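/- Let $d\ge 0$ be an integer, let $W=C_0([0,1],\mathbb R^d)$ be the space of continuous paths started at $0$, and let $\mu$ be the Wiener measure on $W$, so that the coordinate process $(W_t)_{t\in[0,1]}$ is a standard $d$-dimensional Brownian motion. Let $H$ be the Cameron–Martin space of absolutely continuous $h:[0,1]\to\mathbb R^d$ with $h(0)=0$ and $|h|_H^2=\int_0^1|\dot h(s)|^2\,ds<\infty$. Through $h\mapsto\dot h$, identify the Hilbert tensor power $H^{\otimes p}$ with $L^2([0,1]^p;(\mathbb R^d)^{\otimes p})$, i.e. with $L^2\big(([0,1]\times\{1,\dots,d\})^p\big)$ for Lebesgue measure times counting measure, and the symmetric tensor power $H^{\hat\otimes p}$ with the subspace of (a.e.) symmetric kernels. For a symmetric kernel $f\in H^{\hat\otimes p}$ the multiple Wiener integral is the iterated Itô integral $$I_p(f)=p!\int_{t_1<t_2<\dots<t_p<1} f(t_1,\dots,t_p)\,dW_{t_1}\cdots dW_{t_p},\qquad I_0(c)=c .$$ **Theorem.** Let $p,q\ge 0$, $f\in H^{\hat\otimes p}$ and $g\in H^{\hat\otimes q}$. For $0\le i\le p\wedge q$ let $$(f\otimes_i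 g)(t_1,\dots,t_{p-i},s_1,\dots,s_{q-i})=\int f(t_1,\dots,t_{p-i},u_1,\dots,u_i)\,g(s_1,\dots,s_{q-i},u_1,\dots,u_i)\,du_1\cdots du_i ,$$ where each variable ranges over $[0,1]\times\{1,\dots,d\}$ (so that the integral over $[0,1]^i$ also contracts the corresponding $\mathbb R^d$-indices), and let $f\hat\otimes_i g$ be the symmetrization of $f\otimes_i g$ in its $p+q-2i$ variables. Then $f\hat\otimes_i g\in H^{\hat\otimes(p+q-2i)}$ for every such $i$, the multiple Wiener integrals $I_p(f)$, $I_q(g)$ and $I_{p+q-2i}(f\hat\otimes_i g)$ exist, and, for all versions of them, $$I_p(f)\,I_q(g)=\sum_{i=0}^{p\wedge q}\frac{p!\,q!}{i!\,(p-i)!\,(q-i)!}\,I_{p+q-2i}\big(f\hat\otimes_i g\big)\qquad \mu\text{-a.s.}$$ -/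

import Mathlib

open MeasureTheory ProbabilityTheory Filter Topology
open scoped ENNReal

namespace Wiener

/-! ### The classical Wiener space -/

/-- The classical Wiener space `W = C₀([0,1], ℝᵈ)`: continuous paths started at the origin, with
the topology of uniform convergence. -/
abbrev Space (d : ℕ) : Type :=
  {w : C(unitInterval, EuclideanSpace ℝ (Fin d)) // w 0 = 0}

/-- The Borel σ-algebra of the Wiener space. -/
instance instMeasurableSpaceSpace (d : ℕ) : MeasurableSpace (Space d) := borel _

instance instBorelSpaceSpace (d : ℕ) : BorelSpace (Space d) := ⟨rfl⟩

/-- The `j`-th component, at time `t`, of the canonical Wiener process. -/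
def coord {d : ℕ} (t : unitInterval) (j : Fin d) (w : Space d) : ℝ := w.1 t j

/-- `μ` is the Wiener measure: under `μ` the canonical process is a standard `d`-dimensional
Brownian motion, i.e. a centred Gaussian process whose covariance is
`E[W_s^j W_t^k] = δ_{jk} min(s,t)`. There is exactly one such measure. -/
structure IsWienerMeasure {d : ℕ} (μ : Measure (Space d)) : Prop where
  isProbabilityMeasure : IsProbabilityMeasure μ
  isGaussianProcess :
    IsGaussianProcess (fun (e : unitInterval × Fin d) (w : Space d) => coord e.1 e.2 w) μ
  centered : ∀ (t : unitInterval) (j : Fin d), ∫ w, coord t j w ∂μ = 0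
  covariance : ∀ (s t : unitInterval) (j k : Fin d),
    ∫ w, coord s j w * coord t k w ∂μ = if j = k then min (s : ℝ) (t : ℝ) else 0

/-- The σ-algebra `σ(W_s : s ≤ t)` of the canonical filtration. It is completed in
`SimpleProcess` below: `AEStronglyMeasurable[past d t] Y μ` says that `Y` is measurable with
respect to the completion of `past d t` by all `μ`-negligible sets. -/
abbrev past (d : ℕ) (t : unitInterval) : MeasurableSpace (Space d) :=
  ⨆ e : {s : unitInterval // s ≤ t} × Fin d,
    MeasurableSpace.comap (coord e.1.1 e.2) inferInstance

/-! ### Kernels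

Under the isometry `h ↦ ḣ`, the Cameron-Martin space `H` is `L²([0,1], ℝᵈ)`, so `H^{⊗p}` is
`L²([0,1]^p, (ℝᵈ)^{⊗p})`, i.e. the space of square integrable functions on `([0,1] × {1,…,d})^p`,
and `H^{⊗̂p}` is the subspace of its symmetric elements. -/

/-- `[0,1] × {1,…,d}`: a time together with the label of a coordinate. -/
abbrev Idx (d : ℕ) : Type := unitInterval × Fin d

/-- Lebesgue measure on the times times counting measure on the labels. -/
noncomputable def idxMeasure (d : ℕ) : Measure (Idx d) :=
  (volume : Measure unitInterval).prod Measure.count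

/-- The product measure on `([0,1] × {1,…,d})^p`. -/
noncomputable def idxPow (d p : ℕ) : Measure (Fin p → Idx d) :=
  Measure.pi fun _ => idxMeasure d

/-- `f` represents an element of the symmetric Hilbert tensor power `H^{⊗̂p}`. -/
structure IsSymmKernel {d p : ℕ} (f : (Fin p → Idx d) → ℝ) : Prop where
  memLp : MemLp f 2 (idxPow d p)
  symm : ∀ σ : Equiv.Perm (Fin p), (fun x => f (x ∘ σ)) =ᵐ[idxPow d p] f

/-- The contraction in `i` variables, `0 ≤ i ≤ p ∧ q`: the function of
`(t₁,…,t_{p-i},s₁,…,s_{q-i})` given by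
`(f ⊗_i g)(t, s) = ∫ f(t, u₁,…,u_i) g(s, u₁,…,u_i) du₁ ⋯ du_i`. -/
noncomputable def contraction {d p q : ℕ} (i : Fin (min p q + 1))
    (f : (Fin p → Idx d) → ℝ) (g : (Fin q → Idx d) → ℝ) :
    (Fin (p + q - 2 * (i : ℕ)) → Idx d) → ℝ := fun x =>
  ∫ u : Fin (i : ℕ) → Idx d,
    f (Fin.append (fun k : Fin (p - i) => x ⟨k, by have := i.isLt; have := k.isLt; omega⟩) u ∘
        Fin.cast (by have := i.isLt; omega : p = (p - i) + i)) *
    g (Fin.append (fun k : Fin (q - i) => x ⟨(p - i) + k, by have := i.isLt; have := k.isLt; omega⟩) u ∘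
        Fin.cast (by have := i.isLt; omega : q = (q - i) + i)) ∂(idxPow d i)

/-- The symmetrization of a kernel. -/
noncomputable def symmetrization {d n : ℕ} (f : (Fin n → Idx d) → ℝ) : (Fin n → Idx d) → ℝ :=
  fun x => ((n.factorial : ℝ))⁻¹ * ∑ σ : Equiv.Perm (Fin n), f (x ∘ σ)

/-- The symmetrized contraction `f ⊗̂_i g`. -/
noncomputable def symContraction {d p q : ℕ} (i : Fin (min p q + 1))
    (f : (Fin p → Idx d) → ℝ) (g : (Fin q → Idx d) → ℝ) :
    (Fin (p + q - 2 * (i : ℕ)) → Idx d) → ℝ :=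
  symmetrization (contraction i f g)

/-! ### The Itô integral -/

/-- A simple `ℝᵈ`-valued process `∑_k Y_k 1_{(s_k, t_k]} e_{j_k}`, where each `Y_k` is bounded and
measurable with respect to the completed past of time `s_k`. -/
structure SimpleProcess {d : ℕ} (μ : Measure (Space d)) where
  len : ℕ
  left : Fin len → unitInterval
  right : Fin len → unitInterval
  left_le_right : ∀ k, left k ≤ right k
  dir : Fin len → Fin d
  coef : Fin len → Space d → ℝ
  coef_bounded : ∀ k, ∃ C : ℝ, ∀ w, |coef k w| ≤ C
  coef_adapted : ∀ k, AEStronglyMeasurable[past d (left k)] (coef k) μ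

/-- The value of the `e.2`-th component of a simple process at time `e.1`. -/
noncomputable def SimpleProcess.eval {d : ℕ} {μ : Measure (Space d)} (S : SimpleProcess μ)
    (e : Idx d) (w : Space d) : ℝ :=
  ∑ k, if S.left k < e.1 ∧ e.1 ≤ S.right k ∧ e.2 = S.dir k then S.coef k w else 0

/-- The stochastic integral `∑_k Y_k (W_{t_k}^{j_k} - W_{s_k}^{j_k})` of a simple process. -/
noncomputable def SimpleProcess.integral {d : ℕ} {μ : Measure (Space d)} (S : SimpleProcess μ)
    (w : Space d) : ℝ :=
  ∑ k, S.coef k w * (coord (S.right k) (S.dir k) w - coord (S.left k) (S.dir k) w)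

/-- `X` is (a version of) the Itô integral `∑_j ∫₀¹ U_t^j dW_t^j`: the process `U` is the limit in
`L²(dt × dμ)` of simple processes whose integrals converge to `X` in `L²(μ)`. -/
def IsItoIntegral {d : ℕ} (μ : Measure (Space d)) (U : Idx d → Space d → ℝ)
    (X : Space d → ℝ) : Prop :=
  MemLp (Function.uncurry U) 2 ((idxMeasure d).prod μ) ∧ MemLp X 2 μ ∧
  ∃ S : ℕ → SimpleProcess μ,
    Tendsto (fun n => eLpNorm (fun z : Idx d × Space d => U z.1 z.2 - (S n).eval z.1 z.2) 2
      ((idxMeasure d).prod μ)) atTop (𝓝 0) ∧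
    Tendsto (fun n => eLpNorm (fun w => X w - (S n).integral w) 2 μ) atTop (𝓝 0)

/-- `X` is (a version of) the iterated Itô integral
`∫_{t₁ < ⋯ < t_n < 1} f(t₁,…,t_n) dW_{t₁} ⋯ dW_{t_n}`. The outermost integral, in `t = t_n` (with
label `j`), has as its integrand the iterated integral, in `t₁ < ⋯ < t_{n-1}`, of
`1_{t₁,…,t_{n-1} < t} f(·, (t, j))`. -/
def IsIteratedIntegral {d : ℕ} (μ : Measure (Space d)) :
    (n : ℕ) → ((Fin n → Idx d) → ℝ) → (Space d → ℝ) → Prop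
  | 0, f, X => X =ᵐ[μ] fun _ => f Fin.elim0
  | n + 1, f, X => ∃ U : Idx d → Space d → ℝ,
      (∀ᵐ e ∂(idxMeasure d), IsIteratedIntegral μ n
        (fun x => open Classical in
          if ∀ k, (x k).1 < e.1 then f (Fin.snoc (α := fun _ => Idx d) x e) else 0) (U e)) ∧
      IsItoIntegral μ U X

/-- `X` is (a version of) the multiple Wiener integral
`I_p(f) = p! ∫_{t₁ < ⋯ < t_p < 1} f(t₁,…,t_p) dW_{t₁} ⋯ dW_{t_p}`. -/
def IsMultipleWienerIntegral {d p : ℕ} (μ : Measure (Space d))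
    (f : (Fin p → Idx d) → ℝ) (X : Space d → ℝ) : Prop :=
  ∃ J : Space d → ℝ, IsIteratedIntegral μ p f J ∧ X =ᵐ[μ] fun w => (p.factorial : ℝ) * J w

end Wiener

namespace Wiener

section

set_option linter.unusedSimpArgs false

/-! ### Hermite polynomials with a variance parameter -/

/-! Both sides of the product formula are bilinear in the two kernels and continuous with values in
L¹(μ). It is therefore enough to check the formula on a family of symmetric kernels with dense span.
The tensor powers of step functions form such a family: by Ryser's formula the symmetrized indicator
of a box is a combination of them (`mem_of_tpow_mem`).

On tensor powers the formula is algebra. If W(c) is the Wiener integral of c, the iterated integral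
of c^{⊗n} is the normalised Hermite polynomial of W(c) with variance |c|² (`iterInt_tpow`). Put x =
W(c), y = W(c'), α = |c|², β = ⟨c,c'⟩, γ = |c'|². Then exp(sx - s²α/2) exp(ty - t²γ/2) = exp(stβ)
exp(sx + ty - (s²α + 2stβ + t²γ)/2), and comparing coefficients gives `herm_mul_herm`, where βⁱ/i!
multiplies a two-variable Hermite polynomial of degrees p-i, q-i. On the other side, the i-th
contraction of c^{⊗p} with c'^{⊗q} is βⁱ c^{⊗(p-i)} ⊗ c'^{⊗(q-i)}, and expanding (c + tc')^{⊗n} in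
powers of t shows that its symmetrization integrates to the same polynomial, up to βⁱ and a binomial
coefficient (`iterInt_symmetrization_tmul`).

The analysis has to turn a relation, `IsIteratedIntegral`, into a bounded operator. Independence of
past and future gives the Itô isometry for simple processes; hence iterated integration does not
increase L² norms, and its graph is closed (`IsIteratedIntegral.of_tendsto`). Indicators of boxes
over successive time intervals integrate to products of increments, and such boxes are total on the
simplex (`eq_top_of_boxFn_mem`). So every square integrable kernel has an integral, unique almost
surely, and `iterInt` is the resulting operator. Contractions are bounded by Cauchy-Schwarz.

No Itô formula enters `iterInt_tpow`. Testing the Hermite variable G against ordered boxes gives ⟨G,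
I(F)⟩ = ∫ c^{⊗n} F over the simplex for every F, and a comparison of norms then forces G =
I(c^{⊗n}). -/

/-- The sequence `u` shifted to the right by one step, with value `0` at `0`. -/
def shiftRight (u : ℕ → ℝ) : ℕ → ℝ
  | 0 => 0
  | n + 1 => u n

@[simp] lemma shiftRight_zero (u : ℕ → ℝ) : shiftRight u 0 = 0 := rfl

@[simp] lemma shiftRight_succ (u : ℕ → ℝ) (n : ℕ) : shiftRight u (n + 1) = u n := rfl

/-- The normalised Hermite polynomial `H_n(x, λ) / n!`, whose generating function in `s` is
`exp (s x - s² λ / 2)`. -/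
noncomputable def herm (l x : ℝ) : ℕ → ℝ
  | 0 => 1
  | 1 => x
  | n + 2 => (x * herm l x (n + 1) - l * herm l x n) / (n + 2)

@[simp] lemma herm_zero (l x : ℝ) : herm l x 0 = 1 := by rw [herm]

@[simp] lemma herm_one (l x : ℝ) : herm l x 1 = x := by rw [herm]

/-- Coefficient form of ∂ₛ exp(sx - s²l/2) = (x - sl) exp(sx - s²l/2). Multiplication by s is
`shiftRight`, whose value 0 at 0 lets one formula cover n = 0. -/
lemma herm_rec (l x : ℝ) (n : ℕ) :
    (n + 1) * herm l x (n + 1) = x * herm l x n - l * shiftRight (herm l x) n := by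
  cases n with
  | zero => simp
  | succ n =>
    rw [herm, shiftRight_succ]
    push_cast
    field_simp
    ring

lemma herm_rec_two (l x : ℝ) (n : ℕ) :
    (n + 2) * herm l x (n + 2) = x * herm l x (n + 1) - l * herm l x n := by
  have := herm_rec l x (n + 1)
  push_cast at this
  rw [shiftRight_succ] at this
  linear_combination this

/-- The normalised two-variable Hermite polynomials, whose generating function in `s`, `t` is
`exp (s x + t y - (s² α + 2 s t β + t² γ) / 2)`. -/
noncomputable def herm₂ (α β γ x y : ℝ) : ℕ → ℕ → ℝ
  | 0 => herm γ y
  | 1 => fun b => x * herm γ y b - β * shiftRight (herm γ y) b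
  | a + 2 => fun b => (x * herm₂ α β γ x y (a + 1) b - α * herm₂ α β γ x y a b -
      β * shiftRight (herm₂ α β γ x y (a + 1)) b) / (a + 2)

section

variable (α β γ x y : ℝ)

@[simp] lemma herm₂_zero_left (b : ℕ) : herm₂ α β γ x y 0 b = herm γ y b := by rw [herm₂]

lemma herm₂_zero_left' : herm₂ α β γ x y 0 = herm γ y := by rw [herm₂]

/-- The ∂ₛ-equation of the two-variable generating function; the definition is this recurrence
solved for its left side. -/
lemma herm₂_rec_left (a b : ℕ) :
    (a + 1) * herm₂ α β γ x y (a + 1) b = x * herm₂ α β γ x y a b -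
      α * shiftRight (fun a => herm₂ α β γ x y a b) a -
      β * shiftRight (herm₂ α β γ x y a) b := by
  cases a with
  | zero => simp [herm₂]
  | succ a =>
    rw [herm₂, shiftRight_succ]
    push_cast
    field_simp
    ring

/-- The ∂ₜ-equation. The definition favours s, so the symmetry has to be proved: after
multiplication by the degree in s, the left recurrence lowers that degree and the induction
hypothesis applies. The four cases record which shifts vanish. -/
lemma herm₂_rec_right (a b : ℕ) :
    (b + 1) * herm₂ α β γ x y a (b + 1) = y * herm₂ α β γ x y a b -
      γ * shiftRight (herm₂ α β γ x y a) b -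
      β * shiftRight (fun a => herm₂ α β γ x y a b) a := by
  induction a using Nat.strong_induction_on generalizing b with
  | _ a ih =>
  cases a with
  | zero => simpa [herm₂_zero_left'] using herm_rec γ y b
  | succ a =>
    have ha : ((a : ℝ) + 1) ≠ 0 := by positivity
    have L := herm₂_rec_left α β γ x y
    have i0 := ih a (by omega)
    cases a with
    | zero =>
      cases b with
      | zero =>
        have e1 := L 0 1; have e2 := L 0 0
        simp at e1 e2
        apply mul_left_cancel₀ ha
        push_cast
        simp only [shiftRight_succ, shiftRight_zero, zero_add, herm₂_zero_left', mul_zero,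
          sub_zero, one_mul]
        simp only [herm_zero, herm_one]
        linear_combination e1 - y * e2
      | succ b =>
        have e1 := L 0 (b + 2); have e2 := L 0 (b + 1); have e3 := i0 (b + 1)
        have e4 := L 0 b; have e5 := i0 b
        simp at e1 e2 e3 e4 e5
        apply mul_left_cancel₀ ha
        push_cast
        simp only [shiftRight_succ, shiftRight_zero, zero_add, herm₂_zero_left', mul_zero,
          sub_zero, one_mul]
        linear_combination (b + 2) * e1 + x * e3 - y * e2 + γ * e4 - β * e5
    | succ a =>
      have i1 := ih a (by omega)
      cases b with
      | zero =>
        have e1 := L (a + 1) 1; have e2 := L (a + 1) 0; have e3 := i0 0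
        have f1 := i1 0; have f2 := L a 0
        simp at e1 e2 e3 f1 f2
        apply mul_left_cancel₀ ha
        push_cast
        simp only [shiftRight_succ, shiftRight_zero, zero_add, herm₂_zero_left', mul_zero,
          sub_zero, one_mul]
        linear_combination e1 + x * e3 - y * e2 - α * f1 + β * f2
      | succ b =>
        have e1 := L (a + 1) (b + 2); have e2 := L (a + 1) (b + 1); have e3 := i0 (b + 1)
        have e4 := L (a + 1) b; have e5 := i0 b; have f1 := i1 (b + 1); have f2 := L a (b + 1)
        simp at e1 e2 e3 e4 e5 f1 f2
        apply mul_left_cancel₀ ha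
        push_cast
        simp only [shiftRight_succ, shiftRight_zero, zero_add, herm₂_zero_left', mul_zero,
          sub_zero, one_mul]
        linear_combination (b + 2) * e1 + x * e3 - y * e2 + γ * e4 - β * e5 - α * f1 + β * f2

/-- The Hermite polynomial of a linear combination. -/
lemma herm_add_mul (t : ℝ) (n : ℕ) :
    herm (α + 2 * t * β + t ^ 2 * γ) (x + t * y) n =
      ∑ k ∈ Finset.HasAntidiagonal.antidiagonal n, t ^ k.2 * herm₂ α β γ x y k.1 k.2 := by
  -- The candidate `B` is shown to satisfy the recurrence that determines `herm`.
  set B : ℕ → ℝ := fun n => ∑ k ∈ Finset.HasAntidiagonal.antidiagonal n, t ^ k.2 * herm₂ α β γ x y k.1 k.2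
    with hB
  have hA : ∀ n, ∑ k ∈ Finset.HasAntidiagonal.antidiagonal n,
      t ^ k.2 * shiftRight (fun a => herm₂ α β γ x y a k.2) k.1 = shiftRight B n := by
    intro n
    cases n with
    | zero => simp
    | succ n => simp [Finset.Nat.antidiagonal_succ, hB]
  have hC : ∀ n, ∑ k ∈ Finset.HasAntidiagonal.antidiagonal n,
      t ^ k.2 * shiftRight (herm₂ α β γ x y k.1) k.2 = t * shiftRight B n := by
    intro n
    cases n with
    | zero => simp
    | succ n =>
      simp only [Finset.Nat.antidiagonal_succ', hB]
      simp [pow_succ, mul_assoc, mul_comm, mul_left_comm, Finset.mul_sum]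
  have hrec : ∀ n : ℕ, ((n : ℝ) + 1) * B (n + 1) =
      (x + t * y) * B n - (α + 2 * t * β + t ^ 2 * γ) * shiftRight B n := by
    intro n
    -- On the antidiagonal n + 1 = k.1 + k.2; each part of the factor feeds one of the two
    -- recurrences.
    have h1 : ((n : ℝ) + 1) * B (n + 1) =
        ∑ k ∈ Finset.HasAntidiagonal.antidiagonal n,
          t ^ k.2 * (((k.1 : ℝ) + 1) * herm₂ α β γ x y (k.1 + 1) k.2) +
        ∑ k ∈ Finset.HasAntidiagonal.antidiagonal n,
          t ^ (k.2 + 1) * (((k.2 : ℝ) + 1) * herm₂ α β γ x y k.1 (k.2 + 1)) := by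
      have h2 : ((n : ℝ) + 1) * B (n + 1) =
          ∑ k ∈ Finset.HasAntidiagonal.antidiagonal (n + 1), t ^ k.2 * (k.1 * herm₂ α β γ x y k.1 k.2) +
          ∑ k ∈ Finset.HasAntidiagonal.antidiagonal (n + 1), t ^ k.2 * (k.2 * herm₂ α β γ x y k.1 k.2) := by
        rw [hB, Finset.mul_sum, ← Finset.sum_add_distrib]
        refine Finset.sum_congr rfl fun k hk => ?_
        have : ((k.1 : ℝ) + k.2) = n + 1 := by exact_mod_cast Finset.HasAntidiagonal.mem_antidiagonal.1 hk
        rw [← this]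
        ring
      rw [h2]
      congr 1
      · rw [Finset.Nat.antidiagonal_succ]
        simp
      · rw [Finset.Nat.antidiagonal_succ']
        simp
    rw [h1]
    simp only [herm₂_rec_left, herm₂_rec_right]
    have e1 := hA n
    have e2 := hC n
    have e3 : B n = ∑ k ∈ Finset.HasAntidiagonal.antidiagonal n, t ^ k.2 * herm₂ α β γ x y k.1 k.2 := rfl
    have : ∀ k : ℕ × ℕ,
        t ^ k.2 * (x * herm₂ α β γ x y k.1 k.2 -
          α * shiftRight (fun a => herm₂ α β γ x y a k.2) k.1 -
          β * shiftRight (herm₂ α β γ x y k.1) k.2) +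
        t ^ (k.2 + 1) * (y * herm₂ α β γ x y k.1 k.2 -
          γ * shiftRight (herm₂ α β γ x y k.1) k.2 -
          β * shiftRight (fun a => herm₂ α β γ x y a k.2) k.1) =
        (x + t * y) * (t ^ k.2 * herm₂ α β γ x y k.1 k.2) -
        (α + t * β) * (t ^ k.2 * shiftRight (fun a => herm₂ α β γ x y a k.2) k.1) -
        (β + t * γ) * (t ^ k.2 * shiftRight (herm₂ α β γ x y k.1) k.2) := by
      intro k; ring
    rw [← Finset.sum_add_distrib, Finset.sum_congr rfl (fun k _ => this k),
      Finset.sum_sub_distrib, Finset.sum_sub_distrib, ← Finset.mul_sum, ← Finset.mul_sum,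
      ← Finset.mul_sum, e1, e2, ← e3]
    ring
  suffices h : ∀ n, herm (α + 2 * t * β + t ^ 2 * γ) (x + t * y) n = B n from h n
  intro n
  induction n using Nat.strong_induction_on with
  | _ n ih =>
  cases n with
  | zero => simp [hB]
  | succ n =>
    have hn : ((n : ℝ) + 1) ≠ 0 := by positivity
    apply mul_left_cancel₀ hn
    rw [hrec, herm_rec, ih n (by omega)]
    cases n with
    | zero => simp
    | succ n => simp [ih n (by omega)]

/-- The product formula for Hermite polynomials. -/
lemma herm_mul_herm (p q : ℕ) :
    herm α x p * herm γ y q = ∑ i ∈ Finset.range (min p q + 1),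
      β ^ i / (i.factorial : ℝ) * herm₂ α β γ x y (p - i) (q - i) := by
  -- The terms are extended by zero so that the sums for p + 1, p and p - 1 share one range.
  set T : ℕ → ℕ → ℝ := fun p i =>
    if i ≤ p ∧ i ≤ q then β ^ i / (i.factorial : ℝ) * herm₂ α β γ x y (p - i) (q - i) else 0
    with hT
  have hsum : ∀ p N, p ≤ N → ∑ i ∈ Finset.range (min p q + 1),
      β ^ i / (i.factorial : ℝ) * herm₂ α β γ x y (p - i) (q - i) =
      ∑ i ∈ Finset.range (N + 1), T p i := by
    intro p N hN
    rw [← Finset.sum_subset (s₁ := Finset.range (min p q + 1))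
      (f := T p) (s₂ := Finset.range (N + 1))]
    · refine Finset.sum_congr rfl fun i hi => ?_
      simp only [Finset.mem_range] at hi
      simp only [hT]
      rw [if_pos (by omega)]
    · intro i; simp only [Finset.mem_range]; omega
    · intro i _ hi
      simp only [Finset.mem_range] at hi
      simp only [hT]
      rw [if_neg (by omega)]
  -- Termwise, the recurrence of `herm` in p holds up to a telescoping error: p + 1 = (p + 1 - i) +
  -- i, and the β-term of the recurrence for `herm₂` is the multiple (i + 1) of the next summand.
  have hrec : ∀ p i, (p + 1) * T (p + 1) i = x * T p i - α * shiftRight (fun p => T p i) p +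
      (i * T (p + 1) i - (i + 1) * T (p + 1) (i + 1)) := by
    intro p i
    have key : ∀ i, i ≤ p → i + 1 ≤ q →
        ((i : ℝ) + 1) * T (p + 1) (i + 1) =
          β * (β ^ i / (i.factorial : ℝ) * herm₂ α β γ x y (p - i) (q - i - 1)) := by
      intro i hi hq
      simp only [hT]
      rw [if_pos (by omega), Nat.factorial_succ, show p + 1 - (i + 1) = p - i by omega,
        show q - (i + 1) = q - i - 1 by omega]
      push_cast
      have : (i.factorial : ℝ) ≠ 0 := by positivity
      field_simp
      ring
    by_cases hq : i ≤ q
    swap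
    · have h1 : ∀ p, T p i = 0 := fun p => by simp only [hT]; rw [if_neg (by omega)]
      have h2 : T (p + 1) (i + 1) = 0 := by simp only [hT]; rw [if_neg (by omega)]
      cases p <;> simp [h1, h2]
    by_cases hp : i ≤ p
    · have hr := herm₂_rec_left α β γ x y (p - i) (q - i)
      have h1 : T (p + 1) i = β ^ i / (i.factorial : ℝ) *
          herm₂ α β γ x y (p - i + 1) (q - i) := by
        simp only [hT]; rw [if_pos (by omega), show p + 1 - i = p - i + 1 by omega]
      have h2 : T p i = β ^ i / (i.factorial : ℝ) * herm₂ α β γ x y (p - i) (q - i) := by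
        simp only [hT]; rw [if_pos (by omega)]
      have h3 : shiftRight (fun p => T p i) p = β ^ i / (i.factorial : ℝ) *
          shiftRight (fun a => herm₂ α β γ x y a (q - i)) (p - i) := by
        rcases Nat.eq_or_lt_of_le hp with rfl | hlt
        · cases i with
          | zero => simp
          | succ i => simp [hT]
        · obtain ⟨k, rfl⟩ := Nat.exists_eq_add_of_lt hlt
          rw [shiftRight_succ, show i + k + 1 - i = k + 1 by omega, shiftRight_succ]
          simp only [hT]
          rw [if_pos (by omega), show i + k - i = k by omega]
      have h4 : ((i : ℝ) + 1) * T (p + 1) (i + 1) = β * (β ^ i / (i.factorial : ℝ) *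
          shiftRight (herm₂ α β γ x y (p - i)) (q - i)) := by
        rcases Nat.eq_or_lt_of_le hq with rfl | hlt
        · simp [hT]
        · rw [key i hp hlt]
          obtain ⟨k, rfl⟩ := Nat.exists_eq_add_of_lt hlt
          rw [show i + k + 1 - i = k + 1 by omega, shiftRight_succ, Nat.add_sub_cancel]
      rw [h4, h1, h2, h3]
      push_cast [Nat.cast_sub hp] at hr
      linear_combination (β ^ i / (i.factorial : ℝ)) * hr
    · have h2 : T p i = 0 := by simp only [hT]; rw [if_neg (by omega)]
      have h4 : T (p + 1) (i + 1) = 0 := by simp only [hT]; rw [if_neg (by omega)]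
      have h3 : shiftRight (fun p => T p i) p = 0 := by
        cases p with
        | zero => rfl
        | succ p => simp only [hT, shiftRight_succ]; rw [if_neg (by omega)]
      rw [h2, h3, h4]
      by_cases hip : i = p + 1
      · subst hip; push_cast; ring
      · have h1 : T (p + 1) i = 0 := by simp only [hT]; rw [if_neg (by omega)]
        rw [h1]; ring
  induction p using Nat.strong_induction_on with
  | _ p ih =>
  cases p with
  | zero => simp
  | succ p =>
    have hp : ((p : ℝ) + 1) ≠ 0 := by positivity
    apply mul_left_cancel₀ hp
    rw [hsum (p + 1) (p + 1) le_rfl, ← mul_assoc, herm_rec, Finset.mul_sum]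
    simp only [hrec]
    have htel : ∑ i ∈ Finset.range (p + 1 + 1),
        ((i : ℝ) * T (p + 1) i - ((i : ℝ) + 1) * T (p + 1) (i + 1)) = 0 := by
      have h := Finset.sum_range_sub' (fun i : ℕ => (i : ℝ) * T (p + 1) i) (p + 1 + 1)
      have h0 : T (p + 1) (p + 1 + 1) = 0 := by simp only [hT]; rw [if_neg (by omega)]
      push_cast at h
      rw [h, h0]
      simp
    rw [Finset.sum_add_distrib, htel, add_zero, Finset.sum_sub_distrib, ← Finset.mul_sum, ← Finset.mul_sum,
      ← hsum p (p + 1) (by omega), ← ih p (by omega)]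
    cases p with
    | zero => simp
    | succ p =>
      simp only [shiftRight_succ]
      rw [← hsum p (p + 1 + 1) (by omega), ← ih p (by omega)]
      ring

end

/-- The two-variable Hermite polynomial of degree one in `y`. -/
lemma herm₂_one_right (α β γ x y : ℝ) (a : ℕ) :
    herm₂ α β γ x y a 1 = y * herm₂ α β γ x y a 0 -
      β * shiftRight (fun a => herm₂ α β γ x y a 0) a := by
  simpa using herm₂_rec_right α β γ x y a 0

lemma herm₂_zero_right (α β γ x y : ℝ) (a : ℕ) : herm₂ α β γ x y a 0 = herm α x a := by
  simpa using (herm_mul_herm α β γ x y a 0).symm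

/-- This is the case β = 0: the generating function factors, and only i = 0 survives in the product
formula. -/
lemma herm_add (l m x y : ℝ) (n : ℕ) :
    herm (l + m) (x + y) n = ∑ k ∈ Finset.HasAntidiagonal.antidiagonal n, herm l x k.1 * herm m y k.2 := by
  have h := herm_add_mul l 0 m x y 1 n
  simp only [mul_zero, one_pow, one_mul, add_zero] at h
  rw [h]
  refine Finset.sum_congr rfl fun k _ => ?_
  rw [herm_mul_herm l 0 m x y k.1 k.2, Finset.sum_range_succ']
  simp

/-- ∂ₓ multiplies the generating function by s, so differentiation is a shift. -/
lemma hasDerivAt_herm (l x : ℝ) (n : ℕ) :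
    HasDerivAt (fun x => herm l x n) (shiftRight (herm l x) n) x := by
  induction n using Nat.strong_induction_on with
  | _ n ih =>
  match n with
  | 0 => simpa using hasDerivAt_const x (1 : ℝ)
  | 1 => simpa using hasDerivAt_id' x
  | n + 2 =>
    have h := (((hasDerivAt_id x).mul (ih (n + 1) (by omega))).sub
      ((ih n (by omega)).const_mul l)).div_const ((n : ℝ) + 2)
    have e : (fun x => herm l x (n + 2)) = fun x =>
        (id x * herm l x (n + 1) - l * herm l x n) / ((n : ℝ) + 2) := by
      ext x; rw [herm]; rfl
    rw [e]
    refine h.congr_deriv ?_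
    rw [shiftRight_succ, div_eq_iff (by positivity)]
    have := herm_rec l x n
    simp only [shiftRight_succ, id, one_mul]
    linear_combination -this

lemma continuous_herm (l : ℝ) (n : ℕ) : Continuous fun x => herm l x n :=
  continuous_iff_continuousAt.2 fun x => (hasDerivAt_herm l x n).continuousAt

end

section

variable {d : ℕ} {μ : Measure (Space d)}

/-! ### Random variables with moments of all orders -/

/-- All the moments of `X` are finite. -/
def HasFiniteMoments {Ω : Type*} {m : MeasurableSpace Ω} (X : Ω → ℝ) (μ : Measure Ω) : Prop :=
  ∀ p : ℝ≥0∞, p ≠ ∞ → MemLp X p μ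

/-! ### Stability of finite moments under the operations that build Hermite polynomials. -/

namespace HasFiniteMoments

variable {Ω : Type*} {m : MeasurableSpace Ω} {μ : Measure Ω} {X Y : Ω → ℝ}

lemma memLp_two (hX : HasFiniteMoments X μ) : MemLp X 2 μ := hX 2 (by simp)

lemma integrable (hX : HasFiniteMoments X μ) : Integrable X μ :=
  memLp_one_iff_integrable.1 (hX 1 (by simp))

lemma const [IsFiniteMeasure μ] (c : ℝ) : HasFiniteMoments (fun _ => c) μ :=
  fun _ _ => memLp_const c

lemma add (hX : HasFiniteMoments X μ) (hY : HasFiniteMoments Y μ) :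
    HasFiniteMoments (fun w => X w + Y w) μ := fun p hp => (hX p hp).add (hY p hp)

lemma sub (hX : HasFiniteMoments X μ) (hY : HasFiniteMoments Y μ) :
    HasFiniteMoments (fun w => X w - Y w) μ := fun p hp => (hX p hp).sub (hY p hp)

lemma const_mul (hX : HasFiniteMoments X μ) (c : ℝ) :
    HasFiniteMoments (fun w => c * X w) μ := fun p hp => (hX p hp).const_mul c

/-- Hölder with exponents 2p, 2p. This closure under products is why all moments are asked for
instead of a fixed one. -/
lemma mul (hX : HasFiniteMoments X μ) (hY : HasFiniteMoments Y μ) :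
    HasFiniteMoments (fun w => X w * Y w) μ := by
  intro p hp
  have h2 : (2 * p) ≠ ∞ := ENNReal.mul_ne_top (by simp) hp
  have : ENNReal.HolderTriple (2 * p) (2 * p) p := ⟨by
    rw [ENNReal.mul_inv (by simp) (by simp), ← add_mul, ENNReal.inv_two_add_inv_two, one_mul]⟩
  exact (hY _ h2).mul' (hX _ h2)

lemma prod [IsFiniteMeasure μ] {ι : Type*} {s : Finset ι} {X : ι → Ω → ℝ}
    (hX : ∀ i ∈ s, HasFiniteMoments (X i) μ) : HasFiniteMoments (fun w => ∏ i ∈ s, X i w) μ := by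
  classical
  induction s using Finset.induction_on with
  | empty => simpa using const 1
  | insert a s ha ih =>
    simp only [Finset.prod_insert ha]
    exact (hX a (Finset.mem_insert_self _ _)).mul
      (ih fun i hi => hX i (Finset.mem_insert_of_mem hi))

lemma herm [IsFiniteMeasure μ] (hX : HasFiniteMoments X μ) (l : ℝ) (n : ℕ) :
    HasFiniteMoments (fun w => herm l (X w) n) μ := by
  induction n using Nat.strong_induction_on with
  | _ n ih =>
  match n with
  | 0 => simpa using const 1
  | 1 => simpa using hX
  | n + 2 =>
    have h := ((hX.mul (ih (n + 1) (by omega))).sub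
      ((ih n (by omega)).const_mul l)).const_mul ((n : ℝ) + 2)⁻¹
    convert h using 2 with w
    rw [Wiener.herm]
    ring

end HasFiniteMoments

/-! ### Gaussian integration by parts -/

lemma hasFiniteMoments_gaussianReal (v : NNReal) :
    HasFiniteMoments (fun x => x) (gaussianReal 0 v) :=
  fun p hp => memLp_id_gaussianReal' p hp

lemma hasDerivAt_gaussianPDFReal (v : NNReal) (x : ℝ) :
    HasDerivAt (gaussianPDFReal 0 v) (-(x / v) * gaussianPDFReal 0 v x) x := by
  rw [gaussianPDFReal_def]
  have h1 : HasDerivAt (fun x : ℝ => -(x - 0) ^ 2 / (2 * (v : ℝ))) (-(x / v)) x := by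
    have := (((hasDerivAt_id' x).sub_const 0).pow 2).neg.div_const (2 * (v : ℝ))
    refine this.congr_deriv ?_
    -- For zero variance both sides are zero, since division by zero gives zero.
    by_cases hv : (v : ℝ) = 0
    · simp [hv]
    · field_simp
      simp [mul_comm]
  refine (h1.exp.const_mul ((√(2 * Real.pi * v))⁻¹)).congr_deriv ?_
  ring

lemma integrable_gaussianPDFReal_mul {v : NNReal} (hv : v ≠ 0) {f : ℝ → ℝ}
    (hf : Integrable f (gaussianReal 0 v)) :
    Integrable fun x => gaussianPDFReal 0 v x * f x := by
  rw [gaussianReal_of_var_ne_zero _ hv, integrable_withDensity_iff_integrable_smul'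
    (measurable_gaussianPDF _ _) (ae_of_all _ fun _ => gaussianPDF_lt_top)] at hf
  simpa using hf

/-- Stein's identity. -/
lemma integral_id_mul_gaussianReal (v : NNReal) {f f' : ℝ → ℝ}
    (hd : ∀ x, HasDerivAt f (f' x) x) (hf : HasFiniteMoments f (gaussianReal 0 v))
    (hf' : HasFiniteMoments f' (gaussianReal 0 v)) :
    ∫ x, x * f x ∂(gaussianReal 0 v) = v * ∫ x, f' x ∂(gaussianReal 0 v) := by
  -- Zero variance means the Dirac mass at 0, where both integrals are annihilated.
  by_cases hv : v = 0
  · subst hv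
    simp
  have hv' : (v : ℝ) ≠ 0 := by exact_mod_cast hv
  have h1 := integrable_gaussianPDFReal_mul hv
    (((hasFiniteMoments_gaussianReal v).mul hf).const_mul (-(v : ℝ)⁻¹)).integrable
  have h2 := integrable_gaussianPDFReal_mul hv hf'.integrable
  have h3 := integrable_gaussianPDFReal_mul hv hf.integrable
  -- Integration by parts against the density, whose derivative is -(x/v) times itself.
  have := integral_mul_deriv_eq_deriv_mul_of_integrable (u := f) (u' := f')
    (v := gaussianPDFReal 0 v) (v' := fun x => -(x / v) * gaussianPDFReal 0 v x)
    (fun x _ => hd x) (fun x _ => hasDerivAt_gaussianPDFReal v x)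
    (h1.congr (ae_of_all _ fun x => by simp only [Pi.mul_apply]; ring))
    (h2.congr (ae_of_all _ fun x => by simp only [Pi.mul_apply]; ring))
    (h3.congr (ae_of_all _ fun x => by simp only [Pi.mul_apply]; ring))
  rw [integral_gaussianReal_eq_integral_smul hv, integral_gaussianReal_eq_integral_smul hv]
  simp only [smul_eq_mul]
  have e1 : ∫ x, f x * (-(x / v) * gaussianPDFReal 0 v x) =
      -(v : ℝ)⁻¹ * ∫ x, gaussianPDFReal 0 v x * (x * f x) := by
    rw [← integral_const_mul]
    congr 1; ext x; ring
  have e2 : ∫ x, f' x * gaussianPDFReal 0 v x = ∫ x, gaussianPDFReal 0 v x * f' x := by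
    congr 1; ext x; ring
  rw [e1, e2] at this
  rw [neg_mul, neg_inj] at this
  rw [← this, mul_inv_cancel_left₀ hv']

lemma hasFiniteMoments_herm_gaussianReal (v : NNReal) (l : ℝ) (n : ℕ) :
    HasFiniteMoments (fun x => herm l x n) (gaussianReal 0 v) :=
  (hasFiniteMoments_gaussianReal v).herm l n

lemma integral_id_mul_herm_mul_herm (v : NNReal) (m n : ℕ) :
    ∫ x, x * (herm v x (m + 1) * herm v x (n + 1)) ∂(gaussianReal 0 v) =
      v * ∫ x, (herm v x m * herm v x (n + 1) + herm v x (m + 1) * herm v x n)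
        ∂(gaussianReal 0 v) := by
  have F := hasFiniteMoments_herm_gaussianReal v v
  refine integral_id_mul_gaussianReal v (fun x => ?_) ((F _).mul (F _))
    (((F _).mul (F _)).add ((F _).mul (F _)))
  exact (hasDerivAt_herm v x (m + 1)).mul (hasDerivAt_herm v x (n + 1))

/-- By Stein's identity the mean of x Hₙ₊₁ is v times the mean of Hₙ, which cancels the second term
of the recurrence for Hₙ₊₂. -/
lemma integral_herm_succ_gaussianReal (v : NNReal) (n : ℕ) :
    ∫ x, herm v x (n + 1) ∂(gaussianReal 0 v) = 0 := by
  have F := hasFiniteMoments_herm_gaussianReal v v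
  have X := hasFiniteMoments_gaussianReal v
  cases n with
  | zero => simp
  | succ n =>
    have h : ((n : ℝ) + 2) * ∫ x, herm v x (n + 2) ∂(gaussianReal 0 v) = 0 := by
      rw [← integral_const_mul]
      simp only [herm_rec_two]
      rw [integral_sub (X.mul (F _)).integrable ((F _).const_mul _).integrable,
        integral_id_mul_gaussianReal v (fun x => hasDerivAt_herm v x (n + 1)) (F _)
          (by simpa using F n), integral_const_mul]
      simp
    rcases mul_eq_zero.1 h with h | h
    · exact absurd h (by positivity)
    · exact h

/-- Induction through (n + 1) E[Hₙ₊₁²] = v E[Hₙ²]. Multiply the recurrence by Hₙ₊₁ and apply Stein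
to x Hₙ Hₙ₊₁: the terms Hₙ₋₁ Hₙ₊₁ cancel, so no orthogonality is needed. -/
lemma integral_herm_sq_gaussianReal (v : NNReal) (n : ℕ) :
    ∫ x, herm v x n ^ 2 ∂(gaussianReal 0 v) = (v : ℝ) ^ n / n.factorial := by
  have F := hasFiniteMoments_herm_gaussianReal v v
  have X := hasFiniteMoments_gaussianReal v
  induction n with
  | zero => simp
  | succ n ih =>
    have key : ((n : ℝ) + 1) * ∫ x, herm v x (n + 1) ^ 2 ∂(gaussianReal 0 v) =
        v * ∫ x, herm v x n ^ 2 ∂(gaussianReal 0 v) := by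
      rw [← integral_const_mul]
      cases n with
      | zero =>
        have := integral_id_mul_gaussianReal v (f := fun x => x) (f' := fun _ => 1)
          (fun x => hasDerivAt_id' x) X (HasFiniteMoments.const 1)
        simpa [sq] using this
      | succ n =>
        have e : ∀ x, (((n + 1 : ℕ) : ℝ) + 1) * herm v x (n + 1 + 1) ^ 2 =
            x * (herm v x (n + 1) * herm v x (n + 1 + 1)) -
              v * (herm v x n * herm v x (n + 1 + 1)) := by
          intro x
          have := herm_rec v x (n + 1)
          rw [shiftRight_succ] at this
          linear_combination herm v x (n + 1 + 1) * this
        simp only [e]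
        rw [integral_sub (X.mul ((F _).mul (F _))).integrable
          (((F _).mul (F _)).const_mul _).integrable, integral_id_mul_herm_mul_herm,
          integral_add ((F _).mul (F _)).integrable ((F _).mul (F _)).integrable,
          integral_const_mul]
        simp only [sq]
        ring
    rw [ih] at key
    have hn : ((n : ℝ) + 1) ≠ 0 := by positivity
    apply mul_left_cancel₀ hn
    rw [key, Nat.factorial_succ]
    push_cast
    field_simp
    ring

/-! ### Transfer of the Hermite moments to centred Gaussian random variables. -/

section Gaussian

variable {Ω : Type*} {m : MeasurableSpace Ω} {μ : Measure Ω} {N : Ω → ℝ}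

lemma hasFiniteMoments_of_hasGaussianLaw (hN : HasGaussianLaw N μ) : HasFiniteMoments N μ :=
  fun _ hp => hN.memLp hp

/-- A centred Gaussian law is determined by its second moment. -/
lemma map_eq_gaussianReal_of_centered (hN : HasGaussianLaw N μ) (h0 : ∫ w, N w ∂μ = 0) :
    μ.map N = gaussianReal 0 (∫ w, N w ^ 2 ∂μ).toNNReal := by
  have := hN.isProbabilityMeasure
  rw [hN.map_eq_gaussianReal, h0, variance_of_integral_eq_zero hN.aemeasurable h0]

lemma integral_herm_succ (hN : HasGaussianLaw N μ) (h0 : ∫ w, N w ∂μ = 0) {l : ℝ}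
    (hl : ∫ w, N w ^ 2 ∂μ = l) (n : ℕ) : ∫ w, herm l (N w) (n + 1) ∂μ = 0 := by
  have hl0 : 0 ≤ l := hl ▸ integral_nonneg fun _ => sq_nonneg _
  have h := integral_herm_succ_gaussianReal l.toNNReal n
  rw [← hl, ← map_eq_gaussianReal_of_centered hN h0, hl, Real.coe_toNNReal _ hl0,
    integral_map hN.aemeasurable (continuous_herm _ _).aestronglyMeasurable] at h
  exact h

lemma integral_herm_sq (hN : HasGaussianLaw N μ) (h0 : ∫ w, N w ∂μ = 0) {l : ℝ}
    (hl : ∫ w, N w ^ 2 ∂μ = l) (n : ℕ) :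
    ∫ w, herm l (N w) n ^ 2 ∂μ = l ^ n / n.factorial := by
  have hl0 : 0 ≤ l := hl ▸ integral_nonneg fun _ => sq_nonneg _
  have h := integral_herm_sq_gaussianReal l.toNNReal n
  rw [← hl, ← map_eq_gaussianReal_of_centered hN h0, hl, Real.coe_toNNReal _ hl0,
    integral_map (f := fun x => herm l x n ^ 2) hN.aemeasurable
      ((continuous_herm _ _).pow 2).aestronglyMeasurable] at h
  exact h

end Gaussian

/-- A polynomial function that vanishes on infinitely many points has vanishing coefficients. -/
lemma coeff_eq_zero_of_forall_eq_zero {n : ℕ} {c : ℕ → ℝ} {s : Set ℝ} (hs : s.Infinite)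
    (h : ∀ t ∈ s, ∑ k ∈ Finset.range (n + 1), c k * t ^ k = 0) {k : ℕ} (hk : k ≤ n) :
    c k = 0 := by
  set P : Polynomial ℝ := ∑ k ∈ Finset.range (n + 1), Polynomial.monomial k (c k) with hP
  have h0 : P = 0 := Polynomial.eq_zero_of_infinite_isRoot P <| hs.mono fun t ht => by
    simpa [hP, Polynomial.IsRoot, Polynomial.eval_finsetSum] using h t ht
  have : P.coeff k = c k := by
    simp [hP, Polynomial.coeff_monomial, hk]
  rw [← this, h0, Polynomial.coeff_zero]

end

section

variable {d : ℕ} {μ : Measure (Space d)}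

/-! ### The index space -/

instance instIsFiniteMeasureIdxMeasure : IsFiniteMeasure (idxMeasure d) := by
  unfold idxMeasure; infer_instance

instance instIsFiniteMeasureIdxPow (n : ℕ) : IsFiniteMeasure (idxPow d n) := by
  unfold idxPow; infer_instance

lemma idxMeasure_prod_singleton (s : Set unitInterval) (j : Fin d) :
    idxMeasure d (s ×ˢ {j}) = volume s := by
  rw [idxMeasure, Measure.prod_prod]
  simp

/-- The indicator function of `[0, e.1] × {e.2}`. -/
noncomputable def corner (e : Idx d) : Idx d → ℝ :=
  (Set.Iic e.1 ×ˢ {e.2}).indicator 1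

/-- The step functions, as linear combinations of the indicators of `[0, t] × {j}`. -/
noncomputable def step : (Idx d →₀ ℝ) →ₗ[ℝ] (Idx d → ℝ) := Finsupp.linearCombination ℝ corner

/-- The Wiener integral of a step function. -/
noncomputable def wien : (Idx d →₀ ℝ) →ₗ[ℝ] (Space d → ℝ) :=
  Finsupp.linearCombination ℝ fun e => coord e.1 e.2

/-- The restriction of a step function to the time interval `[0, s]`. -/
noncomputable def cut (s : unitInterval) : (Idx d →₀ ℝ) →ₗ[ℝ] (Idx d →₀ ℝ) :=
  Finsupp.lmapDomain ℝ ℝ fun e => (min e.1 s, e.2)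

lemma measurableSet_corner (e : Idx d) : MeasurableSet (Set.Iic e.1 ×ˢ {e.2} : Set (Idx d)) :=
  measurableSet_Iic.prod (measurableSet_singleton _)

lemma measurable_corner (e : Idx d) : Measurable (corner e) :=
  measurable_one.indicator (measurableSet_corner e)

lemma abs_corner_le (e x : Idx d) : |corner e x| ≤ 1 := by
  unfold corner
  by_cases h : x ∈ (Set.Iic e.1 ×ˢ {e.2} : Set (Idx d)) <;> simp [h]

lemma step_single (e : Idx d) (r : ℝ) : step (Finsupp.single e r) = r • corner e :=
  Finsupp.linearCombination_single ..

lemma wien_single (e : Idx d) (r : ℝ) : wien (Finsupp.single e r) = r • coord e.1 e.2 :=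
  Finsupp.linearCombination_single ..

lemma cut_single (s : unitInterval) (e : Idx d) (r : ℝ) :
    cut s (Finsupp.single e r) = Finsupp.single (min e.1 s, e.2) r :=
  Finsupp.mapDomain_single

lemma measurable_step (c : Idx d →₀ ℝ) : Measurable (step c) := by
  induction c using Finsupp.induction_linear with
  | zero => simpa using measurable_zero
  | add a b ha hb => rw [map_add]; exact ha.add hb
  | single e r => rw [step_single]; exact (measurable_corner e).const_smul r

lemma exists_abs_step_le (c : Idx d →₀ ℝ) : ∃ C : ℝ, ∀ x, |step c x| ≤ C := by
  induction c using Finsupp.induction_linear with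
  | zero => exact ⟨0, by simp⟩
  | add a b ha hb =>
    obtain ⟨A, hA⟩ := ha
    obtain ⟨B, hB⟩ := hb
    refine ⟨A + B, fun x => ?_⟩
    rw [map_add]
    exact (abs_add_le _ _).trans (add_le_add (hA x) (hB x))
  | single e r =>
    refine ⟨|r|, fun x => ?_⟩
    rw [step_single, Pi.smul_apply, smul_eq_mul, abs_mul]
    exact mul_le_of_le_one_right (abs_nonneg _) (abs_corner_le e x)

lemma integrable_step_mul_step (c c' : Idx d →₀ ℝ) :
    Integrable (fun x => step c x * step c' x) (idxMeasure d) := by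
  obtain ⟨C, hC⟩ := exists_abs_step_le c
  obtain ⟨C', hC'⟩ := exists_abs_step_le c'
  refine Integrable.of_bound ((measurable_step c).mul (measurable_step c')).aestronglyMeasurable
    (C * C') (ae_of_all _ fun x => ?_)
  rw [Real.norm_eq_abs, abs_mul]
  exact mul_le_mul (hC x) (hC' x) (abs_nonneg _) ((abs_nonneg _).trans (hC x))

lemma step_cut (s : unitInterval) (c : Idx d →₀ ℝ) (x : Idx d) :
    step (cut s c) x = if x.1 ≤ s then step c x else 0 := by
  induction c using Finsupp.induction_linear with
  | zero => simp
  | add a b ha hb => simp only [map_add, Pi.add_apply, ha, hb]; split_ifs <;> simp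
  | single e r =>
    rw [cut_single, step_single, step_single]
    simp only [Pi.smul_apply, corner, Set.indicator_apply, Set.mem_prod, Set.mem_Iic,
      le_min_iff, Set.mem_singleton_iff, Pi.one_apply]
    split_ifs <;> simp_all

/-- The value is the covariance of Brownian motion; bilinearity then yields the isometry for step
functions. -/
lemma integral_corner_mul_corner (e e' : Idx d) :
    ∫ x, corner e x * corner e' x ∂(idxMeasure d) =
      if e.2 = e'.2 then min (e.1 : ℝ) e'.1 else 0 := by
  have h : (fun x => corner e x * corner e' x) =
      (Set.Iic e.1 ×ˢ {e.2} ∩ Set.Iic e'.1 ×ˢ {e'.2} : Set (Idx d)).indicator 1 := by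
    ext x
    rw [Set.inter_indicator_one]
    rfl
  rw [h, Set.prod_inter_prod, Set.Iic_inter_Iic]
  split_ifs with hj
  · rw [hj, Set.inter_self, integral_indicator_one (measurableSet_Iic.prod
      (measurableSet_singleton _)), measureReal_def, idxMeasure_prod_singleton,
      unitInterval.volume_Iic, ENNReal.toReal_ofReal (e.1 ⊓ e'.1).2.1]
    rfl
  · rw [Set.singleton_inter_eq_empty.2 (by simpa using hj)]
    simp

/-! ### The canonical process -/

lemma measurable_coord (t : unitInterval) (j : Fin d) :
    Measurable (coord t j : Space d → ℝ) := by
  have : Continuous (coord t j : Space d → ℝ) := by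
    unfold coord
    fun_prop
  exact this.measurable

lemma past_le (t : unitInterval) : past d t ≤ instMeasurableSpaceSpace d :=
  iSup_le fun _ => (measurable_coord _ _).comap_le

lemma past_mono {s t : unitInterval} (h : s ≤ t) : past d s ≤ past d t :=
  iSup_le fun e => le_iSup (fun e : {u : unitInterval // u ≤ t} × Fin d =>
    MeasurableSpace.comap (coord (d := d) e.1.1 e.2) inferInstance) (⟨e.1.1, e.1.2.trans h⟩, e.2)

lemma measurable_past_coord {s t : unitInterval} (h : s ≤ t) (j : Fin d) :
    Measurable[past d t] (coord s j : Space d → ℝ) :=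
  Measurable.of_comap_le (le_iSup (fun e : {u : unitInterval // u ≤ t} × Fin d =>
    MeasurableSpace.comap (coord (d := d) e.1.1 e.2) inferInstance) (⟨s, h⟩, j))

/-- The σ-algebra generated by the increments of the canonical process after time `s`. -/
abbrev future (d : ℕ) (s : unitInterval) : MeasurableSpace (Space d) :=
  ⨆ e : Idx d, MeasurableSpace.comap (fun w => coord (max e.1 s) e.2 w - coord s e.2 w)
    inferInstance

lemma future_le (s : unitInterval) : future d s ≤ instMeasurableSpaceSpace d :=
  iSup_le fun _ => ((measurable_coord _ _).sub (measurable_coord _ _)).comap_le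

lemma measurable_future_sub {s t : unitInterval} (h : s ≤ t) (j : Fin d) :
    Measurable[future d s] (fun w : Space d => coord t j w - coord s j w) := by
  have : Measurable[future d s] (fun w : Space d => coord (max t s) j w - coord s j w) :=
    Measurable.of_comap_le (le_iSup (fun e : Idx d =>
      MeasurableSpace.comap (fun w : Space d => coord (max e.1 s) e.2 w - coord s e.2 w)
        inferInstance) (t, j))
  rwa [max_eq_left h] at this

lemma measurable_past_wien_cut (s : unitInterval) (c : Idx d →₀ ℝ) :
    Measurable[past d s] (wien (cut s c)) := by
  induction c using Finsupp.induction_linear with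
  | zero =>
    simp only [map_zero]
    exact @measurable_const _ _ _ (past d s) 0
  | add a b ha hb => rw [map_add, map_add]; exact ha.add hb
  | single e r =>
    rw [cut_single, wien_single]
    exact (measurable_past_coord (min_le_right _ _) _).const_smul r

/-- A corner ending before s cancels against its cut; any other leaves an increment starting at s.
-/
lemma measurable_future_wien_sub (s : unitInterval) (c : Idx d →₀ ℝ) :
    Measurable[future d s] (wien (c - cut s c)) := by
  induction c using Finsupp.induction_linear with
  | zero =>
    simp only [map_zero, sub_zero]
    exact @measurable_const _ _ _ (future d s) 0
  | add a b ha hb => rw [map_add, add_sub_add_comm, map_add]; exact ha.add hb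
  | single e r =>
    rw [cut_single, map_sub, wien_single, wien_single, ← smul_sub]
    refine Measurable.const_smul ?_ r
    rcases le_total e.1 s with h | h
    · simp only [min_eq_left h, sub_self]
      exact @measurable_const _ _ _ (future d s) 0
    · simp only [min_eq_right h]
      exact measurable_future_sub h e.2

namespace IsWienerMeasure

variable (hμ : IsWienerMeasure μ)

include hμ

lemma hasFiniteMoments_coord (t : unitInterval) (j : Fin d) :
    HasFiniteMoments (coord t j) μ :=
  hasFiniteMoments_of_hasGaussianLaw (hμ.isGaussianProcess.hasGaussianLaw_eval (t, j))

lemma hasGaussianLaw_wien (c : Idx d →₀ ℝ) : HasGaussianLaw (wien c) μ := by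
  have h := (hμ.isGaussianProcess.smul c).hasGaussianLaw_sum (I := c.support)
  have e : wien c = ∑ i ∈ c.support, fun w => c i • coord i.1 i.2 w := by
    unfold wien
    rw [Finsupp.linearCombination_apply, Finsupp.sum]
    rfl
  rw [e]
  exact h

lemma hasFiniteMoments_wien (c : Idx d →₀ ℝ) : HasFiniteMoments (wien c) μ :=
  hasFiniteMoments_of_hasGaussianLaw (hμ.hasGaussianLaw_wien c)

lemma integral_wien (c : Idx d →₀ ℝ) : ∫ w, wien c w ∂μ = 0 := by
  induction c using Finsupp.induction_linear with
  | zero => simp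
  | add a b ha hb =>
    simp only [map_add, Pi.add_apply]
    rw [integral_add (hμ.hasFiniteMoments_wien a).integrable
      (hμ.hasFiniteMoments_wien b).integrable, ha, hb, add_zero]
  | single e r =>
    simp only [wien_single, Pi.smul_apply, smul_eq_mul]
    rw [integral_const_mul, hμ.centered, mul_zero]

/-- The Itô isometry for step functions. -/
lemma integral_wien_mul_wien (c c' : Idx d →₀ ℝ) :
    ∫ w, wien c w * wien c' w ∂μ = ∫ x, step c x * step c' x ∂(idxMeasure d) := by
  have I : ∀ c c' : Idx d →₀ ℝ, Integrable (fun w => wien c w * wien c' w) μ := fun c c' =>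
    ((hμ.hasFiniteMoments_wien c).mul (hμ.hasFiniteMoments_wien c')).integrable
  induction c using Finsupp.induction_linear with
  | zero => simp
  | add a b ha hb =>
    simp only [map_add, Pi.add_apply, add_mul]
    rw [integral_add (I _ _) (I _ _), ha, hb,
      integral_add (integrable_step_mul_step _ _) (integrable_step_mul_step _ _)]
  | single e r =>
    induction c' using Finsupp.induction_linear with
    | zero => simp
    | add a b ha hb =>
      simp only [map_add, Pi.add_apply, mul_add]
      rw [integral_add (I _ _) (I _ _), ha, hb,
        integral_add (integrable_step_mul_step _ _) (integrable_step_mul_step _ _)]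
    | single e' r' =>
      have h1 : ∀ w, wien (Finsupp.single e r) w * wien (Finsupp.single e' r') w =
          r * r' * (coord e.1 e.2 w * coord e'.1 e'.2 w) := fun w => by
        simp only [wien_single, Pi.smul_apply, smul_eq_mul]; ring
      have h2 : ∀ x, step (Finsupp.single e r) x * step (Finsupp.single e' r') x =
          r * r' * (corner e x * corner e' x) := fun x => by
        simp only [step_single, Pi.smul_apply, smul_eq_mul]; ring
      simp only [h1, h2]
      rw [integral_const_mul, integral_const_mul, hμ.covariance, integral_corner_mul_corner]

lemma integral_coord_mul_sub {r s t : unitInterval} (hrs : r ≤ s) (hst : s ≤ t) (j k : Fin d) :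
    ∫ w, coord r j w * (coord t k w - coord s k w) ∂μ = 0 := by
  simp only [mul_sub]
  have M := hμ.hasFiniteMoments_coord
  rw [integral_sub ((M _ _).mul (M _ _)).integrable ((M _ _).mul (M _ _)).integrable,
    hμ.covariance, hμ.covariance, min_eq_left (by exact_mod_cast hrs.trans hst),
    min_eq_left (by exact_mod_cast hrs), sub_self]

/-- The increments of the canonical process after time `s` are independent of its past. -/
lemma indep_past_future (s : unitInterval) : Indep (past d s) (future d s) μ := by
  have := hμ.isProbabilityMeasure
  set X : {u : unitInterval // u ≤ s} × Fin d → Space d → ℝ := fun e => coord e.1.1 e.2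
  set Y : Idx d → Space d → ℝ := fun e w => coord (max e.1 s) e.2 w - coord s e.2 w
  have hX : ∀ e, Measurable (X e) := fun e => measurable_coord _ _
  have hY : ∀ e, Measurable (Y e) := fun e => (measurable_coord _ _).sub (measurable_coord _ _)
  -- Past values and future increments are jointly Gaussian, so vanishing covariances give
  -- independence.
  have hG : IsGaussianProcess (Sum.elim X Y) μ := by
    classical
    refine hμ.isGaussianProcess.of_isGaussianProcess fun e => ?_
    rcases e with e | e
    · exact ⟨{(e.1.1, e.2)}, ContinuousLinearMap.proj ⟨(e.1.1, e.2), by simp⟩,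
        fun w => by simp [X]⟩
    · exact ⟨{(max e.1 s, e.2), (s, e.2)},
        ContinuousLinearMap.proj ⟨(max e.1 s, e.2), by simp⟩ -
          ContinuousLinearMap.proj ⟨(s, e.2), by simp⟩, fun w => by simp [Y]⟩
  have hI := hG.indepFun_of_covariance_eq_zero (fun e => (hX e).aemeasurable)
    (fun e => (hY e).aemeasurable) fun e e' => by
      have M := hμ.hasFiniteMoments_coord
      rw [covariance_eq_sub (M _ _).memLp_two ((M _ _).sub (M _ _)).memLp_two]
      have h1 : ∫ w, (X e * Y e') w ∂μ = 0 :=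
        hμ.integral_coord_mul_sub e.1.2 (le_max_right _ _) _ _
      have h2 : ∫ w, X e w ∂μ = 0 := hμ.centered _ _
      rw [h1, h2]
      simp
  rw [IndepFun_iff_Indep] at hI
  convert hI using 1
  · rw [MeasurableSpace.pi, MeasurableSpace.comap_iSup]
    simp only [MeasurableSpace.comap_comp]
    rfl
  · rw [MeasurableSpace.pi, MeasurableSpace.comap_iSup]
    simp only [MeasurableSpace.comap_comp]
    rfl

/-- Coefficients are measurable only for the completed past. Independence ignores null sets, so a
version measurable for `past` can be used instead. -/
lemma indepFun_past_future {s : unitInterval} {Y Z : Space d → ℝ}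
    (hY : AEStronglyMeasurable[past d s] Y μ) (hZ : Measurable[future d s] Z) :
    IndepFun Y Z μ := by
  have h : IndepFun (hY.mk Y) Z μ := by
    rw [IndepFun_iff_Indep]
    exact indep_of_indep_of_le_left (indep_of_indep_of_le_right (hμ.indep_past_future s)
      hZ.comap_le) hY.stronglyMeasurable_mk.measurable.comap_le
  exact h.congr hY.ae_eq_mk.symm EventuallyEq.rfl

lemma integral_past_mul_future {s : unitInterval} {Y Z : Space d → ℝ}
    (hY : AEStronglyMeasurable[past d s] Y μ) (hZ : Measurable[future d s] Z) :
    ∫ w, Y w * Z w ∂μ = (∫ w, Y w ∂μ) * ∫ w, Z w ∂μ :=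
  (hμ.indepFun_past_future hY hZ).integral_fun_mul_eq_mul_integral
    (hY.mono (past_le s)) (hZ.mono (future_le s) le_rfl).aestronglyMeasurable

/-- The product of square integrable past and future random variables. -/
lemma eLpNorm_past_mul_future {s : unitInterval} {Y Z : Space d → ℝ}
    (hY : AEStronglyMeasurable[past d s] Y μ) (hZ : Measurable[future d s] Z) :
    eLpNorm (fun w => Y w * Z w) 2 μ = eLpNorm Y 2 μ * eLpNorm Z 2 μ := by
  have h := lintegral_mul_eq_lintegral_mul_lintegral_of_indepFun''
    (f := fun w => ‖Y w‖ₑ ^ (2 : ℝ)) (g := fun w => ‖Z w‖ₑ ^ (2 : ℝ))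
    (((hY.mono (past_le s)).enorm).pow_const _)
    ((hZ.mono (future_le s) le_rfl).enorm.pow_const _).aemeasurable
    ((hμ.indepFun_past_future hY hZ).comp (φ := fun x : ℝ => ‖x‖ₑ ^ (2 : ℝ))
      (ψ := fun x : ℝ => ‖x‖ₑ ^ (2 : ℝ)) (by fun_prop) (by fun_prop))
  simp only [eLpNorm_eq_lintegral_rpow_enorm_toReal (p := 2) (by simp) (by simp),
    ENNReal.toReal_ofNat, enorm_mul, ENNReal.mul_rpow_of_nonneg _ _ (zero_le_two (α := ℝ))]
  rw [h, ENNReal.mul_rpow_of_nonneg _ _ (by norm_num)]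

end IsWienerMeasure

end

section

variable {d : ℕ} {μ : Measure (Space d)}

/-! ### Square integrable functions -/

section Lp

variable {α β : Type*} {mα : MeasurableSpace α} {mβ : MeasurableSpace β} {ν : Measure α}
  {ρ : Measure β}

lemma eLpNorm_two_eq (f : α → ℝ) : eLpNorm f 2 ν = (∫⁻ x, ‖f x‖ₑ ^ 2 ∂ν) ^ (1 / 2 : ℝ) := by
  rw [eLpNorm_eq_lintegral_rpow_enorm_toReal (by simp) (by simp)]
  simp

lemma eLpNorm_two_sq (f : α → ℝ) : eLpNorm f 2 ν ^ 2 = ∫⁻ x, ‖f x‖ₑ ^ 2 ∂ν := by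
  rw [eLpNorm_two_eq, ← ENNReal.rpow_natCast, ← ENNReal.rpow_mul]
  simp

lemma lintegral_enorm_sq_eq {f : α → ℝ} (hf : MemLp f 2 ν) :
    ∫⁻ x, ‖f x‖ₑ ^ 2 ∂ν = ENNReal.ofReal (∫ x, f x ^ 2 ∂ν) := by
  rw [ofReal_integral_eq_lintegral_ofReal hf.integrable_sq (ae_of_all _ fun x => sq_nonneg _)]
  refine lintegral_congr fun x => ?_
  rw [← Real.enorm_of_nonneg (sq_nonneg (f x)), enorm_pow]

lemma eLpNorm_two_eq_of_integral_sq_eq {f : α → ℝ} {g : β → ℝ} (hf : MemLp f 2 ν)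
    (hg : MemLp g 2 ρ) (h : ∫ x, f x ^ 2 ∂ν = ∫ y, g y ^ 2 ∂ρ) :
    eLpNorm f 2 ν = eLpNorm g 2 ρ := by
  rw [eLpNorm_two_eq, eLpNorm_two_eq, lintegral_enorm_sq_eq hf, lintegral_enorm_sq_eq hg, h]

lemma eLpNorm_two_prod_mul [SFinite ρ] [SFinite ν] {f : α → ℝ} {g : β → ℝ}
    (hf : AEStronglyMeasurable f ν) (hg : AEStronglyMeasurable g ρ) :
    eLpNorm (fun z : α × β => f z.1 * g z.2) 2 (ν.prod ρ) =
      eLpNorm f 2 ν * eLpNorm g 2 ρ := by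
  simp only [eLpNorm_two_eq, enorm_mul, mul_pow]
  rw [lintegral_prod_mul (hf.enorm.pow_const 2) (hg.enorm.pow_const 2),
    ENNReal.mul_rpow_of_nonneg _ _ (by norm_num)]

lemma memLp_two_prod_mul [SFinite ρ] [SFinite ν] {f : α → ℝ} {g : β → ℝ}
    (hf : MemLp f 2 ν) (hg : MemLp g 2 ρ) :
    MemLp (fun z : α × β => f z.1 * g z.2) 2 (ν.prod ρ) :=
  ⟨hf.1.comp_fst.mul hg.1.comp_snd, by
    rw [eLpNorm_two_prod_mul hf.1 hg.1]; exact ENNReal.mul_lt_top hf.2 hg.2⟩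

/-- Truncations converge in `L²`. -/
lemma tendsto_eLpNorm_sub_truncation {f : α → ℝ} (hf : MemLp f 2 ν) :
    Tendsto (fun n : ℕ => eLpNorm (fun x => f x - max (-(n : ℝ)) (min (f x) n)) 2 ν) atTop
      (𝓝 0) := by
  have h : Tendsto (fun n : ℕ => ∫⁻ x, ‖f x - max (-(n : ℝ)) (min (f x) n)‖ₑ ^ 2 ∂ν) atTop
      (𝓝 (∫⁻ _, 0 ∂ν)) := by
    refine tendsto_lintegral_of_dominated_convergence' (fun x => ‖f x‖ₑ ^ 2) (fun n => ?_)
      (fun n => ae_of_all _ fun x => ?_) ?_ (ae_of_all _ fun x => ?_)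
    · have : AEMeasurable f ν := hf.1.aemeasurable
      fun_prop
    · refine pow_le_pow_left' (enorm_le_iff_norm_le.2 ?_) 2
      have hn : (0 : ℝ) ≤ n := n.cast_nonneg
      rw [Real.norm_eq_abs, Real.norm_eq_abs]
      rcases le_total (f x) n with h1 | h1
      · rw [min_eq_left h1]
        rcases le_total (-(n : ℝ)) (f x) with h2 | h2
        · rw [max_eq_right h2]; simp
        · rw [max_eq_left h2, abs_of_nonpos (by linarith), abs_of_nonpos (by linarith)]
          linarith
      · rw [min_eq_right h1, max_eq_right (by linarith), abs_of_nonneg (by linarith),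
          abs_of_nonneg (by linarith)]
        linarith
    · rw [← eLpNorm_two_sq]
      exact ENNReal.pow_ne_top hf.2.ne
    · refine tendsto_const_nhds.congr' ?_
      filter_upwards [eventually_ge_atTop ⌈|f x|⌉₊] with n hn
      have hn' : |f x| ≤ n := Nat.ceil_le.1 hn
      rw [min_eq_left (le_of_abs_le hn'), max_eq_right (neg_le_of_abs_le hn')]
      simp
  simp only [eLpNorm_two_eq]
  have := (ENNReal.continuous_rpow_const (y := (1 / 2 : ℝ))).tendsto _ |>.comp h
  simpa [Function.comp_def] using this

end Lp

/-! ### Simple processes -/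

/-- The step function `1_{(s, t] × {j}}`. -/
noncomputable def incr (s t : unitInterval) (j : Fin d) : Idx d →₀ ℝ :=
  Finsupp.single (t, j) 1 - Finsupp.single (s, j) 1

lemma wien_incr (s t : unitInterval) (j : Fin d) (w : Space d) :
    wien (incr s t j) w = coord t j w - coord s j w := by
  simp [incr, wien_single]

open Classical in
lemma step_incr {s t : unitInterval} (h : s ≤ t) (j : Fin d) (x : Idx d) :
    step (incr s t j) x = if s < x.1 ∧ x.1 ≤ t ∧ x.2 = j then 1 else 0 := by
  simp only [incr, map_sub, step_single, one_smul, Pi.sub_apply, corner, Set.indicator_apply,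
    Set.mem_prod, Set.mem_Iic, Set.mem_singleton_iff, Pi.one_apply]
  rcases lt_or_ge s x.1 with h1 | h1
  · simp [h1, not_le.2 h1]
  · simp [h1, not_lt.2 h1, h1.trans h]

lemma measurable_future_wien_incr {s t : unitInterval} (h : s ≤ t) (j : Fin d) :
    Measurable[future d s] (wien (incr s t j)) := by
  have : wien (incr s t j) = fun w => coord t j w - coord s j w := funext (wien_incr s t j)
  rw [this]
  exact measurable_future_sub h j

lemma integral_step_sub_cut_mul {s t : unitInterval} (h : s ≤ t) (j : Fin d)
    (a : Idx d →₀ ℝ) :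
    ∫ x, step (a - cut s a) x * step (incr s t j) x ∂(idxMeasure d) =
      ∫ x, step a x * step (incr s t j) x ∂(idxMeasure d) := by
  congr 1
  ext x
  rw [map_sub, Pi.sub_apply, step_cut, step_incr h]
  split_ifs with h1 h2
  · exact absurd h1 (not_le.2 h2.1)
  all_goals simp

/-- Split W(a) at time s. The part before s belongs to the past, and the centred increment kills it;
the part after s is independent of Y, and the isometry evaluates what remains. -/
lemma IsWienerMeasure.integral_mul_wien_mul_incr (hμ : IsWienerMeasure μ) {s t : unitInterval}
    (h : s ≤ t) (j : Fin d) (a : Idx d →₀ ℝ) {Y : Space d → ℝ}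
    (hY : AEStronglyMeasurable[past d s] Y μ) (hY' : HasFiniteMoments Y μ) :
    ∫ w, Y w * (wien a w * wien (incr s t j) w) ∂μ =
      (∫ w, Y w ∂μ) * ∫ x, step a x * step (incr s t j) x ∂(idxMeasure d) := by
  have W := hμ.hasFiniteMoments_wien
  have e : ∀ w, Y w * (wien a w * wien (incr s t j) w) =
      (Y w * wien (cut s a) w) * wien (incr s t j) w +
      Y w * (wien (a - cut s a) w * wien (incr s t j) w) := fun w => by
    simp only [map_sub, Pi.sub_apply]; ring
  simp only [e]
  rw [integral_add ((hY'.mul (W _)).mul (W _)).integrable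
    (hY'.mul ((W _).mul (W _))).integrable,
    hμ.integral_past_mul_future (s := s) (Y := fun w => Y w * wien (cut s a) w)
      (hY.mul (measurable_past_wien_cut s a).aestronglyMeasurable)
      (measurable_future_wien_incr h j),
    hμ.integral_wien, mul_zero, zero_add,
    hμ.integral_past_mul_future
      (Z := fun w => wien (a - cut s a) w * wien (incr s t j) w) hY
      ((measurable_future_wien_sub s a).mul (measurable_future_wien_incr h j)), hμ.integral_wien_mul_wien,
    integral_step_sub_cut_mul h]

namespace SimpleProcess

variable (S T : SimpleProcess μ)

lemma eval_eq (e : Idx d) (w : Space d) :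
    S.eval e w = ∑ k, step (incr (S.left k) (S.right k) (S.dir k)) e * S.coef k w := by
  refine Finset.sum_congr rfl fun k _ => ?_
  rw [step_incr (S.left_le_right k)]
  split_ifs <;> simp

lemma integral_eq (w : Space d) :
    S.integral w = ∑ k, S.coef k w * wien (incr (S.left k) (S.right k) (S.dir k)) w := by
  simp only [wien_incr]
  rfl

/-- The sum of two simple processes. -/
noncomputable def add : SimpleProcess μ where
  len := S.len + T.len
  left := Fin.append S.left T.left
  right := Fin.append S.right T.right
  left_le_right k := by
    refine Fin.addCases (fun i => ?_) (fun i => ?_) k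
    · simpa using S.left_le_right i
    · simpa using T.left_le_right i
  dir := Fin.append S.dir T.dir
  coef := Fin.append S.coef T.coef
  coef_bounded k := by
    refine Fin.addCases (fun i => ?_) (fun i => ?_) k
    · simpa using S.coef_bounded i
    · simpa using T.coef_bounded i
  coef_adapted k := by
    refine Fin.addCases (fun i => ?_) (fun i => ?_) k
    · rw [Fin.append_left, Fin.append_left]
      exact S.coef_adapted i
    · rw [Fin.append_right, Fin.append_right]
      exact T.coef_adapted i

/-- A scalar multiple of a simple process. -/
noncomputable def smul (c : ℝ) : SimpleProcess μ where
  len := S.len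
  left := S.left
  right := S.right
  left_le_right := S.left_le_right
  dir := S.dir
  coef k w := c * S.coef k w
  coef_bounded k := by
    obtain ⟨C, hC⟩ := S.coef_bounded k
    refine ⟨|c| * C, fun w => ?_⟩
    rw [abs_mul]
    exact mul_le_mul_of_nonneg_left (hC w) (abs_nonneg c)
  coef_adapted k := (S.coef_adapted k).const_mul c

lemma eval_add (e : Idx d) (w : Space d) : (S.add T).eval e w = S.eval e w + T.eval e w := by
  rw [eval_eq, eval_eq, eval_eq]
  exact (Fin.sum_univ_add _).trans (by simp [add])

lemma integral_add (w : Space d) : (S.add T).integral w = S.integral w + T.integral w :=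
  (Fin.sum_univ_add _).trans (by simp [add, integral])

lemma eval_smul (c : ℝ) (e : Idx d) (w : Space d) : (S.smul c).eval e w = c * S.eval e w := by
  simp only [eval, smul, Finset.mul_sum, mul_ite, mul_zero]
  rfl

lemma integral_smul (c : ℝ) (w : Space d) : (S.smul c).integral w = c * S.integral w := by
  simp only [integral, smul, Finset.mul_sum, mul_assoc]
  rfl

lemma aestronglyMeasurable_coef (k : Fin S.len) : AEStronglyMeasurable (S.coef k) μ :=
  (S.coef_adapted k).mono (past_le _)

lemma hasFiniteMoments_coef [IsFiniteMeasure μ] (k : Fin S.len) :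
    HasFiniteMoments (S.coef k) μ := by
  obtain ⟨C, hC⟩ := S.coef_bounded k
  exact fun p _ => MemLp.of_bound (S.aestronglyMeasurable_coef k) C (ae_of_all _ hC)

lemma memLp_step (c : Idx d →₀ ℝ) : MemLp (step c) 2 (idxMeasure d) := by
  obtain ⟨C, hC⟩ := exists_abs_step_le c
  exact MemLp.of_bound (measurable_step c).aestronglyMeasurable C (ae_of_all _ hC)

lemma memLp_eval [IsFiniteMeasure μ] :
    MemLp (fun z : Idx d × Space d => S.eval z.1 z.2) 2 ((idxMeasure d).prod μ) := by
  simp only [eval_eq]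
  exact memLp_finsetSum _ fun k _ =>
    memLp_two_prod_mul (memLp_step _) (S.hasFiniteMoments_coef k).memLp_two

lemma memLp_integral (hμ : IsWienerMeasure μ) : MemLp S.integral 2 μ := by
  have := hμ.isProbabilityMeasure
  have : S.integral = fun w => ∑ k, S.coef k w *
      wien (incr (S.left k) (S.right k) (S.dir k)) w := funext S.integral_eq
  rw [this]
  exact memLp_finsetSum _ fun k _ =>
    ((S.hasFiniteMoments_coef k).mul (hμ.hasFiniteMoments_wien _)).memLp_two

/-- The two intervals may overlap. Both coefficients lie in the past of the later left endpoint, and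
the earlier increment, possibly straddling that endpoint, plays the role of `a` in
`integral_mul_wien_mul_incr`. -/
lemma integral_mul_of_left_le (hμ : IsWienerMeasure μ) {k l : Fin S.len}
    (h : S.left k ≤ S.left l) :
    ∫ w, (S.coef k w * wien (incr (S.left k) (S.right k) (S.dir k)) w) *
      (S.coef l w * wien (incr (S.left l) (S.right l) (S.dir l)) w) ∂μ =
    (∫ x, step (incr (S.left k) (S.right k) (S.dir k)) x *
      step (incr (S.left l) (S.right l) (S.dir l)) x ∂(idxMeasure d)) *
      ∫ w, S.coef k w * S.coef l w ∂μ := by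
  have := hμ.isProbabilityMeasure
  rw [mul_comm, ← hμ.integral_mul_wien_mul_incr (S.left_le_right l) (S.dir l) _
    (Y := fun w => S.coef k w * S.coef l w) (((S.coef_adapted k).mono (past_mono h)).mul (S.coef_adapted l))
    ((S.hasFiniteMoments_coef k).mul (S.hasFiniteMoments_coef l))]
  congr 1
  ext w
  ring

lemma integral_mul (hμ : IsWienerMeasure μ) (k l : Fin S.len) :
    ∫ w, (S.coef k w * wien (incr (S.left k) (S.right k) (S.dir k)) w) *
      (S.coef l w * wien (incr (S.left l) (S.right l) (S.dir l)) w) ∂μ =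
    (∫ x, step (incr (S.left k) (S.right k) (S.dir k)) x *
      step (incr (S.left l) (S.right l) (S.dir l)) x ∂(idxMeasure d)) *
      ∫ w, S.coef k w * S.coef l w ∂μ := by
  rcases le_total (S.left k) (S.left l) with h | h
  · exact S.integral_mul_of_left_le hμ h
  · have := S.integral_mul_of_left_le hμ h
    simpa only [mul_comm] using this

lemma integral_integral_sq (hμ : IsWienerMeasure μ) :
    ∫ w, S.integral w ^ 2 ∂μ =
      ∫ z : Idx d × Space d, S.eval z.1 z.2 ^ 2 ∂((idxMeasure d).prod μ) := by
  have := hμ.isProbabilityMeasure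
  have M := S.hasFiniteMoments_coef
  have W := hμ.hasFiniteMoments_wien
  simp only [integral_eq, eval_eq, sq, Finset.sum_mul_sum]
  have e : ∀ z : Idx d × Space d, ∀ k l : Fin S.len,
      step (incr (S.left k) (S.right k) (S.dir k)) z.1 * S.coef k z.2 *
      (step (incr (S.left l) (S.right l) (S.dir l)) z.1 * S.coef l z.2) =
      (fun x => step (incr (S.left k) (S.right k) (S.dir k)) x *
        step (incr (S.left l) (S.right l) (S.dir l)) x) z.1 *
      (fun w => S.coef k w * S.coef l w) z.2 := fun z k l => by simp only; ring
  simp only [e]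
  rw [integral_finsetSum _ fun k _ => integrable_finsetSum _ fun l _ =>
      (((M k).mul (W _)).mul ((M l).mul (W _))).integrable,
    integral_finsetSum _ fun k _ => integrable_finsetSum _ fun l _ =>
      (integrable_step_mul_step _ _).mul_prod ((M k).mul (M l)).integrable]
  refine Finset.sum_congr rfl fun k _ => ?_
  rw [integral_finsetSum _ fun l _ => (((M k).mul (W _)).mul ((M l).mul (W _))).integrable,
    integral_finsetSum _ fun l _ =>
      (integrable_step_mul_step _ _).mul_prod ((M k).mul (M l)).integrable]
  refine Finset.sum_congr rfl fun l _ => ?_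
  exact (S.integral_mul hμ k l).trans (integral_prod_mul
    (fun x => step (incr (S.left k) (S.right k) (S.dir k)) x *
      step (incr (S.left l) (S.right l) (S.dir l)) x) (fun w => S.coef k w * S.coef l w)).symm

/-- The Itô isometry. -/
lemma eLpNorm_integral (hμ : IsWienerMeasure μ) :
    eLpNorm S.integral 2 μ =
      eLpNorm (fun z : Idx d × Space d => S.eval z.1 z.2) 2 ((idxMeasure d).prod μ) := by
  have := hμ.isProbabilityMeasure
  exact eLpNorm_two_eq_of_integral_sq_eq (S.memLp_integral hμ) S.memLp_eval
    (S.integral_integral_sq hμ)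

end SimpleProcess

/-! ### The Itô integral -/

namespace IsItoIntegral

variable {U V : Idx d → Space d → ℝ} {X Y : Space d → ℝ}

/-- The isometry for simple processes passes to the limit; this inequality suffices for uniqueness
and continuity. -/
lemma eLpNorm_le (hμ : IsWienerMeasure μ) (h : IsItoIntegral μ U X) :
    eLpNorm X 2 μ ≤ eLpNorm (Function.uncurry U) 2 ((idxMeasure d).prod μ) := by
  have := hμ.isProbabilityMeasure
  obtain ⟨hU, hX, S, hS, hS'⟩ := h
  have key : ∀ n, eLpNorm X 2 μ ≤ eLpNorm (fun w => X w - (S n).integral w) 2 μ +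
      (eLpNorm (fun z : Idx d × Space d => U z.1 z.2 - (S n).eval z.1 z.2) 2
        ((idxMeasure d).prod μ) + eLpNorm (Function.uncurry U) 2 ((idxMeasure d).prod μ)) := by
    intro n
    have h1 : eLpNorm X 2 μ ≤ eLpNorm (fun w => X w - (S n).integral w) 2 μ +
        eLpNorm (S n).integral 2 μ := by
      refine le_trans (le_of_eq ?_) (eLpNorm_add_le (p := 2)
        (hX.1.sub ((S n).memLp_integral hμ).1) ((S n).memLp_integral hμ).1 (by norm_num))
      congr 1
      ext w
      simp
    have h2 : eLpNorm (fun z : Idx d × Space d => (S n).eval z.1 z.2) 2 ((idxMeasure d).prod μ) ≤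
        eLpNorm (fun z : Idx d × Space d => (S n).eval z.1 z.2 - U z.1 z.2) 2
          ((idxMeasure d).prod μ) +
        eLpNorm (Function.uncurry U) 2 ((idxMeasure d).prod μ) := by
      refine le_trans (le_of_eq ?_) (eLpNorm_add_le (p := 2)
        ((S n).memLp_eval.1.sub hU.1) hU.1 (by norm_num))
      congr 1
      ext z
      simp [Function.uncurry_def]
    rw [← (S n).eLpNorm_integral hμ] at h2
    refine h1.trans (add_le_add le_rfl (h2.trans (add_le_add (le_of_eq ?_) le_rfl)))
    exact eLpNorm_sub_comm (fun z : Idx d × Space d => (S n).eval z.1 z.2)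
      (fun z => U z.1 z.2) 2 _
  refine ge_of_tendsto' (x := atTop) ?_ key
  simpa using hS'.add (hS.add_const (eLpNorm (Function.uncurry U) 2 ((idxMeasure d).prod μ)))

lemma const_mul (h : IsItoIntegral μ U X) (c : ℝ) :
    IsItoIntegral μ (fun e w => c * U e w) (fun w => c * X w) := by
  obtain ⟨hU, hX, S, hS, hS'⟩ := h
  refine ⟨hU.const_mul c, hX.const_mul c, fun n => (S n).smul c, ?_, ?_⟩
  · simp only [SimpleProcess.eval_smul, ← mul_sub]
    have : ∀ n, eLpNorm (fun z : Idx d × Space d => c * (U z.1 z.2 - (S n).eval z.1 z.2)) 2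
        ((idxMeasure d).prod μ) = ‖c‖ₑ * eLpNorm (fun z : Idx d × Space d =>
          U z.1 z.2 - (S n).eval z.1 z.2) 2 ((idxMeasure d).prod μ) := fun n =>
      eLpNorm_const_smul c (fun z : Idx d × Space d => U z.1 z.2 - (S n).eval z.1 z.2) 2 _
    simp only [this]
    simpa using ENNReal.Tendsto.const_mul hS (Or.inr enorm_ne_top)
  · simp only [SimpleProcess.integral_smul, ← mul_sub]
    have : ∀ n, eLpNorm (fun w => c * (X w - (S n).integral w)) 2 μ =
        ‖c‖ₑ * eLpNorm (fun w => X w - (S n).integral w) 2 μ := fun n =>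
      eLpNorm_const_smul c (fun w => X w - (S n).integral w) 2 _
    simp only [this]
    simpa using ENNReal.Tendsto.const_mul hS' (Or.inr enorm_ne_top)

lemma add (hμ : IsWienerMeasure μ) (h : IsItoIntegral μ U X) (h' : IsItoIntegral μ V Y) :
    IsItoIntegral μ (fun e w => U e w + V e w) (fun w => X w + Y w) := by
  have := hμ.isProbabilityMeasure
  obtain ⟨hU, hX, S, hS, hS'⟩ := h
  obtain ⟨hV, hY, T, hT, hT'⟩ := h'
  refine ⟨hU.add hV, hX.add hY, fun n => (S n).add (T n), ?_, ?_⟩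
  · refine tendsto_of_tendsto_of_tendsto_of_le_of_le tendsto_const_nhds
      (by simpa using hS.add hT) (fun _ => zero_le) fun n => ?_
    refine le_trans (le_of_eq ?_) (eLpNorm_add_le (p := 2) (hU.1.sub (S n).memLp_eval.1)
      (hV.1.sub (T n).memLp_eval.1) (by norm_num))
    congr 1
    ext z
    simp only [SimpleProcess.eval_add, Pi.add_apply]
    ring
  · refine tendsto_of_tendsto_of_tendsto_of_le_of_le tendsto_const_nhds
      (by simpa using hS'.add hT') (fun _ => zero_le) fun n => ?_
    refine le_trans (le_of_eq ?_) (eLpNorm_add_le (p := 2)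
      (hX.1.sub ((S n).memLp_integral hμ).1) (hY.1.sub ((T n).memLp_integral hμ).1)
      (by norm_num))
    congr 1
    ext w
    simp only [SimpleProcess.integral_add, Pi.add_apply]
    ring

lemma of_tendsto (hμ : IsWienerMeasure μ) {Us : ℕ → Idx d → Space d → ℝ}
    {Xs : ℕ → Space d → ℝ} (h : ∀ m, IsItoIntegral μ (Us m) (Xs m))
    (hU : MemLp (Function.uncurry U) 2 ((idxMeasure d).prod μ)) (hX : MemLp X 2 μ)
    (hUs : Tendsto (fun m => eLpNorm (Function.uncurry U - Function.uncurry (Us m)) 2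
      ((idxMeasure d).prod μ)) atTop (𝓝 0))
    (hXs : Tendsto (fun m => eLpNorm (X - Xs m) 2 μ) atTop (𝓝 0)) : IsItoIntegral μ U X := by
  have := hμ.isProbabilityMeasure
  have hpos : ∀ m : ℕ, (0 : ℝ≥0∞) < ((m : ℝ≥0∞) + 1)⁻¹ := fun m => by simp
  -- Diagonal choice: one simple process must be close to the integrand and, at the same time, have
  -- integral close to `Xs m`.
  have hch : ∀ m, ∃ S : SimpleProcess μ,
      eLpNorm (fun z : Idx d × Space d => Us m z.1 z.2 - S.eval z.1 z.2) 2
        ((idxMeasure d).prod μ) ≤ ((m : ℝ≥0∞) + 1)⁻¹ ∧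
      eLpNorm (fun w => Xs m w - S.integral w) 2 μ ≤ ((m : ℝ≥0∞) + 1)⁻¹ := by
    intro m
    obtain ⟨-, -, S, hS, hS'⟩ := h m
    obtain ⟨n, hn, hn'⟩ := ((hS.eventually_le_const (hpos m)).and
      (hS'.eventually_le_const (hpos m))).exists
    exact ⟨S n, hn, hn'⟩
  choose S hS hS' using hch
  have hlim : Tendsto (fun m : ℕ => ((m : ℝ≥0∞) + 1)⁻¹) atTop (𝓝 0) := by
    have := (tendsto_add_atTop_iff_nat 1).2 ENNReal.tendsto_inv_nat_nhds_zero
    simpa using this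
  refine ⟨hU, hX, S, ?_, ?_⟩
  · refine tendsto_of_tendsto_of_tendsto_of_le_of_le tendsto_const_nhds
      (by simpa using hUs.add hlim) (fun _ => zero_le) fun m => ?_
    refine le_trans (le_trans (le_of_eq ?_) (eLpNorm_add_le (p := 2) (hU.1.sub (h m).1.1)
      ((h m).1.1.sub (S m).memLp_eval.1) (by norm_num))) (add_le_add le_rfl (hS m))
    congr 1
    ext z
    simp [Function.uncurry_def]
  · refine tendsto_of_tendsto_of_tendsto_of_le_of_le tendsto_const_nhds
      (by simpa using hXs.add hlim) (fun _ => zero_le) fun m => ?_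
    refine le_trans (le_trans (le_of_eq ?_) (eLpNorm_add_le (p := 2) (hX.1.sub (h m).2.1.1)
      ((h m).2.1.1.sub ((S m).memLp_integral hμ).1) (by norm_num))) (add_le_add le_rfl (hS' m))
    congr 1
    ext w
    simp

/-- The Itô integral of `1_{(s, t] × {j}} Y` for a square integrable `Y` in the past of `s`. -/
lemma incr_mul (hμ : IsWienerMeasure μ) {s t : unitInterval} (hst : s ≤ t) (j : Fin d)
    (hY : AEStronglyMeasurable[past d s] Y μ) (hY2 : MemLp Y 2 μ) :
    IsItoIntegral μ (fun e w => step (incr s t j) e * Y w)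
      (fun w => Y w * wien (incr s t j) w) := by
  have := hμ.isProbabilityMeasure
  -- Coefficients of simple processes are bounded, so Y is truncated at level n; truncation
  -- preserves adaptedness.
  let S : ℕ → SimpleProcess μ := fun n =>
    { len := 1
      left := fun _ => s
      right := fun _ => t
      left_le_right := fun _ => hst
      dir := fun _ => j
      coef := fun _ w => max (-(n : ℝ)) (min (Y w) n)
      coef_bounded := fun _ => ⟨n, fun w => abs_le.2 ⟨le_max_left _ _,
        max_le (by linarith [n.cast_nonneg (α := ℝ)]) (min_le_right _ _)⟩⟩
      coef_adapted := fun _ =>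
        (by fun_prop : Continuous fun y : ℝ => max (-(n : ℝ)) (min y n)).comp_aestronglyMeasurable
          hY }
  have hF : Measurable[future d s] (wien (incr s t j)) := measurable_future_wien_incr hst j
  have hW := (hμ.hasFiniteMoments_wien (incr s t j)).memLp_two
  have hT := tendsto_eLpNorm_sub_truncation hY2
  refine ⟨memLp_two_prod_mul (SimpleProcess.memLp_step _) hY2, ⟨hY2.1.mul hW.1, ?_⟩, S, ?_, ?_⟩
  -- Square integrability of the product comes from independence, as Y has only two moments.
  · exact (hμ.eLpNorm_past_mul_future hY hF).trans_lt (ENNReal.mul_lt_top hY2.2 hW.2)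
  · have e : ∀ n, eLpNorm (fun z : Idx d × Space d => step (incr s t j) z.1 * Y z.2 -
        (S n).eval z.1 z.2) 2 ((idxMeasure d).prod μ) =
        eLpNorm (step (incr s t j)) 2 (idxMeasure d) *
          eLpNorm (fun w => Y w - max (-(n : ℝ)) (min (Y w) n)) 2 μ := fun n => by
      rw [← eLpNorm_two_prod_mul (g := fun w => Y w - max (-(n : ℝ)) (min (Y w) n))
        (SimpleProcess.memLp_step _).1 (hY2.1.sub ((S n).aestronglyMeasurable_coef 0))]
      congr 1
      ext z
      simp [SimpleProcess.eval_eq, S, mul_sub]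
    simp only [e]
    simpa using ENNReal.Tendsto.const_mul hT (Or.inr (SimpleProcess.memLp_step _).2.ne)
  · have e : ∀ n, eLpNorm (fun w => Y w * wien (incr s t j) w - (S n).integral w) 2 μ =
        eLpNorm (fun w => Y w - max (-(n : ℝ)) (min (Y w) n)) 2 μ *
          eLpNorm (wien (incr s t j)) 2 μ := fun n => by
      rw [← hμ.eLpNorm_past_mul_future (Y := fun w => Y w - max (-(n : ℝ)) (min (Y w) n))
        (hY.sub ((S n).coef_adapted 0)) hF]
      congr 1
      ext w
      simp [SimpleProcess.integral_eq, S, sub_mul]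
    simp only [e]
    simpa using ENNReal.Tendsto.mul_const hT (Or.inr hW.2.ne)

end IsItoIntegral

end

section

variable {d : ℕ} {μ : Measure (Space d)}

section Lp

variable {α : Type*} {mα : MeasurableSpace α} {ν : Measure α}

/-- Completeness of `L²`, in terms of functions. -/
lemma exists_tendsto_eLpNorm_sub {F : ℕ → α → ℝ} (hF : ∀ m, MemLp (F m) 2 ν) {b : ℕ → ℝ≥0∞}
    (hb : Tendsto b atTop (𝓝 0)) (h : ∀ m l, eLpNorm (F m - F l) 2 ν ≤ b m + b l) :
    ∃ G : α → ℝ, MemLp G 2 ν ∧ Tendsto (fun m => eLpNorm (G - F m) 2 ν) atTop (𝓝 0) := by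
  have hC : CauchySeq fun m => (hF m).toLp (F m) := by
    rw [EMetric.cauchySeq_iff]
    intro ε hε
    have hε2 : (0 : ℝ≥0∞) < ε / 2 := ENNReal.half_pos hε.ne'
    obtain ⟨N, hN⟩ := (hb.eventually_lt_const hε2).exists_forall_of_atTop
    refine ⟨N, fun m hm l hl => ?_⟩
    rw [Lp.edist_toLp_toLp]
    exact (h m l).trans_lt ((ENNReal.add_lt_add (hN m hm) (hN l hl)).trans_eq
      (ENNReal.add_halves ε))
  obtain ⟨G, hG⟩ := cauchySeq_tendsto_of_complete hC
  refine ⟨G, Lp.memLp G, ?_⟩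
  rw [tendsto_iff_edist_tendsto_0] at hG
  refine hG.congr fun m => ?_
  rw [edist_comm, Lp.edist_def]
  exact eLpNorm_congr_ae (EventuallyEq.rfl.sub (hF m).coeFn_toLp)

/-- Along a subsequence the integrals are at most 2⁻ᵏ, so the series of functions is finite almost
everywhere and its terms tend to 0. -/
lemma exists_subseq_ae_tendsto_zero {a : ℕ → α → ℝ≥0∞} (ha : ∀ m, AEMeasurable (a m) ν)
    (h : Tendsto (fun m => ∫⁻ x, a m x ∂ν) atTop (𝓝 0)) :
    ∃ φ : ℕ → ℕ, StrictMono φ ∧ ∀ᵐ x ∂ν, Tendsto (fun m => a (φ m) x) atTop (𝓝 0) := by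
  obtain ⟨φ, hφ, hφ'⟩ := extraction_forall_of_eventually'
    (P := fun k m => ∫⁻ x, a m x ∂ν ≤ (2⁻¹ : ℝ≥0∞) ^ k) fun k => by
      obtain ⟨N, hN⟩ := (h.eventually_le_const
        (ENNReal.pow_pos (show (0 : ℝ≥0∞) < 2⁻¹ by simp) k)).exists_forall_of_atTop
      exact ⟨N, hN⟩
  refine ⟨φ, hφ, ?_⟩
  have hsum : ∫⁻ x, ∑' k, a (φ k) x ∂ν ≠ ∞ := by
    rw [lintegral_tsum fun k => ha _]
    refine ne_top_of_le_ne_top ?_ (ENNReal.tsum_le_tsum hφ')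
    rw [ENNReal.tsum_geometric, ENNReal.one_sub_inv_two]
    simp
  filter_upwards [ae_lt_top' (AEMeasurable.tsum fun k => ha _) hsum] with x hx
  exact ENNReal.tendsto_atTop_zero_of_tsum_ne_top hx.ne

end Lp

/-! ### Adding a last variable -/

/-- The point `(x, e)`. -/
def snocMap {d n : ℕ} (z : Idx d × (Fin n → Idx d)) : Fin (n + 1) → Idx d :=
  Fin.snoc (α := fun _ => Idx d) z.2 z.1

lemma measurePreserving_snocMap (n : ℕ) :
    MeasurePreserving (snocMap (d := d) (n := n)) ((idxMeasure d).prod (idxPow d n))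
      (idxPow d (n + 1)) := by
  have h := (measurePreserving_piFinSuccAbove (fun _ : Fin (n + 1) => idxMeasure d)
    (Fin.last n)).symm
  have e : snocMap (d := d) (n := n) =
      (MeasurableEquiv.piFinSuccAbove (fun _ : Fin (n + 1) => Idx d) (Fin.last n)).symm :=
    funext fun z => (Fin.insertNth_last' (β := Idx d) z.1 z.2).symm
  rw [e]
  exact h

@[simp] lemma snocMap_last {n : ℕ} (z : Idx d × (Fin n → Idx d)) :
    snocMap z (Fin.last n) = z.1 := by
  simp [snocMap]

@[simp] lemma snocMap_castSucc {n : ℕ} (z : Idx d × (Fin n → Idx d)) (k : Fin n) :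
    snocMap z k.castSucc = z.2 k := by
  simp [snocMap]

lemma lintegral_snocMap {n : ℕ} {F : (Fin (n + 1) → Idx d) → ℝ≥0∞}
    (hF : AEMeasurable F (idxPow d (n + 1))) :
    ∫⁻ x, F x ∂(idxPow d (n + 1)) = ∫⁻ e, ∫⁻ x, F (snocMap (e, x)) ∂(idxPow d n) ∂(idxMeasure d) := by
  have h := measurePreserving_snocMap (d := d) n
  rw [← h.map_eq, lintegral_map' (by rwa [h.map_eq]) h.measurable.aemeasurable]
  exact lintegral_prod (fun z => F (snocMap z))
    (AEMeasurable.comp_measurable (by rwa [h.map_eq]) h.measurable)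

/-- The kernel `1_{t₁,…,t_n < t} f(·, (t, j))`. -/
noncomputable def slice {n : ℕ} (f : (Fin (n + 1) → Idx d) → ℝ) (e : Idx d) :
    (Fin n → Idx d) → ℝ := fun x =>
  open Classical in
  if ∀ k, (x k).1 < e.1 then f (Fin.snoc (α := fun _ => Idx d) x e) else 0

lemma slice_def {n : ℕ} (f : (Fin (n + 1) → Idx d) → ℝ) (e : Idx d) :
    slice f e = {x | ∀ k, (x k).1 < e.1}.indicator fun x => f (snocMap (e, x)) := by
  classical
  ext x
  rw [Set.indicator_apply, slice]
  simp only [Set.mem_ofPred_eq, snocMap]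

lemma measurableSet_forall_lt (n : ℕ) (e : Idx d) :
    MeasurableSet {x : Fin n → Idx d | ∀ k, (x k).1 < e.1} := by
  rw [Set.ofPred_forall]
  exact MeasurableSet.iInter fun k =>
    measurableSet_lt (measurable_pi_apply k).fst measurable_const

lemma ae_aestronglyMeasurable_slice {n : ℕ} {f : (Fin (n + 1) → Idx d) → ℝ}
    (hf : AEStronglyMeasurable f (idxPow d (n + 1))) :
    ∀ᵐ e ∂(idxMeasure d), AEStronglyMeasurable (slice f e) (idxPow d n) := by
  have h := hf.comp_measurePreserving (measurePreserving_snocMap n)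
  filter_upwards [h.prodMk_left] with e he
  rw [slice_def]
  exact he.indicator (measurableSet_forall_lt n e)

lemma slice_sub {n : ℕ} (f g : (Fin (n + 1) → Idx d) → ℝ) (e : Idx d) :
    slice (f - g) e = slice f e - slice g e := by
  ext x
  simp only [slice, Pi.sub_apply]
  split_ifs <;> simp

/-- The set of points with increasing times. -/
def simplex (d n : ℕ) : Set (Fin n → Idx d) := {x | ∀ i j, i < j → (x i).1 < (x j).1}

lemma measurableSet_simplex (n : ℕ) : MeasurableSet (simplex d n) := by
  simp only [simplex, Set.ofPred_forall]
  exact MeasurableSet.iInter fun i => MeasurableSet.iInter fun j => MeasurableSet.iInter fun _ =>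
    measurableSet_lt (measurable_pi_apply i).fst (measurable_pi_apply j).fst

lemma snocMap_mem_simplex {n : ℕ} (e : Idx d) (x : Fin n → Idx d) :
    snocMap (e, x) ∈ simplex d (n + 1) ↔ (∀ k, (x k).1 < e.1) ∧ x ∈ simplex d n := by
  constructor
  · intro h
    refine ⟨fun k => ?_, fun i j hij => ?_⟩
    · simpa using h k.castSucc (Fin.last n) (Fin.castSucc_lt_last k)
    · simpa using h i.castSucc j.castSucc (by simpa using hij)
  · rintro ⟨h1, h2⟩ i j hij
    obtain ⟨i, rfl⟩ := Fin.eq_castSucc_of_ne_last (Fin.ne_last_of_lt hij)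
    refine Fin.lastCases (fun _ => ?_) (fun j hij => ?_) j hij
    · simpa using h1 i
    · simpa using h2 i j (by simpa using hij)

/-- Repeated slicing accumulates the conditions tₖ < t, so only values on the simplex matter. This
identity carries that fact through the inductions. -/
lemma indicator_simplex_slice {n : ℕ} (f : (Fin (n + 1) → Idx d) → ℝ) (e : Idx d)
    (x : Fin n → Idx d) :
    (simplex d n).indicator (slice f e) x = (simplex d (n + 1)).indicator f (snocMap (e, x)) := by
  classical
  simp only [Set.indicator_apply, snocMap_mem_simplex, slice_def, Set.mem_ofPred_eq]
  split_ifs <;> simp_all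

lemma idxPow_zero (F : (Fin 0 → Idx d) → ℝ≥0∞) : ∫⁻ x, F x ∂(idxPow d 0) = F Fin.elim0 := by
  rw [idxPow, Measure.pi_of_empty, lintegral_dirac]
  congr 1

/-! ### Iterated integrals -/

lemma isItoIntegral_zero : IsItoIntegral μ (fun _ _ => 0) (fun _ => 0) := by
  let S : SimpleProcess μ :=
    { len := 0
      left := Fin.elim0
      right := Fin.elim0
      left_le_right := fun k => k.elim0
      dir := Fin.elim0
      coef := fun k => k.elim0
      coef_bounded := fun k => k.elim0
      coef_adapted := fun k => k.elim0 }
  have h1 : ∀ e w, S.eval e w = 0 := fun e w => Fin.sum_univ_zero _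
  have h2 : ∀ w, S.integral w = 0 := fun w => Fin.sum_univ_zero _
  refine ⟨MemLp.zero', MemLp.zero', fun _ => S, ?_, ?_⟩ <;> simp [h1, h2]

namespace IsIteratedIntegral

lemma succ_iff {n : ℕ} {f : (Fin (n + 1) → Idx d) → ℝ} {X : Space d → ℝ} :
    IsIteratedIntegral μ (n + 1) f X ↔ ∃ U : Idx d → Space d → ℝ,
      (∀ᵐ e ∂(idxMeasure d), IsIteratedIntegral μ n (slice f e) (U e)) ∧ IsItoIntegral μ U X :=
  Iff.rfl

lemma const_mul {n : ℕ} {f : (Fin n → Idx d) → ℝ} {X : Space d → ℝ}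
    (h : IsIteratedIntegral μ n f X) (c : ℝ) :
    IsIteratedIntegral μ n (fun x => c * f x) (fun w => c * X w) := by
  induction n generalizing X with
  | zero =>
    change X =ᵐ[μ] _ at h
    change _ =ᵐ[μ] _
    filter_upwards [h] with w hw using by rw [hw]
  | succ n ih =>
    obtain ⟨U, hU, hX⟩ := succ_iff.1 h
    refine succ_iff.2 ⟨fun e w => c * U e w, ?_, hX.const_mul c⟩
    filter_upwards [hU] with e he
    convert ih he using 1
    ext x
    simp only [slice, mul_ite, mul_zero]

lemma add (hμ : IsWienerMeasure μ) {n : ℕ} {f g : (Fin n → Idx d) → ℝ} {X Y : Space d → ℝ}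
    (h : IsIteratedIntegral μ n f X) (h' : IsIteratedIntegral μ n g Y) :
    IsIteratedIntegral μ n (fun x => f x + g x) (fun w => X w + Y w) := by
  induction n generalizing X Y with
  | zero =>
    change X =ᵐ[μ] _ at h
    change Y =ᵐ[μ] _ at h'
    change _ =ᵐ[μ] _
    filter_upwards [h, h'] with w hw hw' using by rw [hw, hw']
  | succ n ih =>
    obtain ⟨U, hU, hX⟩ := succ_iff.1 h
    obtain ⟨V, hV, hY⟩ := succ_iff.1 h'
    refine succ_iff.2 ⟨fun e w => U e w + V e w, ?_, hX.add hμ hY⟩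
    filter_upwards [hU, hV] with e he he'
    convert ih he he' using 1
    ext x
    simp only [slice]
    split_ifs <;> simp

lemma sub (hμ : IsWienerMeasure μ) {n : ℕ} {f g : (Fin n → Idx d) → ℝ} {X Y : Space d → ℝ}
    (h : IsIteratedIntegral μ n f X) (h' : IsIteratedIntegral μ n g Y) :
    IsIteratedIntegral μ n (f - g) (X - Y) := by
  convert h.add hμ (h'.const_mul (-1)) using 2 <;> simp [sub_eq_add_neg]

lemma of_eq_zero_on_simplex {n : ℕ} {f : (Fin n → Idx d) → ℝ} (hf : ∀ x ∈ simplex d n, f x = 0) :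
    IsIteratedIntegral μ n f (fun _ => 0) := by
  induction n with
  | zero =>
    have : f Fin.elim0 = 0 := hf _ fun i => i.elim0
    change _ =ᵐ[μ] _
    rw [this]
  | succ n ih =>
    refine succ_iff.2 ⟨fun _ _ => 0, ae_of_all _ fun e => ih fun x hx => ?_, isItoIntegral_zero⟩
    have h := indicator_simplex_slice f e x
    rw [Set.indicator_of_mem hx] at h
    rw [h]
    by_cases hx' : snocMap (e, x) ∈ simplex d (n + 1)
    · rw [Set.indicator_of_mem hx', hf _ hx']
    · rw [Set.indicator_of_notMem hx']

/-- The iterated integral is a contraction for the norm of `L²` of the simplex. -/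
lemma lintegral_enorm_sq_le (hμ : IsWienerMeasure μ) {n : ℕ} {f : (Fin n → Idx d) → ℝ}
    {X : Space d → ℝ} (hf : AEStronglyMeasurable f (idxPow d n))
    (h : IsIteratedIntegral μ n f X) :
    ∫⁻ w, ‖X w‖ₑ ^ 2 ∂μ ≤ ∫⁻ x, ‖(simplex d n).indicator f x‖ₑ ^ 2 ∂(idxPow d n) := by
  have := hμ.isProbabilityMeasure
  induction n generalizing X with
  | zero =>
    change X =ᵐ[μ] _ at h
    have h0 : (Fin.elim0 : Fin 0 → Idx d) ∈ simplex d 0 := fun i => i.elim0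
    rw [idxPow_zero, Set.indicator_of_mem h0, lintegral_congr_ae (g := fun _ => ‖f Fin.elim0‖ₑ ^ 2)
      (h.mono fun w hw => by simp only [hw])]
    simp
  | succ n ih =>
    obtain ⟨U, hU, hX⟩ := succ_iff.1 h
    have h1 := pow_le_pow_left' (hX.eLpNorm_le hμ) 2
    rw [eLpNorm_two_sq, eLpNorm_two_sq] at h1
    refine h1.trans ?_
    rw [lintegral_prod _ (hX.1.1.enorm.pow_const 2), lintegral_snocMap
      ((hf.indicator (measurableSet_simplex _)).enorm.pow_const 2)]
    refine lintegral_mono_ae ?_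
    filter_upwards [hU, ae_aestronglyMeasurable_slice hf] with e he hm
    simpa only [indicator_simplex_slice, Function.uncurry_apply_pair] using ih hm he

lemma eLpNorm_le (hμ : IsWienerMeasure μ) {n : ℕ} {f : (Fin n → Idx d) → ℝ}
    {X : Space d → ℝ} (hf : AEStronglyMeasurable f (idxPow d n))
    (h : IsIteratedIntegral μ n f X) : eLpNorm X 2 μ ≤ eLpNorm f 2 (idxPow d n) := by
  rw [eLpNorm_two_eq, eLpNorm_two_eq]
  refine ENNReal.rpow_le_rpow ((h.lintegral_enorm_sq_le hμ hf).trans ?_) (by norm_num)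
  refine lintegral_mono fun x => ?_
  gcongr
  exact enorm_indicator_le_enorm_self f x

lemma lintegral_slice_le {n : ℕ} {f : (Fin (n + 1) → Idx d) → ℝ}
    (hf : AEStronglyMeasurable f (idxPow d (n + 1))) :
    ∫⁻ e, ∫⁻ x, ‖slice f e x‖ₑ ^ 2 ∂(idxPow d n) ∂(idxMeasure d) ≤
      ∫⁻ x, ‖f x‖ₑ ^ 2 ∂(idxPow d (n + 1)) := by
  rw [lintegral_snocMap (hf.enorm.pow_const 2)]
  refine lintegral_mono fun e => lintegral_mono fun x => ?_
  gcongr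
  rw [slice_def]
  exact enorm_indicator_le_enorm_self _ x

lemma aestronglyMeasurable {n : ℕ} {f : (Fin n → Idx d) → ℝ} {X : Space d → ℝ}
    (h : IsIteratedIntegral μ n f X) : AEStronglyMeasurable X μ := by
  cases n with
  | zero => exact aestronglyMeasurable_const.congr (EventuallyEq.symm h)
  | succ n =>
    obtain ⟨U, -, hX⟩ := succ_iff.1 h
    exact hX.2.1.1

lemma memLp (hμ : IsWienerMeasure μ) {n : ℕ} {f : (Fin n → Idx d) → ℝ} {X : Space d → ℝ}
    (hf : MemLp f 2 (idxPow d n)) (h : IsIteratedIntegral μ n f X) : MemLp X 2 μ :=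
  ⟨h.aestronglyMeasurable, (h.eLpNorm_le hμ hf.1).trans_lt hf.2⟩

lemma measurable_lintegral_slice {n : ℕ} {f : (Fin (n + 1) → Idx d) → ℝ}
    (hf : AEStronglyMeasurable f (idxPow d (n + 1))) :
    AEMeasurable (fun e => ∫⁻ x, ‖slice f e x‖ₑ ^ 2 ∂(idxPow d n)) (idxMeasure d) := by
  have h := hf.comp_measurePreserving (measurePreserving_snocMap n)
  have hS : MeasurableSet {z : Idx d × (Fin n → Idx d) | ∀ k, (z.2 k).1 < z.1.1} := by
    rw [Set.ofPred_forall]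
    exact MeasurableSet.iInter fun k =>
      measurableSet_lt ((measurable_pi_apply k).comp measurable_snd).fst measurable_fst.fst
  convert ((h.indicator hS).enorm.pow_const 2).lintegral_prod_right' using 4 with e x
  rw [slice_def]
  rfl

/-- The graph of the iterated integral is closed in `L²`. -/
lemma of_tendsto (hμ : IsWienerMeasure μ) {n : ℕ} {f : (Fin n → Idx d) → ℝ}
    {fs : ℕ → (Fin n → Idx d) → ℝ} {X : Space d → ℝ} {Xs : ℕ → Space d → ℝ}
    (hf : AEStronglyMeasurable f (idxPow d n))
    (hfs : ∀ m, AEStronglyMeasurable (fs m) (idxPow d n)) (hX : MemLp X 2 μ)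
    (h : ∀ m, IsIteratedIntegral μ n (fs m) (Xs m))
    (hlim : Tendsto (fun m => eLpNorm (f - fs m) 2 (idxPow d n)) atTop (𝓝 0))
    (hlim' : Tendsto (fun m => eLpNorm (X - Xs m) 2 μ) atTop (𝓝 0)) :
    IsIteratedIntegral μ n f X := by
  have := hμ.isProbabilityMeasure
  induction n generalizing X Xs with
  | zero =>
    change X =ᵐ[μ] _
    -- In order zero the kernel space is a point, and the difference of the constants is itself a
    -- 0-fold integral, bounded by the kernel norm.
    have h0 : ∀ m, IsIteratedIntegral μ 0 (f - fs m) (fun _ => f Fin.elim0 - fs m Fin.elim0) :=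
      fun m => EventuallyEq.rfl
    have key : ∀ m, eLpNorm (X - fun _ => f Fin.elim0) 2 μ ≤
        eLpNorm (X - Xs m) 2 μ + eLpNorm (f - fs m) 2 (idxPow d 0) := by
      intro m
      have hm : Xs m =ᵐ[μ] fun _ => fs m Fin.elim0 := h m
      have e : (X - fun _ => f Fin.elim0 : Space d → ℝ) =ᵐ[μ]
          (X - Xs m) - fun _ => f Fin.elim0 - fs m Fin.elim0 := by
        filter_upwards [hm] with w hw
        simp [hw]
      rw [eLpNorm_congr_ae e]
      exact (eLpNorm_sub_le (hX.1.sub (h m).aestronglyMeasurable)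
        aestronglyMeasurable_const (by norm_num)).trans
        (add_le_add le_rfl ((h0 m).eLpNorm_le hμ (hf.sub (hfs m))))
    have hz : eLpNorm (X - fun _ => f Fin.elim0) 2 μ = 0 :=
      le_antisymm (ge_of_tendsto' (by simpa using hlim'.add hlim) key) zero_le
    rw [eLpNorm_eq_zero_iff (hX.1.sub aestronglyMeasurable_const) (by norm_num)] at hz
    filter_upwards [hz] with w hw
    simpa [sub_eq_zero] using hw
  | succ n ih =>
    choose U hU hUX using fun m => succ_iff.1 (h m)
    set ρ := (idxMeasure d).prod μ with hρ
    set b : ℕ → ℝ≥0∞ := fun m => eLpNorm (f - fs m) 2 (idxPow d (n + 1)) with hb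
    -- The inner integrals form a Cauchy sequence in L²(dt × μ): for almost every e the difference
    -- is an iterated integral of a difference of slices, hence bounded by its norm.
    have hUU : ∀ m l, eLpNorm (Function.uncurry (U m) - Function.uncurry (U l)) 2 ρ ≤
        b m + b l := by
      intro m l
      have h1 : eLpNorm (Function.uncurry (U m) - Function.uncurry (U l)) 2 ρ ≤
          eLpNorm (fs m - fs l) 2 (idxPow d (n + 1)) := by
        rw [eLpNorm_two_eq, eLpNorm_two_eq]
        refine ENNReal.rpow_le_rpow ?_ (by norm_num)
        rw [lintegral_prod _ (((hUX m).1.1.sub (hUX l).1.1).enorm.pow_const 2)]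
        refine le_trans (lintegral_mono_ae ?_) (lintegral_slice_le ((hfs m).sub (hfs l)))
        filter_upwards [hU m, hU l, ae_aestronglyMeasurable_slice ((hfs m).sub (hfs l))]
          with e h1 h2 h3
        have h4 := h1.sub hμ h2
        rw [← slice_sub] at h4
        have h5 := pow_le_pow_left' (h4.eLpNorm_le hμ h3) 2
        rwa [eLpNorm_two_sq, eLpNorm_two_sq] at h5
      refine h1.trans ?_
      have e : fs m - fs l = (f - fs l) - (f - fs m) := by abel
      rw [e, add_comm (b m)]
      exact eLpNorm_sub_le (hf.sub (hfs l)) (hf.sub (hfs m)) (by norm_num)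
    obtain ⟨V, hV, hVlim⟩ := exists_tendsto_eLpNorm_sub (fun m => (hUX m).1) hlim hUU
    have hm1 : ∀ m, AEMeasurable (fun e => ∫⁻ x, ‖slice (f - fs m) e x‖ₑ ^ 2 ∂(idxPow d n))
        (idxMeasure d) := fun m => measurable_lintegral_slice (hf.sub (hfs m))
    have hm2 : ∀ m, AEMeasurable (fun e => ∫⁻ w, ‖(V - Function.uncurry (U m)) (e, w)‖ₑ ^ 2 ∂μ)
        (idxMeasure d) := fun m =>
      ((hV.1.sub (hUX m).1.1).enorm.pow_const 2).lintegral_prod_right'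
    -- L² convergence does not give convergence at each e. A subsequence of the sum of both squared
    -- distances makes slices and inner integrals converge together for almost every e, where the
    -- induction hypothesis applies.
    obtain ⟨φ, hφ, hae⟩ := exists_subseq_ae_tendsto_zero (ν := idxMeasure d)
      (a := fun m e => ∫⁻ x, ‖slice (f - fs m) e x‖ₑ ^ 2 ∂(idxPow d n) +
        ∫⁻ w, ‖(V - Function.uncurry (U m)) (e, w)‖ₑ ^ 2 ∂μ) (fun m => (hm1 m).add (hm2 m)) (by
      have hl := (ENNReal.Tendsto.pow (n := 2) hlim).add (ENNReal.Tendsto.pow (n := 2) hVlim)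
      simp only [ne_eq, OfNat.ofNat_ne_zero, not_false_eq_true, zero_pow, add_zero] at hl
      refine tendsto_of_tendsto_of_tendsto_of_le_of_le tendsto_const_nhds hl
        (fun _ => zero_le) fun m => ?_
      simp only
      rw [lintegral_add_left' (hm1 m), eLpNorm_two_sq, eLpNorm_two_sq]
      refine add_le_add (lintegral_slice_le (hf.sub (hfs m))) (le_of_eq ?_)
      rw [lintegral_prod _ ((hV.1.sub (hUX m).1.1).enorm.pow_const 2)])
    have hVe : ∀ᵐ e ∂(idxMeasure d), MemLp (fun w => V (e, w)) 2 μ := by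
      have h2 : ∫⁻ e, ∫⁻ w, ‖V (e, w)‖ₑ ^ 2 ∂μ ∂(idxMeasure d) ≠ ∞ := by
        rw [← lintegral_prod _ (hV.1.enorm.pow_const 2), ← eLpNorm_two_sq]
        exact ENNReal.pow_ne_top hV.2.ne
      filter_upwards [hV.1.prodMk_left, ae_lt_top'
        (hV.1.enorm.pow_const 2).lintegral_prod_right' h2] with e h3 h4
      refine ⟨h3, ?_⟩
      rw [eLpNorm_two_eq]
      exact ENNReal.rpow_lt_top_of_nonneg (by norm_num) h4.ne
    refine succ_iff.2 ⟨fun e w => V (e, w), ?_, ?_⟩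
    · filter_upwards [hae, hVe, ae_aestronglyMeasurable_slice hf,
        ae_all_iff.2 fun m => ae_aestronglyMeasurable_slice (hfs m), ae_all_iff.2 hU]
        with e h1 h2 h3 h4 h5
      have hsqrt : ∀ {a : ℕ → ℝ≥0∞}, Tendsto a atTop (𝓝 0) →
          Tendsto (fun m => a m ^ (1 / 2 : ℝ)) atTop (𝓝 0) := fun {a} ha => by
        have := (ENNReal.continuous_rpow_const (y := (1 / 2 : ℝ))).tendsto _ |>.comp ha
        simpa [Function.comp_def] using this
      refine ih (fs := fun m => slice (fs (φ m)) e) (Xs := fun m => U (φ m) e) h3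
        (fun m => h4 _) h2 (fun m => h5 _) ?_ ?_
      · simp only [eLpNorm_two_eq, ← slice_sub]
        exact hsqrt (tendsto_of_tendsto_of_tendsto_of_le_of_le tendsto_const_nhds h1
          (fun _ => zero_le) fun m => le_self_add)
      · simp only [eLpNorm_two_eq]
        exact hsqrt (tendsto_of_tendsto_of_tendsto_of_le_of_le tendsto_const_nhds h1
          (fun _ => zero_le) fun m => le_add_self)
    · exact IsItoIntegral.of_tendsto hμ hUX hV hX hVlim hlim'

/-- Closedness of the graph along a constant sequence: functions at L² distance zero are limits of
each other. -/
lemma congr_left (hμ : IsWienerMeasure μ) {n : ℕ} {f g : (Fin n → Idx d) → ℝ} {X : Space d → ℝ}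
    (hf : MemLp f 2 (idxPow d n)) (h : IsIteratedIntegral μ n f X)
    (hfg : g =ᵐ[idxPow d n] f) : IsIteratedIntegral μ n g X := by
  refine of_tendsto hμ (fs := fun _ => f) (Xs := fun _ => X) (hf.1.congr hfg.symm)
    (fun _ => hf.1) (h.memLp hμ hf) (fun _ => h) ?_ (by simp)
  rw [eLpNorm_congr_ae (g := 0) (hfg.mono fun x hx => by simp [hx])]
  simp

lemma congr_right (hμ : IsWienerMeasure μ) {n : ℕ} {f : (Fin n → Idx d) → ℝ} {X Y : Space d → ℝ}
    (hf : MemLp f 2 (idxPow d n)) (h : IsIteratedIntegral μ n f X)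
    (hXY : Y =ᵐ[μ] X) : IsIteratedIntegral μ n f Y := by
  refine of_tendsto hμ (fs := fun _ => f) (Xs := fun _ => X) hf.1
    (fun _ => hf.1) ((h.memLp hμ hf).ae_eq hXY.symm) (fun _ => h) (by simp) ?_
  rw [eLpNorm_congr_ae (g := 0) (hXY.mono fun x hx => by simp [hx])]
  simp

/-- By linearity X - Y integrates a kernel that is null almost everywhere, so the contraction bound
makes its norm zero. -/
lemma ae_unique (hμ : IsWienerMeasure μ) {n : ℕ} {f g : (Fin n → Idx d) → ℝ}
    {X Y : Space d → ℝ} (hf : MemLp f 2 (idxPow d n)) (h : IsIteratedIntegral μ n f X)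
    (h' : IsIteratedIntegral μ n g Y) (hfg : g =ᵐ[idxPow d n] f) : X =ᵐ[μ] Y := by
  have h1 := (h.sub hμ h').eLpNorm_le hμ (hf.1.sub (hf.1.congr hfg.symm))
  rw [eLpNorm_congr_ae (g := 0) (hfg.mono fun x hx => by simp [hx]), eLpNorm_zero,
    nonpos_iff_eq_zero, eLpNorm_eq_zero_iff
      (h.aestronglyMeasurable.sub h'.aestronglyMeasurable) (by norm_num)] at h1
  filter_upwards [h1] with w hw
  simpa [sub_eq_zero] using hw

end IsIteratedIntegral

/-! ### Products of disjoint increments -/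

/-- The indicator function of the box `∏_k (s_k, t_k] × {j_k}`. -/
noncomputable def boxFn {n : ℕ} (s t : Fin n → unitInterval) (j : Fin n → Fin d)
    (x : Fin n → Idx d) : ℝ :=
  ∏ k, step (incr (s k) (t k) (j k)) (x k)

/-- Since the intervals are successive, the constraint tₖ < t is automatic on the box, and the
product of the earlier increments lies in the past of the last left endpoint.
`IsItoIntegral.incr_mul` then integrates the last variable. -/
lemma isIteratedIntegral_boxFn (hμ : IsWienerMeasure μ) {n : ℕ} {s t : Fin n → unitInterval}
    (j : Fin n → Fin d) (hst : ∀ k, s k ≤ t k) (hts : ∀ k l, k < l → t k ≤ s l) :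
    IsIteratedIntegral μ n (boxFn s t j)
      (fun w => ∏ k, wien (incr (s k) (t k) (j k)) w) := by
  have := hμ.isProbabilityMeasure
  induction n with
  | zero => exact ae_of_all _ fun w => by simp [boxFn]
  | succ n ih =>
    have ih' := ih (s := fun k => s k.castSucc) (t := fun k => t k.castSucc)
      (fun k => j k.castSucc) (fun k => hst _) fun k l hkl => hts _ _ (by simpa using hkl)
    refine IsIteratedIntegral.succ_iff.2
      ⟨fun e w => step (incr (s (Fin.last n)) (t (Fin.last n)) (j (Fin.last n))) e *
        ∏ k : Fin n, wien (incr (s k.castSucc) (t k.castSucc) (j k.castSucc)) w,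
        ae_of_all _ fun e => ?_, ?_⟩
    · convert ih'.const_mul (step (incr (s (Fin.last n)) (t (Fin.last n)) (j (Fin.last n))) e)
        using 1
      ext x
      rw [slice_def, Set.indicator_apply]
      split_ifs with hx
      · simp only [boxFn, Fin.prod_univ_castSucc, snocMap_castSucc, snocMap_last]
        ring
      · simp only [Set.mem_ofPred_eq, not_forall, not_lt] at hx
        obtain ⟨k, hk⟩ := hx
        symm
        rw [mul_eq_zero, step_incr (hst _)]
        -- If e comes after the last left endpoint, the time of `x k` lies beyond its own interval
        -- and that factor vanishes; otherwise the last factor does.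
        by_cases he : s (Fin.last n) < e.1
        · right
          refine Finset.prod_eq_zero (Finset.mem_univ k) ?_
          rw [step_incr (hst _), if_neg]
          rintro ⟨-, h2, -⟩
          exact absurd (hk.trans (h2.trans (hts _ _ (Fin.castSucc_lt_last k)))) (not_le.2 he)
        · left
          rw [if_neg fun h => he h.1]
    · have hY : AEStronglyMeasurable[past d (s (Fin.last n))]
          (fun w : Space d => ∏ k : Fin n,
            wien (incr (s k.castSucc) (t k.castSucc) (j k.castSucc)) w) μ := by
        refine (Measurable.stronglyMeasurable (mα := past d (s (Fin.last n))) ?_).aestronglyMeasurable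
        refine Finset.measurable_fun_prod _ fun k _ => ?_
        have h1 := hts _ _ (Fin.castSucc_lt_last k)
        rw [show wien (incr (s k.castSucc) (t k.castSucc) (j k.castSucc)) = fun w => _ from
          funext (wien_incr _ _ _)]
        exact (measurable_past_coord h1 _).sub (measurable_past_coord ((hst _).trans h1) _)
      have h := IsItoIntegral.incr_mul hμ (hst (Fin.last n)) (j (Fin.last n)) hY
        (HasFiniteMoments.prod fun k _ => hμ.hasFiniteMoments_wien _).memLp_two
      simpa only [Fin.prod_univ_castSucc] using h

end

section

variable {d : ℕ} {μ : Measure (Space d)}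

/-! ### Density of boxes -/

/-- The box `∏_k [0, e_k.1] × {e_k.2}`. -/
def cornerSet {n : ℕ} (e : Fin n → Idx d) : Set (Fin n → Idx d) :=
  Set.univ.pi fun k => Set.Iic (e k).1 ×ˢ {(e k).2}

lemma measurableSet_cornerSet {n : ℕ} (e : Fin n → Idx d) : MeasurableSet (cornerSet e) :=
  MeasurableSet.univ_pi fun k => measurableSet_corner (e k)

lemma mem_cornerSet {n : ℕ} {e x : Fin n → Idx d} :
    x ∈ cornerSet e ↔ ∀ k, (x k).1 ≤ (e k).1 ∧ (x k).2 = (e k).2 := by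
  simp [cornerSet, Set.mem_pi, Set.mem_prod]

/-- A π-system generating the σ-algebra of the index space. -/
def cornerPiSystem (d : ℕ) : Set (Set (Idx d)) :=
  Set.image2 (· ×ˢ ·) (Set.range Set.Iic) {s | s.Subsingleton}

lemma isPiSystem_cornerPiSystem : IsPiSystem (cornerPiSystem d) := by
  rintro _ ⟨_, ⟨a, rfl⟩, s, hs, rfl⟩ _ ⟨_, ⟨b, rfl⟩, t, -, rfl⟩ -
  exact ⟨_, ⟨min a b, rfl⟩, s ∩ t, Set.Subsingleton.anti hs Set.inter_subset_left, by
    simp only [Set.prod_inter_prod, Set.Iic_inter_Iic]⟩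

lemma isCountablySpanning_Iic :
    IsCountablySpanning (Set.range (Set.Iic : unitInterval → Set unitInterval)) :=
  ⟨fun _ => Set.Iic 1, fun _ => ⟨1, rfl⟩, by
    rw [Set.iUnion_const]; exact Set.eq_univ_of_forall fun x => x.2.2⟩

/-- The sets with index n ≥ d are empty, which singletons would not allow; d = 0 is covered as well.
-/
lemma isCountablySpanning_subsingleton :
    IsCountablySpanning {s : Set (Fin d) | s.Subsingleton} :=
  ⟨fun n => {x | (x : ℕ) = n}, fun _ _ hx _ hy => Fin.ext (Eq.trans hx (Eq.symm hy)),
    Set.eq_univ_of_forall fun x => Set.mem_iUnion.2 ⟨x, rfl⟩⟩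

lemma generateFrom_cornerPiSystem :
    MeasurableSpace.generateFrom (cornerPiSystem d) = (inferInstance : MeasurableSpace (Idx d)) := by
  rw [cornerPiSystem, ← generateFrom_prod_eq isCountablySpanning_Iic
    isCountablySpanning_subsingleton]
  have h1 : MeasurableSpace.generateFrom
      (Set.range (Set.Iic : unitInterval → Set unitInterval)) =
      (inferInstance : MeasurableSpace unitInterval) := by
    rw [← borel_eq_generateFrom_Iic]
    exact (BorelSpace.measurable_eq (α := unitInterval)).symm
  have h2 : MeasurableSpace.generateFrom {s : Set (Fin d) | s.Subsingleton} =
      (inferInstance : MeasurableSpace (Fin d)) := by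
    refine le_antisymm (fun s _ => MeasurableSet.of_discrete) fun s _ => ?_
    rw [← Set.biUnion_of_singleton s]
    exact MeasurableSet.biUnion s.to_countable fun x _ =>
      MeasurableSpace.measurableSet_generateFrom Set.subsingleton_singleton
  rw [h1, h2]

lemma isCountablySpanning_cornerPiSystem : IsCountablySpanning (cornerPiSystem d) :=
  isCountablySpanning_Iic.prod isCountablySpanning_subsingleton

lemma iUnion_cornerSet (n : ℕ) :
    ⋃ j : Fin n → Fin d, cornerSet (fun k => ((1 : unitInterval), j k)) = Set.univ :=
  Set.eq_univ_of_forall fun x => Set.mem_iUnion.2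
    ⟨fun k => (x k).2, mem_cornerSet.2 fun k => ⟨(x k).1.2.2, rfl⟩⟩

/-- An integrable function is determined by its integrals over the boxes
`∏_k [0, t_k] × {j_k}`. -/
lemma ae_eq_zero_of_setIntegral_cornerSet {n : ℕ} {f : (Fin n → Idx d) → ℝ}
    (hf : Integrable f (idxPow d n)) (h : ∀ e, ∫ x in cornerSet e, f x ∂(idxPow d n) = 0) :
    f =ᵐ[idxPow d n] 0 := by
  -- The whole space is the disjoint union, over all choices of labels, of the boxes with end time
  -- 1. The complement step of the induction needs its integral.
  have huniv : ∫ x, f x ∂(idxPow d n) = 0 := by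
    rw [← setIntegral_univ, ← iUnion_cornerSet, integral_iUnion_fintype
      (fun j => measurableSet_cornerSet _) _ fun j => hf.integrableOn]
    · exact Finset.sum_eq_zero fun j _ => h _
    · intro j j' hj
      refine Set.disjoint_left.2 fun x hx hx' => hj (funext fun k => ?_)
      exact ((mem_cornerSet.1 hx k).2).symm.trans (mem_cornerSet.1 hx' k).2
  have key : ∀ s, MeasurableSet s → ∫ x in s, f x ∂(idxPow d n) = 0 := by
    intro s hs
    induction s, hs using MeasurableSpace.induction_on_inter
      (generateFrom_eq_pi (fun _ : Fin n => generateFrom_cornerPiSystem (d := d))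
        (fun _ => isCountablySpanning_cornerPiSystem)).symm
      (IsPiSystem.pi fun _ => isPiSystem_cornerPiSystem) with
    | empty => simp
    | basic t ht =>
      obtain ⟨A, hA, rfl⟩ := ht
      -- In a nonempty box every subsingleton of labels is a singleton, so the box is a `cornerSet`.
      by_cases hne : (Set.univ.pi A).Nonempty
      · obtain ⟨x, hx⟩ := hne
        have : ∀ k, ∃ a : unitInterval, A k = Set.Iic a ×ˢ {(x k).2} := by
          intro k
          obtain ⟨_, ⟨a, rfl⟩, s, hs, hk⟩ := hA k (Set.mem_univ k)
          have hxk := hx k (Set.mem_univ k)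
          rw [← hk] at hxk ⊢
          exact ⟨a, by rw [Set.Subsingleton.eq_singleton_of_mem hs hxk.2]⟩
        choose a ha using this
        have e : Set.univ.pi A = cornerSet fun k => (a k, (x k).2) := by
          unfold cornerSet
          congr 1
          ext1 k
          exact ha k
        rw [e]
        exact h _
      · rw [Set.not_nonempty_iff_eq_empty.1 hne]
        simp
    | compl t ht ih =>
      have := integral_add_compl ht hf
      rw [ih, zero_add, huniv] at this
      exact this
    | iUnion g hd hm ih =>
      rw [integral_iUnion hm hd hf.integrableOn]
      simp [ih]
  exact hf.ae_eq_zero_of_forall_setIntegral_eq_zero fun s hs _ => key s hs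

/-- The last time allowed for the `k`-th variable when the later ones are above `s`. -/
def tailInf {n : ℕ} (s : Fin n → unitInterval) (k : Fin n) : unitInterval :=
  (Finset.univ.filter (k < ·)).inf s

lemma tailInf_le {n : ℕ} (s : Fin n → unitInterval) {k l : Fin n} (h : k < l) :
    tailInf s k ≤ s l :=
  Finset.inf_le (by simpa using h)

/-- The points whose `k`-th time lies in `(s_k, s_l]` for all `l > k`. -/
def stairSet {n : ℕ} (s : Fin n → unitInterval) : Set (Fin n → Idx d) :=
  {x | ∀ k, s k < (x k).1 ∧ (x k).1 ≤ tailInf s k}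

lemma measurableSet_stairSet {n : ℕ} (s : Fin n → unitInterval) :
    MeasurableSet (stairSet (d := d) s) := by
  simp only [stairSet, Set.ofPred_forall]
  exact MeasurableSet.iInter fun k =>
    (measurableSet_lt (f := fun _ : Fin n → Idx d => s k) (g := fun x => (x k).1)
      measurable_const (measurable_pi_apply k).fst).inter
      (measurableSet_le (f := fun x : Fin n → Idx d => (x k).1) (measurable_pi_apply k).fst
        measurable_const)

/-- A point of a countable dense sequence fits below each time and above the earlier ones, so
countably many stairs cover the part of the simplex with nonzero times. For the first variable the
supremum is empty, equal to 0, whence the condition on the times. -/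
lemma exists_mem_stairSet {n : ℕ} {x : Fin n → Idx d} (hx : x ∈ simplex d n)
    (h0 : ∀ k, (x k).1 ≠ 0) :
    ∃ a : Fin n → ℕ, x ∈ stairSet fun k => TopologicalSpace.denseSeq unitInterval (a k) := by
  have : ∀ k, ∃ a : ℕ, (Finset.univ.filter (· < k)).sup (fun i => (x i).1) <
      TopologicalSpace.denseSeq unitInterval a ∧
      TopologicalSpace.denseSeq unitInterval a < (x k).1 := by
    intro k
    have hlt : (Finset.univ.filter (· < k)).sup (fun i => (x i).1) < (x k).1 := by
      rw [Finset.sup_lt_iff (bot_lt_iff_ne_bot.2 (h0 k))]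
      exact fun i hi => hx i k (by simpa using hi)
    obtain ⟨_, ⟨a, rfl⟩, ha⟩ :=
      (TopologicalSpace.denseRange_denseSeq unitInterval).exists_between hlt
    exact ⟨a, ha.1, ha.2⟩
  choose a ha ha' using this
  refine ⟨a, fun k => ⟨ha' k, Finset.le_inf fun l hl => ?_⟩⟩
  have : (x k).1 ≤ (Finset.univ.filter (· < l)).sup (fun i => (x i).1) :=
    Finset.le_sup (f := fun i => (x i).1) (by simpa using hl)
  exact this.trans (ha l).le

lemma ae_ne_zero (n : ℕ) : ∀ᵐ x ∂(idxPow d n), ∀ k, (x k).1 ≠ 0 := by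
  rw [ae_all_iff]
  intro k
  have h0 : idxMeasure d {e | e.1 = 0} = 0 := by
    have : {e : Idx d | e.1 = 0} = {0} ×ˢ Set.univ := by ext e; simp
    rw [this, idxMeasure, Measure.prod_prod]
    simp
  have := Measure.pi_eval_preimage_null (μ := fun _ : Fin n => idxMeasure d) (i := k) h0
  exact measure_mono_null (fun x hx => by simpa using hx) this

lemma boxFn_eq {n : ℕ} {s t : Fin n → unitInterval} (j : Fin n → Fin d) (hst : ∀ k, s k ≤ t k)
    (x : Fin n → Idx d) :
    boxFn s t j x =
      {x : Fin n → Idx d | ∀ k, s k < (x k).1 ∧ (x k).1 ≤ t k ∧ (x k).2 = j k}.indicator 1 x := by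
  classical
  simp only [boxFn, step_incr (hst _)]
  rw [Finset.prod_ite_zero, Set.indicator_apply]
  simp

lemma abs_step_incr_le {s t : unitInterval} (hst : s ≤ t) (j : Fin d) (x : Idx d) :
    |step (incr s t j) x| ≤ 1 := by
  rw [step_incr hst]
  split_ifs <;> simp

lemma measurable_boxFn {n : ℕ} (s t : Fin n → unitInterval) (j : Fin n → Fin d) :
    Measurable (boxFn s t j) :=
  Finset.measurable_fun_prod _ fun k _ => (measurable_step _).comp (measurable_pi_apply k)

lemma memLp_boxFn {n : ℕ} {s t : Fin n → unitInterval} (j : Fin n → Fin d)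
    (hst : ∀ k, s k ≤ t k) : MemLp (boxFn s t j) 2 (idxPow d n) := by
  refine MemLp.of_bound (measurable_boxFn s t j).aestronglyMeasurable 1 (ae_of_all _ fun x => ?_)
  rw [boxFn, Real.norm_eq_abs, Finset.abs_prod]
  exact Finset.prod_le_one (fun _ _ => abs_nonneg _) fun k _ => abs_step_incr_le (hst k) _ _

/-- A closed subspace of `L²` that contains the ordered boxes, and the functions that vanish on
the simplex, contains everything. -/
lemma eq_top_of_boxFn_mem {n : ℕ} {K : Submodule ℝ (Lp ℝ 2 (idxPow d n))}
    (hK : IsClosed (K : Set (Lp ℝ 2 (idxPow d n))))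
    (hbox : ∀ (s t : Fin n → unitInterval) (j : Fin n → Fin d) (hst : ∀ k, s k ≤ t k),
      (∀ k l, k < l → t k ≤ s l) → (memLp_boxFn j hst).toLp (boxFn s t j) ∈ K)
    (hsimplex : ∀ F : Lp ℝ 2 (idxPow d n), (∀ᵐ x ∂(idxPow d n), x ∈ simplex d n → F x = 0) →
      F ∈ K) : K = ⊤ := by
  -- It suffices that an element F of the orthogonal complement vanishes: off the simplex by testing
  -- it against its own restriction, on the simplex by boxes.
  rw [← hK.submodule_topologicalClosure_eq, Submodule.topologicalClosure_eq_top_iff,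
    Submodule.eq_bot_iff]
  intro F hF
  have hF2 : MemLp F 2 (idxPow d n) := Lp.memLp F
  have hFi : Integrable F (idxPow d n) := hF2.integrable (by norm_num)
  have horth : ∀ {G : (Fin n → Idx d) → ℝ} (hG : MemLp G 2 (idxPow d n)), hG.toLp G ∈ K →
      ∫ x, F x * G x ∂(idxPow d n) = 0 := by
    intro G hG hGK
    have h := hF _ hGK
    rw [L2.inner_def] at h
    rw [← h]
    refine integral_congr_ae ?_
    filter_upwards [hG.coeFn_toLp] with x hx
    simp [hx]
  have hout : ∀ᵐ x ∂(idxPow d n), x ∉ simplex d n → F x = 0 := by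
    have hm := (measurableSet_simplex (d := d) n).compl
    have hG : MemLp ((simplex d n)ᶜ.indicator F) 2 (idxPow d n) := hF2.indicator hm
    have h := horth hG (hsimplex _ (by
      filter_upwards [hG.coeFn_toLp] with x hx hxs
      rw [hx, Set.indicator_of_notMem (by simpa using hxs)]))
    have hnonneg : 0 ≤ᵐ[idxPow d n] fun x => F x * (simplex d n)ᶜ.indicator F x :=
      ae_of_all _ fun x => by
        by_cases hx : x ∈ (simplex d n)ᶜ
        · simpa [Set.indicator_of_mem hx] using mul_self_nonneg (F x)
        · simp [Set.indicator_of_notMem hx]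
    have hint : Integrable (fun x => F x * (simplex d n)ᶜ.indicator F x) (idxPow d n) :=
      hF2.integrable_mul hG
    filter_upwards [(integral_eq_zero_iff_of_nonneg_ae hnonneg hint).1 h] with x hx hxs
    rw [Set.indicator_of_mem (by simpa using hxs)] at hx
    simpa using hx
  -- A stair intersected with a corner box is an ordered box or empty, so F is orthogonal to it.
  -- Corner boxes determine an integrable function.
  have hstair : ∀ s : Fin n → unitInterval,
      (stairSet (d := d) s).indicator F =ᵐ[idxPow d n] 0 := by
    intro s
    refine ae_eq_zero_of_setIntegral_cornerSet (hFi.indicator (measurableSet_stairSet s))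
      fun e => ?_
    rw [← integral_indicator (measurableSet_cornerSet e)]
    have hmem : ∀ x : Fin n → Idx d, (x ∈ cornerSet e ∧ x ∈ stairSet s) ↔
        ∀ k, s k < (x k).1 ∧ (x k).1 ≤ min (tailInf s k) (e k).1 ∧ (x k).2 = (e k).2 := by
      intro x
      rw [mem_cornerSet]
      constructor
      · rintro ⟨h1, h2⟩ k
        exact ⟨(h2 k).1, le_min (h2 k).2 (h1 k).1, (h1 k).2⟩
      · intro h
        exact ⟨fun k => ⟨(h k).2.1.trans (min_le_right _ _), (h k).2.2⟩,
          fun k => ⟨(h k).1, (h k).2.1.trans (min_le_left _ _)⟩⟩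
    by_cases hst : ∀ k, s k ≤ min (tailInf s k) (e k).1
    · have h := horth (memLp_boxFn (fun k => (e k).2) hst) (hbox _ _ _ hst fun k l hkl =>
        (min_le_left _ _).trans (tailInf_le s hkl))
      rw [← h]
      congr 1
      ext x
      classical
      rw [boxFn_eq _ hst]
      by_cases h1 : x ∈ cornerSet e ∧ x ∈ stairSet s
      · have h2 := (hmem x).1 h1
        rw [Set.indicator_of_mem h1.1, Set.indicator_of_mem h1.2,
          Set.indicator_apply, if_pos (by exact h2)]
        simp
      · have h2 := fun h => h1 ((hmem x).2 h)
        rw [Set.indicator_apply {x : Fin n → Idx d | _}, if_neg (by exact h2), mul_zero]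
        by_cases h3 : x ∈ cornerSet e
        · rw [Set.indicator_of_mem h3, Set.indicator_of_notMem fun h4 => h1 ⟨h3, h4⟩]
        · rw [Set.indicator_of_notMem h3]
    · push Not at hst
      obtain ⟨k, hk⟩ := hst
      rw [← integral_zero (α := Fin n → Idx d) ℝ]
      congr 1
      ext x
      by_cases h3 : x ∈ cornerSet e
      · rw [Set.indicator_of_mem h3, Set.indicator_of_notMem fun h4 => ?_]
        have := (hmem x).1 ⟨h3, h4⟩ k
        exact absurd (this.1.trans_le this.2.1) (not_lt.2 hk.le)
      · rw [Set.indicator_of_notMem h3]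
  rw [Lp.eq_zero_iff_ae_eq_zero]
  have hall := ae_all_iff.2 fun a : Fin n → ℕ =>
    hstair fun k => TopologicalSpace.denseSeq unitInterval (a k)
  filter_upwards [hout, hall, ae_ne_zero n] with x h1 h2 h3
  by_cases hx : x ∈ simplex d n
  · obtain ⟨a, ha⟩ := exists_mem_stairSet hx h3
    have := h2 a
    rwa [Set.indicator_of_mem ha] at this
  · exact h1 hx

end

section

variable {d : ℕ} {μ : Measure (Space d)}

/-! ### The iterated integral as a bounded operator -/

/-- Kernels having an integral form a subspace, closed by the contraction bound and completeness of
L²(μ). It contains the ordered boxes and the kernels null on the simplex, so it is everything. -/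
lemma IsIteratedIntegral.exists_of_lp (hμ : IsWienerMeasure μ) {n : ℕ}
    (F : Lp ℝ 2 (idxPow d n)) : ∃ X, IsIteratedIntegral μ n F X := by
  let K : Submodule ℝ (Lp ℝ 2 (idxPow d n)) :=
    { carrier := {F | ∃ X, IsIteratedIntegral μ n F X}
      add_mem' := by
        rintro F G ⟨X, hX⟩ ⟨Y, hY⟩
        exact ⟨_, (hX.add hμ hY).congr_left hμ ((Lp.memLp F).add (Lp.memLp G))
          (Lp.coeFn_add F G)⟩
      zero_mem' := ⟨fun _ => 0, by
        refine (IsIteratedIntegral.of_eq_zero_on_simplex (f := 0) (by simp)).congr_left hμ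
          MemLp.zero (Lp.coeFn_zero _ _ _)⟩
      smul_mem' := by
        rintro c F ⟨X, hX⟩
        exact ⟨_, (hX.const_mul c).congr_left hμ ((Lp.memLp F).const_mul c)
          (Lp.coeFn_smul c F)⟩ }
  have hK : K = ⊤ := by
    refine eq_top_of_boxFn_mem ?_ (fun s t j hst hts => ?_) fun F hF => ?_
    · refine IsSeqClosed.isClosed fun Fs F hFs hF => ?_
      choose Xs hXs using hFs
      have hb : Tendsto (fun m => eLpNorm (F - Fs m : (Fin n → Idx d) → ℝ) 2 (idxPow d n))
          atTop (𝓝 0) := by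
        rw [tendsto_iff_edist_tendsto_0] at hF
        refine hF.congr fun m => ?_
        rw [edist_comm, Lp.edist_def]
      have hm : ∀ F : Lp ℝ 2 (idxPow d n), AEStronglyMeasurable F (idxPow d n) :=
        fun F => Lp.aestronglyMeasurable F
      obtain ⟨X, hX, hlim⟩ := exists_tendsto_eLpNorm_sub
        (fun m => (hXs m).memLp hμ (Lp.memLp (Fs m))) hb fun m l => by
          refine (((hXs m).sub hμ (hXs l)).eLpNorm_le hμ ((hm _).sub (hm _))).trans ?_
          have e : (Fs m - Fs l : (Fin n → Idx d) → ℝ) = (F - Fs l) - (F - Fs m) := by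
            ext x; simp
          rw [e, add_comm]
          exact eLpNorm_sub_le ((hm _).sub (hm _)) ((hm _).sub (hm _)) (by norm_num)
      exact ⟨X, IsIteratedIntegral.of_tendsto hμ (hm _) (fun m => hm _) hX hXs hb hlim⟩
    · exact ⟨_, (isIteratedIntegral_boxFn hμ j hst hts).congr_left hμ (memLp_boxFn j hst)
        (memLp_boxFn j hst).coeFn_toLp⟩
    · have hm := (measurableSet_simplex (d := d) n).compl
      refine ⟨fun _ => 0, (IsIteratedIntegral.of_eq_zero_on_simplex
        (f := (simplex d n)ᶜ.indicator F) fun x hx => ?_).congr_left hμ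
          ((Lp.memLp F).indicator hm) ?_⟩
      · exact Set.indicator_of_notMem (by simpa using hx) _
      · filter_upwards [hF] with x hx
        by_cases h : x ∈ simplex d n
        · rw [hx h, Set.indicator_of_notMem (by simpa using h)]
        · rw [Set.indicator_of_mem (by simpa using h)]
  exact (hK ▸ Submodule.mem_top : F ∈ K)

/-- The iterated integral as a bounded operator. -/
noncomputable def iterInt (hμ : IsWienerMeasure μ) (n : ℕ) :
    Lp ℝ 2 (idxPow d n) →L[ℝ] Lp ℝ 2 μ :=
  LinearMap.mkContinuous
    { toFun F := ((IsIteratedIntegral.exists_of_lp hμ F).choose_spec.memLp hμ (Lp.memLp F)).toLp _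
      map_add' F G := by
        have hF := (IsIteratedIntegral.exists_of_lp hμ F).choose_spec
        have hG := (IsIteratedIntegral.exists_of_lp hμ G).choose_spec
        have hFG := (IsIteratedIntegral.exists_of_lp hμ (F + G)).choose_spec
        rw [← MemLp.toLp_add, MemLp.toLp_eq_toLp_iff]
        exact hFG.ae_unique hμ (Lp.memLp _) (hF.add hμ hG) (Lp.coeFn_add F G).symm
      map_smul' c F := by
        have hF := (IsIteratedIntegral.exists_of_lp hμ F).choose_spec
        have hcF := (IsIteratedIntegral.exists_of_lp hμ (c • F)).choose_spec
        rw [RingHom.id_apply, ← MemLp.toLp_const_smul, MemLp.toLp_eq_toLp_iff]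
        exact hcF.ae_unique hμ (Lp.memLp _) (hF.const_mul c) (Lp.coeFn_smul c F).symm } 1
    fun F => by
      have hF := (IsIteratedIntegral.exists_of_lp hμ F).choose_spec
      rw [one_mul, Lp.norm_def F]
      refine (Lp.norm_toLp _ (hF.memLp hμ (Lp.memLp F))).trans_le ?_
      exact ENNReal.toReal_mono (Lp.memLp F).2.ne (hF.eLpNorm_le hμ (Lp.aestronglyMeasurable F))

lemma isIteratedIntegral_iterInt (hμ : IsWienerMeasure μ) {n : ℕ} (F : Lp ℝ 2 (idxPow d n)) :
    IsIteratedIntegral μ n F (iterInt hμ n F) := by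
  have hF := (IsIteratedIntegral.exists_of_lp hμ F).choose_spec
  exact hF.congr_right hμ (Lp.memLp F) (hF.memLp hμ (Lp.memLp F)).coeFn_toLp

/-- This exchanges the relation for the bounded operator `iterInt`. -/
lemma isIteratedIntegral_iff (hμ : IsWienerMeasure μ) {n : ℕ} {f : (Fin n → Idx d) → ℝ}
    (hf : MemLp f 2 (idxPow d n)) {X : Space d → ℝ} :
    IsIteratedIntegral μ n f X ↔ X =ᵐ[μ] iterInt hμ n (hf.toLp f) := by
  have h := isIteratedIntegral_iterInt hμ (hf.toLp f)
  constructor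
  · intro hX
    exact hX.ae_unique hμ hf h hf.coeFn_toLp
  · intro hX
    exact (h.congr_left hμ (Lp.memLp _) hf.coeFn_toLp.symm).congr_right hμ hf hX

lemma iterInt_eq_zero (hμ : IsWienerMeasure μ) {n : ℕ} {F : Lp ℝ 2 (idxPow d n)}
    (hF : ∀ᵐ x ∂(idxPow d n), x ∈ simplex d n → F x = 0) : iterInt hμ n F = 0 := by
  have h := (isIteratedIntegral_iterInt hμ F).lintegral_enorm_sq_le hμ (Lp.aestronglyMeasurable F)
  have h0 : (simplex d n).indicator F =ᵐ[idxPow d n] 0 := by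
    filter_upwards [hF] with x hx
    by_cases h : x ∈ simplex d n
    · simp [hx h]
    · simp [h]
  rw [← eLpNorm_two_sq, ← eLpNorm_two_sq, eLpNorm_congr_ae h0, eLpNorm_zero, zero_pow two_ne_zero,
    nonpos_iff_eq_zero, pow_eq_zero_iff two_ne_zero,
    eLpNorm_eq_zero_iff (Lp.aestronglyMeasurable _) (by norm_num)] at h
  exact (Lp.eq_zero_iff_ae_eq_zero).2 h

/-! ### Hermite polynomials of Gaussian variables -/

lemma HasFiniteMoments.herm₂ {Ω : Type*} {m : MeasurableSpace Ω} {ν : Measure Ω}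
    [IsFiniteMeasure ν] {X Y : Ω → ℝ} (hX : HasFiniteMoments X ν) (hY : HasFiniteMoments Y ν)
    (α β γ : ℝ) (a b : ℕ) : HasFiniteMoments (fun w => herm₂ α β γ (X w) (Y w) a b) ν := by
  have hs : ∀ {Z : Ω → ℕ → ℝ}, (∀ b, HasFiniteMoments (fun w => Z w b) ν) →
      ∀ b, HasFiniteMoments (fun w => shiftRight (Z w) b) ν := by
    intro Z hZ b
    cases b with
    | zero => exact HasFiniteMoments.const 0
    | succ b => exact hZ b
  induction a using Nat.strong_induction_on generalizing b with
  | _ a ih =>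
  match a with
  | 0 => simpa only [herm₂_zero_left'] using hY.herm γ b
  | a + 1 =>
    have e : (fun w => Wiener.herm₂ α β γ (X w) (Y w) (a + 1) b) = fun w => ((a : ℝ) + 1)⁻¹ *
        (X w * Wiener.herm₂ α β γ (X w) (Y w) a b -
        α * shiftRight (fun a => Wiener.herm₂ α β γ (X w) (Y w) a b) a -
        β * shiftRight (Wiener.herm₂ α β γ (X w) (Y w) a) b) := by
      ext w
      rw [← herm₂_rec_left, inv_mul_cancel_left₀ (by positivity)]
    rw [e]
    refine HasFiniteMoments.const_mul (((hX.mul (ih a (by omega) b)).sub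
      (HasFiniteMoments.const_mul ?_ _)).sub (HasFiniteMoments.const_mul
        (hs (fun b => ih a (by omega) b) b) _)) _
    cases a with
    | zero => exact HasFiniteMoments.const 0
    | succ a => exact ih a (by omega) b

lemma sum_antidiagonal_eq_sum_range (f : ℕ → ℕ → ℝ) (n : ℕ) :
    ∑ k ∈ Finset.HasAntidiagonal.antidiagonal n, f k.1 k.2 =
      ∑ k ∈ Finset.range (n + 1), f (n - k) k := by
  rw [← Finset.Nat.sum_antidiagonal_swap]
  exact Finset.Nat.sum_antidiagonal_eq_sum_range_succ (fun i j => f j i) n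

lemma IsWienerMeasure.integral_wien_sq (hμ : IsWienerMeasure μ) (c : Idx d →₀ ℝ) :
    ∫ w, wien c w ^ 2 ∂μ = ∫ x, step c x * step c x ∂(idxMeasure d) := by
  rw [← hμ.integral_wien_mul_wien]
  simp only [pow_two]

lemma step_add_smul_mul_self (a b : Idx d →₀ ℝ) (t : ℝ) :
    ∫ x, step (a + t • b) x * step (a + t • b) x ∂(idxMeasure d) =
      ∫ x, step a x * step a x ∂(idxMeasure d) +
        2 * t * ∫ x, step a x * step b x ∂(idxMeasure d) +
        t ^ 2 * ∫ x, step b x * step b x ∂(idxMeasure d) := by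
  have I := fun a b : Idx d →₀ ℝ => integrable_step_mul_step a b
  have I2 : Integrable (fun x => step a x * step a x + 2 * t * (step a x * step b x))
      (idxMeasure d) := (I a a).add ((I a b).const_mul _)
  rw [← integral_const_mul, ← integral_const_mul, ← integral_add (I a a)
    ((I a b).const_mul _), ← integral_add I2 ((I b b).const_mul _)]
  congr 1
  ext x
  simp only [map_add, map_smul, Pi.add_apply, Pi.smul_apply, smul_eq_mul]
  ring

/-- E[Hₙ₊₁(W(a + tb))] vanishes for all t. Its coefficient of t says that `herm₂` of degrees n, 1
has mean zero, which turns E[W(b) Hₙ(W(a))] into β E[Hₙ₋₁(W(a))], nonzero at most for n = 1. -/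
lemma IsWienerMeasure.integral_wien_mul_herm (hμ : IsWienerMeasure μ) (a b : Idx d →₀ ℝ) (n : ℕ) :
    ∫ w, wien b w * herm (∫ x, step a x * step a x ∂(idxMeasure d)) (wien a w) n ∂μ =
      if n = 1 then ∫ x, step a x * step b x ∂(idxMeasure d) else 0 := by
  have := hμ.isProbabilityMeasure
  have W := hμ.hasFiniteMoments_wien
  set α := ∫ x, step a x * step a x ∂(idxMeasure d) with hα
  set β := ∫ x, step a x * step b x ∂(idxMeasure d)
  set γ := ∫ x, step b x * step b x ∂(idxMeasure d)
  have h1 : ∫ w, herm₂ α β γ (wien a w) (wien b w) n 1 ∂μ = 0 := by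
    have h := coeff_eq_zero_of_forall_eq_zero (n := n + 1) (s := Set.univ) (k := 1)
      (c := fun k => ∫ w, herm₂ α β γ (wien a w) (wien b w) (n + 1 - k) k ∂μ) Set.infinite_univ
      (fun t _ => by
        have h := integral_herm_succ (hμ.hasGaussianLaw_wien (a + t • b)) (hμ.integral_wien _)
          (hμ.integral_wien_sq _) n
        rw [step_add_smul_mul_self] at h
        simp only [map_add, map_smul, Pi.add_apply, Pi.smul_apply, smul_eq_mul,
          herm_add_mul] at h
        rw [integral_finsetSum _ fun k _ => (((W a).herm₂ (W b) α β γ _ _).const_mul _).integrable]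
          at h
        simp only [integral_const_mul] at h
        rw [sum_antidiagonal_eq_sum_range fun i j =>
          t ^ j * ∫ w, herm₂ α β γ (wien a w) (wien b w) i j ∂μ] at h
        simpa only [mul_comm] using h) (by omega)
    simpa using h
  simp only [herm₂_one_right, herm₂_zero_right] at h1
  rw [integral_sub ((W b).mul ((W a).herm _ _)).integrable] at h1
  · rw [sub_eq_zero.1 h1]
    match n with
    | 0 => simp
    | 1 => simp
    | n + 2 =>
      simp only [shiftRight_succ, Nat.reduceEqDiff, if_false]
      rw [integral_const_mul, integral_herm_succ (hμ.hasGaussianLaw_wien a) (hμ.integral_wien _)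
        (hμ.integral_wien_sq _), mul_zero]
  · cases n with
    | zero => simp
    | succ n => exact (((W a).herm α n).const_mul β).integrable

end

section

variable {d : ℕ} {μ : Measure (Space d)}

/-! ### Multiple integrals of tensor powers -/

/-- Induction on n: cut c at the last left endpoint, expand Hₙ₊₁(W(a) + W(b)) by `herm_add`, and
separate past from future. Against the last increment only the term of degree one in W(b) survives.
-/
lemma IsWienerMeasure.integral_herm_mul_prod (hμ : IsWienerMeasure μ) {n : ℕ}
    {s t : Fin n → unitInterval} (j : Fin n → Fin d) (hst : ∀ k, s k ≤ t k)
    (hts : ∀ k l, k < l → t k ≤ s l) (c : Idx d →₀ ℝ) :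
    ∫ w, herm (∫ x, step c x * step c x ∂(idxMeasure d)) (wien c w) n *
        ∏ k, wien (incr (s k) (t k) (j k)) w ∂μ =
      ∏ k, ∫ x, step c x * step (incr (s k) (t k) (j k)) x ∂(idxMeasure d) := by
  have := hμ.isProbabilityMeasure
  have W := hμ.hasFiniteMoments_wien
  induction n generalizing c with
  | zero => simp
  | succ n ih =>
    set s₀ := s (Fin.last n)
    set a := cut s₀ c
    set b := c - cut s₀ c
    have hc : c = a + b := by simp [a, b]
    set Z : Space d → ℝ := wien (incr s₀ (t (Fin.last n)) (j (Fin.last n)))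
    set α := ∫ x, step a x * step a x ∂(idxMeasure d)
    set γ := ∫ x, step b x * step b x ∂(idxMeasure d)
    -- The two pieces live on disjoint time sets, so their variances add.
    have hβ : ∫ x, step a x * step b x ∂(idxMeasure d) = 0 := by
      rw [← integral_zero (α := Idx d) ℝ]
      congr 1
      ext x
      simp only [a, b, map_sub, Pi.sub_apply, step_cut]
      split_ifs <;> simp
    have hl : ∫ x, step c x * step c x ∂(idxMeasure d) = α + γ := by
      have h := step_add_smul_mul_self a b 1
      rw [one_smul, ← hc, hβ] at h
      linarith
    set P : Space d → ℝ := fun w => ∏ k : Fin n, wien (incr (s k.castSucc) (t k.castSucc)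
      (j k.castSucc)) w
    have hPm : HasFiniteMoments P μ := HasFiniteMoments.prod fun k _ => W _
    have hpast : ∀ k : ℕ, Measurable[past d s₀] fun w => herm α (wien a w) k * P w := by
      intro k
      refine ((continuous_herm α k).measurable.comp (measurable_past_wien_cut s₀ c)).mul ?_
      refine Finset.measurable_fun_prod _ fun k _ => ?_
      have h1 : s k.castSucc ≤ s₀ := (hst _).trans (hts _ _ (Fin.castSucc_lt_last k))
      have h2 : t k.castSucc ≤ s₀ := hts _ _ (Fin.castSucc_lt_last k)
      have e : wien (incr (s k.castSucc) (t k.castSucc) (j k.castSucc)) = fun w : Space d =>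
        coord (t k.castSucc) (j k.castSucc) w - coord (s k.castSucc) (j k.castSucc) w :=
        funext (wien_incr _ _ _)
      rw [e]
      exact (measurable_past_coord h2 _).sub (measurable_past_coord h1 _)
    have hfut : ∀ k : ℕ, Measurable[future d s₀] fun w => Z w * herm γ (wien b w) k := fun k =>
      (measurable_future_wien_incr (hst _) _).mul
        ((continuous_herm γ k).measurable.comp (measurable_future_wien_sub s₀ c))
    have hsum : ∀ w, herm (∫ x, step c x * step c x ∂(idxMeasure d)) (wien c w) (n + 1) *
        ∏ k, wien (incr (s k) (t k) (j k)) w = ∑ k ∈ Finset.HasAntidiagonal.antidiagonal (n + 1),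
          herm α (wien a w) k.1 * P w * (Z w * herm γ (wien b w) k.2) := by
      intro w
      have hw : wien c w = wien a w + wien b w := by
        rw [← Pi.add_apply, ← map_add, ← hc]
      rw [hl, hw, herm_add, Fin.prod_univ_castSucc, Finset.sum_mul]
      refine Finset.sum_congr rfl fun k _ => ?_
      simp only [P, Z, s₀]
      ring
    simp only [hsum]
    rw [integral_finsetSum]
    swap
    · exact fun k _ => ((((W a).herm α _).mul hPm).mul ((W _).mul ((W b).herm γ _))).integrable
    have hterm : ∀ k ∈ Finset.HasAntidiagonal.antidiagonal (n + 1),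
        ∫ w, herm α (wien a w) k.1 * P w * (Z w * herm γ (wien b w) k.2) ∂μ =
          if k = (n, 1) then (∏ k : Fin n, ∫ x, step c x * step (incr (s k.castSucc)
            (t k.castSucc) (j k.castSucc)) x ∂(idxMeasure d)) *
            ∫ x, step c x * step (incr (s (Fin.last n)) (t (Fin.last n)) (j (Fin.last n))) x
              ∂(idxMeasure d) else 0 := by
      rintro ⟨k, l⟩ hkl
      rw [Finset.HasAntidiagonal.mem_antidiagonal] at hkl
      rw [hμ.integral_past_mul_future (Measurable.stronglyMeasurable (mα := past d s₀)
        (hpast k)).aestronglyMeasurable (hfut l), hμ.integral_wien_mul_herm b]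
      by_cases h1 : l = 1
      · have hk : k = n := by simp at hkl; omega
        rw [if_pos h1, if_pos (by rw [h1, hk]), hk, integral_step_sub_cut_mul (hst _),
          ih (fun k => j k.castSucc) (fun k => hst _)
            (fun k l hkl => hts _ _ (by simpa using hkl)) a]
        congr 1
        -- The earlier intervals end before the cut, so there c and its cut agree.
        refine Finset.prod_congr rfl fun k _ => ?_
        congr 1
        ext x
        have h2 : t k.castSucc ≤ s₀ := hts _ _ (Fin.castSucc_lt_last k)
        rw [step_cut, step_incr (hst _)]
        split_ifs with h3 h4 h4
        · rfl
        · simp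
        · exact absurd (h4.2.1.trans h2) h3
        · simp
      · rw [if_neg h1, if_neg (by simp [h1]), mul_zero]
    rw [Finset.sum_congr rfl hterm, Finset.sum_ite_eq' _ _, if_pos (by
      simp [Finset.HasAntidiagonal.mem_antidiagonal]), Fin.prod_univ_castSucc]

/-- The tensor power of a step function. -/
noncomputable def tpow (c : Idx d →₀ ℝ) (n : ℕ) (x : Fin n → Idx d) : ℝ := ∏ k, step c (x k)

lemma measurable_tpow (c : Idx d →₀ ℝ) (n : ℕ) : Measurable (tpow c n) :=
  Finset.measurable_fun_prod _ fun k _ => (measurable_step _).comp (measurable_pi_apply k)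

lemma memLp_tpow (c : Idx d →₀ ℝ) (n : ℕ) : MemLp (tpow c n) 2 (idxPow d n) := by
  obtain ⟨C, hC⟩ := exists_abs_step_le c
  refine MemLp.of_bound (measurable_tpow c n).aestronglyMeasurable (C ^ n)
    (ae_of_all _ fun x => ?_)
  rw [tpow, Real.norm_eq_abs, Finset.abs_prod]
  refine (Finset.prod_le_prod (fun _ _ => abs_nonneg _) fun k _ => hC (x k)).trans_eq ?_
  simp

/-- The permutation of the variables preserves the product measure. -/
lemma measurePreserving_comp_equiv {ι κ : Type*} [Fintype ι] [Fintype κ] (e : ι ≃ κ) :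
    MeasurePreserving (fun x : κ → Idx d => x ∘ e) (Measure.pi fun _ => idxMeasure d)
      (Measure.pi fun _ => idxMeasure d) := by
  have h := measurePreserving_arrowCongr' (fun _ : κ => idxMeasure d) (fun _ : ι => idxMeasure d)
    e.symm (MeasurableEquiv.refl (Idx d)) (fun _ => MeasurePreserving.id _)
  exact h

lemma integral_comp_equiv {ι κ : Type*} [Fintype ι] [Fintype κ] (e : ι ≃ κ)
    (F : (ι → Idx d) → ℝ) : ∫ x : κ → Idx d, F (x ∘ e) ∂(Measure.pi fun _ => idxMeasure d) =
      ∫ x, F x ∂(Measure.pi fun _ => idxMeasure d) :=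
  (measurePreserving_comp_equiv e).integral_comp
    (MeasurableEquiv.arrowCongr' e.symm (MeasurableEquiv.refl (Idx d))).measurableEmbedding F

/-- Almost all points have distinct times. -/
lemma ae_injective (n : ℕ) :
    ∀ᵐ x ∂(idxPow d n), Function.Injective fun k => (x k).1 := by
  have h : ∀ i j : Fin n, i ≠ j → ∀ᵐ x ∂(idxPow d n), (x i).1 ≠ (x j).1 := by
    intro i j hij
    cases n with
    | zero => exact i.elim0
    | succ n =>
      obtain ⟨k, rfl⟩ := Fin.exists_succAbove_eq hij.symm
      have hp := measurePreserving_piFinSuccAbove (fun _ : Fin (n + 1) => idxMeasure d) i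
      have hS : MeasurableSet {z : Idx d × (Fin n → Idx d) | z.1.1 = (z.2 k).1} :=
        measurableSet_eq_fun measurable_fst.fst ((measurable_pi_apply k).comp measurable_snd).fst
      have h0 : (idxMeasure d).prod (Measure.pi fun _ : Fin n => idxMeasure d)
          {z : Idx d × (Fin n → Idx d) | z.1.1 = (z.2 k).1} = 0 := by
        rw [Measure.measure_prod_null hS]
        refine ae_of_all _ fun e => ?_
        have h0 : idxMeasure d {e' | e.1 = e'.1} = 0 := by
          have : {e' : Idx d | e.1 = e'.1} = {e.1} ×ˢ Set.univ := by ext; simp [eq_comm]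
          rw [this, idxMeasure, Measure.prod_prod]
          simp
        exact Measure.pi_eval_preimage_null (μ := fun _ : Fin n => idxMeasure d) (i := k) h0
      have h1 := hp.measure_preimage hS.nullMeasurableSet
      rw [h0] at h1
      refine measure_mono_null (fun x hx => ?_) h1
      have hx' : (x i).1 = (x (i.succAbove k)).1 := by simpa using hx
      exact hx'
  have h' := ae_all_iff.2 fun i : Fin n => ae_all_iff.2 fun j => ae_all_iff.2 fun hij => h i j hij
  filter_upwards [h'] with x hx i j hij
  by_contra hne
  exact hx i j hne hij

/-- Sorting the times provides one permutation that lands in the simplex; the lower bound is enough.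
-/
lemma one_le_sum_indicator_simplex {n : ℕ} {x : Fin n → Idx d}
    (hx : Function.Injective fun k => (x k).1) :
    1 ≤ ∑ σ : Equiv.Perm (Fin n), (simplex d n).indicator (fun _ => (1 : ℝ)) (x ∘ σ) := by
  have h : x ∘ Tuple.sort (fun k => (x k).1) ∈ simplex d n := fun i j hij =>
    ((Tuple.monotone_sort fun k => (x k).1).strictMono_of_injective
      (hx.comp (Equiv.injective _))) hij
  have h1 : (simplex d n).indicator (fun _ => (1 : ℝ)) (x ∘ Tuple.sort fun k => (x k).1) = 1 :=
    Set.indicator_of_mem h _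
  refine h1.symm.trans_le ?_
  exact Finset.single_le_sum (f := fun σ : Equiv.Perm (Fin n) =>
    (simplex d n).indicator (fun _ => (1 : ℝ)) (x ∘ σ))
    (fun σ _ => Set.indicator_nonneg (fun _ _ => zero_le_one) _) (Finset.mem_univ _)

lemma integral_tpow_sq (c : Idx d →₀ ℝ) (n : ℕ) :
    ∫ x, tpow c n x ^ 2 ∂(idxPow d n) = (∫ x, step c x * step c x ∂(idxMeasure d)) ^ n := by
  have h := integral_fintype_prod_eq_prod (𝕜 := ℝ) (ι := Fin n)
    (μ := fun _ => idxMeasure d) (fun _ x => step c x * step c x)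
  simp only [Finset.prod_const, Finset.card_univ, Fintype.card_fin] at h
  rw [← h]
  refine integral_congr_ae (ae_of_all _ fun x => ?_)
  simp only [tpow, pow_two, Finset.prod_mul_distrib]

/-- The n! permuted copies of the simplex cover almost every point, and the tensor power takes equal
integrals on them by symmetry. -/
lemma le_setIntegral_simplex_tpow_sq (c : Idx d →₀ ℝ) (n : ℕ) :
    (∫ x, step c x * step c x ∂(idxMeasure d)) ^ n / n.factorial ≤
      ∫ x, (simplex d n).indicator (fun x => tpow c n x ^ 2) x ∂(idxPow d n) := by
  have hm := measurableSet_simplex (d := d) n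
  have hI : Integrable (fun x => (simplex d n).indicator (fun x => tpow c n x ^ 2) x)
    (idxPow d n) := (memLp_tpow c n).integrable_sq.indicator hm
  have hσ : ∀ σ : Equiv.Perm (Fin n), MeasurePreserving (fun x : Fin n → Idx d => x ∘ σ)
      (idxPow d n) (idxPow d n) := fun σ => measurePreserving_comp_equiv σ
  have hIσ : ∀ σ : Equiv.Perm (Fin n), Integrable (fun x : Fin n → Idx d =>
      (simplex d n).indicator (fun x => tpow c n x ^ 2) (x ∘ σ)) (idxPow d n) :=
    fun σ => (hσ σ).integrable_comp_of_integrable hI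
  rw [div_le_iff₀ (by positivity), ← integral_tpow_sq, mul_comm]
  have h : ∑ σ : Equiv.Perm (Fin n), ∫ x, (simplex d n).indicator (fun x => tpow c n x ^ 2)
      (x ∘ σ) ∂(idxPow d n) = (n.factorial : ℝ) *
      ∫ x, (simplex d n).indicator (fun x => tpow c n x ^ 2) x ∂(idxPow d n) := by
    have hi : ∀ σ : Equiv.Perm (Fin n), ∫ x, (simplex d n).indicator (fun x => tpow c n x ^ 2)
        (x ∘ σ) ∂(idxPow d n) =
        ∫ x, (simplex d n).indicator (fun x => tpow c n x ^ 2) x ∂(idxPow d n) :=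
      fun σ => integral_comp_equiv σ _
    simp only [hi]
    simp [Fintype.card_perm]
  rw [← h, ← integral_finsetSum _ fun σ _ => hIσ σ]
  refine integral_mono_ae (memLp_tpow c n).integrable_sq
    (integrable_finsetSum _ fun σ _ => hIσ σ) ?_
  filter_upwards [ae_injective n] with x hx
  have h1 : ∀ σ : Equiv.Perm (Fin n), (simplex d n).indicator (fun x => tpow c n x ^ 2) (x ∘ σ) =
      (simplex d n).indicator (fun _ => (1 : ℝ)) (x ∘ σ) * tpow c n x ^ 2 := by
    intro σ
    have h2 : tpow c n (x ∘ σ) = tpow c n x := Equiv.prod_comp σ fun k => step c (x k)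
    by_cases h3 : x ∘ σ ∈ simplex d n
    · rw [Set.indicator_of_mem h3, Set.indicator_of_mem h3, h2, one_mul]
    · rw [Set.indicator_of_notMem h3, Set.indicator_of_notMem h3, zero_mul]
  simp only [h1]
  rw [← Finset.sum_mul]
  exact le_mul_of_one_le_left (sq_nonneg _) (one_le_sum_indicator_simplex hx)

lemma inner_toLp {α : Type*} {m : MeasurableSpace α} {ν : Measure α} {f g : α → ℝ}
    (hf : MemLp f 2 ν) (hg : MemLp g 2 ν) :
    inner ℝ (hf.toLp f) (hg.toLp g) = ∫ x, f x * g x ∂ν := by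
  rw [L2.inner_def]
  refine integral_congr_ae ?_
  filter_upwards [hf.coeFn_toLp, hg.coeFn_toLp] with x h1 h2
  simp [h1, h2, mul_comm]

lemma norm_sq_toLp {α : Type*} {m : MeasurableSpace α} {ν : Measure α} {f : α → ℝ}
    (hf : MemLp f 2 ν) : ‖hf.toLp f‖ ^ 2 = ∫ x, f x ^ 2 ∂ν := by
  rw [← real_inner_self_eq_norm_sq, inner_toLp]
  simp only [pow_two]

lemma boxFn_eq_zero_of_notMem_simplex {n : ℕ} {s t : Fin n → unitInterval} (j : Fin n → Fin d)
    (hst : ∀ k, s k ≤ t k) (hts : ∀ k l, k < l → t k ≤ s l) {x : Fin n → Idx d}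
    (hx : x ∉ simplex d n) : boxFn s t j x = 0 := by
  rw [boxFn_eq j hst]
  refine Set.indicator_of_notMem (fun h => hx fun k l hkl => ?_) _
  have h : ∀ k, s k < (x k).1 ∧ (x k).1 ≤ t k ∧ (x k).2 = j k := h
  exact (h k).2.1.trans_lt ((hts k l hkl).trans_lt (h l).1)

/-- The iterated integral of a tensor power is a Hermite polynomial. -/
lemma iterInt_tpow (hμ : IsWienerMeasure μ) (c : Idx d →₀ ℝ) (n : ℕ) :
    iterInt hμ n ((memLp_tpow c n).toLp _) =ᵐ[μ]
      fun w => herm (∫ x, step c x * step c x ∂(idxMeasure d)) (wien c w) n := by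
  have := hμ.isProbabilityMeasure
  have hm := measurableSet_simplex (d := d) n
  set l := ∫ x, step c x * step c x ∂(idxMeasure d) with hl
  have hH : MemLp (fun w => herm l (wien c w) n) 2 μ :=
    ((hμ.hasFiniteMoments_wien c).herm l n).memLp_two
  set G := hH.toLp _ with hG
  have hPm : MemLp ((simplex d n).indicator (tpow c n)) 2 (idxPow d n) :=
    (memLp_tpow c n).indicator hm
  set P := hPm.toLp _ with hP
  -- Both sides are continuous linear in F, so ordered boxes and kernels null on the simplex decide;
  -- on boxes this is `integral_herm_mul_prod` and Fubini.
  have hinner : ∀ F : Lp ℝ 2 (idxPow d n), inner ℝ G (iterInt hμ n F) = inner ℝ P F := by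
    let L : Lp ℝ 2 (idxPow d n) →L[ℝ] ℝ :=
      (innerSL ℝ G).comp (iterInt hμ n) - innerSL ℝ P
    have hK : LinearMap.ker L.toLinearMap = ⊤ := by
      refine eq_top_of_boxFn_mem L.isClosed_ker (fun s t j hst hts => ?_) fun F hF => ?_
      · have e : iterInt hμ n ((memLp_boxFn j hst).toLp _) =ᵐ[μ]
            fun w => ∏ k, wien (incr (s k) (t k) (j k)) w :=
          ((isIteratedIntegral_iff hμ (memLp_boxFn j hst)).1
            (isIteratedIntegral_boxFn hμ j hst hts)).symm
        have hX : MemLp (fun w => ∏ k, wien (incr (s k) (t k) (j k)) w) 2 μ :=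
          (HasFiniteMoments.prod fun k _ => hμ.hasFiniteMoments_wien _).memLp_two
        have e2 : iterInt hμ n ((memLp_boxFn j hst).toLp _) = hX.toLp _ :=
          Lp.ext (e.trans hX.coeFn_toLp.symm)
        change inner ℝ G (iterInt hμ n _) - inner ℝ P _ = 0
        rw [e2, hG, hP, inner_toLp, inner_toLp, sub_eq_zero,
          hμ.integral_herm_mul_prod j hst hts]
        have h := integral_fintype_prod_eq_prod (𝕜 := ℝ) (ι := Fin n)
          (μ := fun _ => idxMeasure d) (fun k x => step c x * step (incr (s k) (t k) (j k)) x)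
        rw [← h]
        refine integral_congr_ae (ae_of_all _ fun x => ?_)
        by_cases hx : x ∈ simplex d n
        · simp only [Set.indicator_of_mem hx, tpow, boxFn, Finset.prod_mul_distrib]
        · have h0 := boxFn_eq_zero_of_notMem_simplex j hst hts hx
          simp only [Finset.prod_mul_distrib, Set.indicator_of_notMem hx, zero_mul]
          rw [boxFn] at h0
          rw [h0, mul_zero]
      · change inner ℝ G (iterInt hμ n _) - inner ℝ P _ = 0
        rw [iterInt_eq_zero hμ hF, inner_zero_right, zero_sub, neg_eq_zero, L2.inner_def,
          ← integral_zero (α := Fin n → Idx d) ℝ]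
        refine integral_congr_ae ?_
        filter_upwards [hF, hPm.coeFn_toLp] with x h1 h2
        by_cases hx : x ∈ simplex d n
        · simp [h1 hx]
        · simp [hP, h2, hx]
    intro F
    have hF : F ∈ LinearMap.ker L.toLinearMap := hK ▸ Submodule.mem_top
    exact sub_eq_zero.1 hF
  set T := (memLp_tpow c n).toLp (tpow c n) with hT
  set b := ∫ x, (simplex d n).indicator (fun x => tpow c n x ^ 2) x ∂(idxPow d n)
  have h1 : ‖G‖ ^ 2 = l ^ n / n.factorial := by
    rw [hG, norm_sq_toLp]
    exact integral_herm_sq (hμ.hasGaussianLaw_wien c) (hμ.integral_wien c)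
      (hμ.integral_wien_sq c) n
  have h2 : inner ℝ P T = b := by
    rw [hP, hT, inner_toLp]
    refine integral_congr_ae (ae_of_all _ fun x => ?_)
    by_cases hx : x ∈ simplex d n
    · simp only [Set.indicator_of_mem hx, pow_two]
    · simp only [Set.indicator_of_notMem hx, zero_mul]
  have h3 : ‖iterInt hμ n T‖ ^ 2 ≤ b := by
    have hT' := isIteratedIntegral_iterInt hμ T
    have h := (hT'.congr_left hμ (Lp.memLp T)
      (memLp_tpow c n).coeFn_toLp.symm).lintegral_enorm_sq_le hμ (memLp_tpow c n).1
    rw [lintegral_enorm_sq_eq (Lp.memLp _), lintegral_enorm_sq_eq hPm, ENNReal.ofReal_le_ofReal_iff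
      (integral_nonneg fun _ => sq_nonneg _), ← norm_sq_toLp (Lp.memLp _), Lp.toLp_coeFn] at h
    refine h.trans_eq (integral_congr_ae (ae_of_all _ fun x => ?_))
    by_cases hx : x ∈ simplex d n
    · simp only [Set.indicator_of_mem hx]
    · simp [Set.indicator_of_notMem hx]
  -- With l the squared norm of c, ‖G - I(T)‖² ≤ lⁿ/n! - 2b + b, and b ≥ lⁿ/n!; hence the distance
  -- is zero.
  have h4 := norm_sub_sq_real G (iterInt hμ n T)
  rw [hinner, h1, h2] at h4
  have h5 := le_setIntegral_simplex_tpow_sq c n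
  have h6 : ‖G - iterInt hμ n T‖ ^ 2 = 0 := le_antisymm (by linarith) (sq_nonneg _)
  rw [sq_eq_zero_iff, norm_eq_zero, sub_eq_zero] at h6
  rw [← h6]
  exact hH.coeFn_toLp

end

section

variable {d : ℕ} {μ : Measure (Space d)}

/-! ### Contractions -/

/-! ### Partial integration of the product of two kernels. -/

section Pairing

variable {α β υ : Type*} {mα : MeasurableSpace α} {mβ : MeasurableSpace β}
  {mυ : MeasurableSpace υ} {ν : Measure α} {ρ : Measure β} {τ : Measure υ}
  [IsFiniteMeasure ν] [IsFiniteMeasure ρ] [IsFiniteMeasure τ]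
  {f f' : α × υ → ℝ} {g g' : β × υ → ℝ}

/-- The kernel `(y, z) ↦ ∫ f(y, u) g(z, u) dτ(u)`. -/
noncomputable def pairing (τ : Measure υ) (f : α × υ → ℝ) (g : β × υ → ℝ) (z : α × β) : ℝ :=
  ∫ u, f (z.1, u) * g (z.2, u) ∂τ

lemma measurePreserving_rotate_right :
    MeasurePreserving (fun z : (α × β) × υ => ((z.1.2, z.2), z.1.1)) ((ν.prod ρ).prod τ)
      ((ρ.prod τ).prod ν) :=
  Measure.measurePreserving_swap.comp (measurePreserving_prodAssoc ν ρ τ)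

lemma measurePreserving_rotate_left :
    MeasurePreserving (fun z : (α × β) × υ => ((z.1.1, z.2), z.1.2)) ((ν.prod ρ).prod τ)
      ((ν.prod τ).prod ρ) :=
  measurePreserving_rotate_right.comp
    (Measure.measurePreserving_swap.prod (MeasurePreserving.id τ))

/-- Each factor is extended by the constant 1 in the missing variable, staying in L² because the
measures are finite. Thus the inner integrals exist almost everywhere, as additivity of `pairing`
requires. -/
lemma integrable_mul_of_memLp (hf : MemLp f 2 (ν.prod τ)) (hg : MemLp g 2 (ρ.prod τ)) :
    Integrable (fun z : (α × β) × υ => f (z.1.1, z.2) * g (z.1.2, z.2)) ((ν.prod ρ).prod τ) := by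
  have h1 := (memLp_two_prod_mul hf (memLp_const (μ := ρ) 1)).comp_measurePreserving
    (measurePreserving_rotate_left (ν := ν) (ρ := ρ) (τ := τ))
  have h2 := (memLp_two_prod_mul hg (memLp_const (μ := ν) 1)).comp_measurePreserving
    (measurePreserving_rotate_right (ν := ν) (ρ := ρ) (τ := τ))
  have h := h1.integrable_mul h2
  refine h.congr (ae_of_all _ fun z => ?_)
  simp

omit [IsFiniteMeasure ν] in
-- Cauchy-Schwarz in u for almost every (y, z); the squared bound is a function of y times a
-- function of z, and integrates separately.
lemma eLpNorm_pairing_le (hf : MemLp f 2 (ν.prod τ)) (hg : MemLp g 2 (ρ.prod τ)) :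
    eLpNorm (pairing τ f g) 2 (ν.prod ρ) ≤ eLpNorm f 2 (ν.prod τ) * eLpNorm g 2 (ρ.prod τ) := by
  simp only [eLpNorm_two_eq]
  rw [← ENNReal.mul_rpow_of_nonneg _ _ (by norm_num)]
  refine ENNReal.rpow_le_rpow ?_ (by norm_num)
  have hf' := hf.1.enorm.pow_const 2
  have hg' := hg.1.enorm.pow_const 2
  rw [lintegral_prod _ hf', lintegral_prod _ hg', ← lintegral_prod_mul hf'.lintegral_prod_right'
    hg'.lintegral_prod_right']
  refine lintegral_mono_ae ?_
  filter_upwards [Measure.quasiMeasurePreserving_fst.ae hf.1.prodMk_left,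
    Measure.quasiMeasurePreserving_snd.ae hg.1.prodMk_left] with z h1 h2
  have h := ENNReal.lintegral_mul_le_Lp_mul_Lq τ Real.HolderConjugate.two_two h1.enorm h2.enorm
  have h3 : ‖pairing τ f g z‖ₑ ≤ ∫⁻ u, ‖f (z.1, u)‖ₑ * ‖g (z.2, u)‖ₑ ∂τ := by
    refine (enorm_integral_le_lintegral_enorm _).trans_eq ?_
    simp only [enorm_mul]
  refine (pow_le_pow_left' (h3.trans h) 2).trans_eq ?_
  rw [← ENNReal.mul_rpow_of_nonneg _ _ (by norm_num), ← ENNReal.rpow_natCast, ← ENNReal.rpow_mul]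
  simp

lemma memLp_pairing (hf : MemLp f 2 (ν.prod τ)) (hg : MemLp g 2 (ρ.prod τ)) :
    MemLp (pairing τ f g) 2 (ν.prod ρ) :=
  ⟨(integrable_mul_of_memLp hf hg).1.integral_prod_right',
    (eLpNorm_pairing_le hf hg).trans_lt (ENNReal.mul_lt_top hf.2 hg.2)⟩

omit [IsFiniteMeasure ν] [IsFiniteMeasure ρ] in
lemma pairing_congr (hf : f =ᵐ[ν.prod τ] f') (hg : g =ᵐ[ρ.prod τ] g') :
    pairing τ f g =ᵐ[ν.prod ρ] pairing τ f' g' := by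
  filter_upwards [Measure.quasiMeasurePreserving_fst.ae (Measure.ae_ae_of_ae_prod hf),
    Measure.quasiMeasurePreserving_snd.ae (Measure.ae_ae_of_ae_prod hg)] with z h1 h2
  refine integral_congr_ae ?_
  filter_upwards [h1, h2] with u h1 h2
  rw [h1, h2]

lemma pairing_add_left (hf : MemLp f 2 (ν.prod τ)) (hf' : MemLp f' 2 (ν.prod τ))
    (hg : MemLp g 2 (ρ.prod τ)) :
    pairing τ (f + f') g =ᵐ[ν.prod ρ] pairing τ f g + pairing τ f' g := by
  filter_upwards [(integrable_mul_of_memLp hf hg).prod_right_ae,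
    (integrable_mul_of_memLp hf' hg).prod_right_ae] with z h1 h2
  simp only [pairing, Pi.add_apply, add_mul]
  exact integral_add h1 h2

lemma pairing_add_right (hf : MemLp f 2 (ν.prod τ)) (hg : MemLp g 2 (ρ.prod τ))
    (hg' : MemLp g' 2 (ρ.prod τ)) :
    pairing τ f (g + g') =ᵐ[ν.prod ρ] pairing τ f g + pairing τ f g' := by
  filter_upwards [(integrable_mul_of_memLp hf hg).prod_right_ae,
    (integrable_mul_of_memLp hf hg').prod_right_ae] with z h1 h2
  simp only [pairing, Pi.add_apply, mul_add]
  exact integral_add h1 h2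

omit [IsFiniteMeasure τ] in
lemma pairing_smul_left (c : ℝ) (f : α × υ → ℝ) (g : β × υ → ℝ) :
    pairing τ (c • f) g = c • pairing τ f g := by
  ext z
  simp only [pairing, Pi.smul_apply, smul_eq_mul, mul_assoc, integral_const_mul]

omit [IsFiniteMeasure τ] in
lemma pairing_smul_right (c : ℝ) (f : α × υ → ℝ) (g : β × υ → ℝ) :
    pairing τ f (c • g) = c • pairing τ f g := by
  ext z
  simp only [pairing, Pi.smul_apply, smul_eq_mul, mul_left_comm _ c, integral_const_mul]

end Pairing

/-- The first `a` and the last `b` coordinates. -/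
def splitMap {a b n : ℕ} (h : a + b = n) (x : Fin n → Idx d) :
    (Fin a → Idx d) × (Fin b → Idx d) :=
  ((fun k : Fin a => x ⟨k, by omega⟩), fun k : Fin b => x ⟨a + k, by omega⟩)

/-- The concatenation of two vectors. -/
def joinMap {a b n : ℕ} (h : n = a + b) (z : (Fin a → Idx d) × (Fin b → Idx d)) : Fin n → Idx d :=
  Fin.append z.1 z.2 ∘ Fin.cast h

lemma measurePreserving_splitMap {a b n : ℕ} (h : a + b = n) :
    MeasurePreserving (splitMap (d := d) h) (idxPow d n) ((idxPow d a).prod (idxPow d b)) := by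
  subst h
  exact (measurePreserving_sumPiEquivProdPi fun _ : Fin a ⊕ Fin b => idxMeasure d).comp
    (measurePreserving_comp_equiv finSumFinEquiv)

lemma measurePreserving_joinMap {a b n : ℕ} (h : n = a + b) :
    MeasurePreserving (joinMap (d := d) h) ((idxPow d a).prod (idxPow d b)) (idxPow d n) := by
  subst h
  have h := (measurePreserving_comp_equiv (d := d) finSumFinEquiv.symm).comp
    (measurePreserving_sumPiEquivProdPi_symm fun _ : Fin a ⊕ Fin b => idxMeasure d)
  have e : joinMap (d := d) (rfl : a + b = a + b) = (fun x => x ∘ finSumFinEquiv.symm) ∘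
      (MeasurableEquiv.sumPiEquivProdPi fun _ : Fin a ⊕ Fin b => Idx d).symm := by
    ext1 z
    refine funext fun k => ?_
    refine Fin.addCases (fun k => ?_) (fun k => ?_) k
    · simp only [joinMap, Function.comp_apply, Fin.cast_eq_self, Fin.append_left,
        finSumFinEquiv_symm_apply_castAdd]
      rfl
    · simp only [joinMap, Function.comp_apply, Fin.cast_eq_self, Fin.append_right,
        finSumFinEquiv_symm_apply_natAdd]
      rfl
  rw [e]
  exact h

/-! ### Contraction as a bounded bilinear operator on kernels. -/

section Contraction

variable {p q : ℕ} (i : Fin (min p q + 1)) {f f' : (Fin p → Idx d) → ℝ}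
  {g g' : (Fin q → Idx d) → ℝ}

/-- Definitional; it transports the estimates for `pairing` through measure preserving changes of
coordinates. -/
lemma contraction_eq (f : (Fin p → Idx d) → ℝ) (g : (Fin q → Idx d) → ℝ) :
    contraction i f g = pairing (idxPow d i)
      (f ∘ joinMap (by omega : p = (p - i) + i)) (g ∘ joinMap (by omega : q = (q - i) + i)) ∘
      splitMap (by omega : (p - i) + (q - i) = p + q - 2 * i) :=
  rfl

lemma memLp_contraction (hf : MemLp f 2 (idxPow d p)) (hg : MemLp g 2 (idxPow d q)) :
    MemLp (contraction i f g) 2 (idxPow d (p + q - 2 * i)) := by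
  rw [contraction_eq]
  exact (memLp_pairing (hf.comp_measurePreserving (measurePreserving_joinMap _))
    (hg.comp_measurePreserving (measurePreserving_joinMap _))).comp_measurePreserving
    (measurePreserving_splitMap _)

lemma eLpNorm_contraction_le (hf : MemLp f 2 (idxPow d p)) (hg : MemLp g 2 (idxPow d q)) :
    eLpNorm (contraction i f g) 2 (idxPow d (p + q - 2 * i)) ≤
      eLpNorm f 2 (idxPow d p) * eLpNorm g 2 (idxPow d q) := by
  have hp := measurePreserving_joinMap (d := d) (by omega : p = (p - i) + i)
  have hq := measurePreserving_joinMap (d := d) (by omega : q = (q - i) + i)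
  have h := eLpNorm_pairing_le (hf.comp_measurePreserving hp) (hg.comp_measurePreserving hq)
  rw [eLpNorm_comp_measurePreserving hf.1 hp, eLpNorm_comp_measurePreserving hg.1 hq] at h
  rw [contraction_eq, eLpNorm_comp_measurePreserving (memLp_pairing
    (hf.comp_measurePreserving hp) (hg.comp_measurePreserving hq)).1
    (measurePreserving_splitMap _)]
  exact h

lemma contraction_congr (hf : f =ᵐ[idxPow d p] f') (hg : g =ᵐ[idxPow d q] g') :
    contraction i f g =ᵐ[idxPow d (p + q - 2 * i)] contraction i f' g' := by
  rw [contraction_eq, contraction_eq]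
  exact (measurePreserving_splitMap _).quasiMeasurePreserving.ae_eq_comp (pairing_congr
    ((measurePreserving_joinMap _).quasiMeasurePreserving.ae_eq_comp hf)
    ((measurePreserving_joinMap _).quasiMeasurePreserving.ae_eq_comp hg))

lemma contraction_add_left (hf : MemLp f 2 (idxPow d p)) (hf' : MemLp f' 2 (idxPow d p))
    (hg : MemLp g 2 (idxPow d q)) : contraction i (f + f') g =ᵐ[idxPow d (p + q - 2 * i)]
      contraction i f g + contraction i f' g := by
  simp only [contraction_eq]
  exact (measurePreserving_splitMap _).quasiMeasurePreserving.ae_eq_comp (pairing_add_left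
    (hf.comp_measurePreserving (measurePreserving_joinMap _))
    (hf'.comp_measurePreserving (measurePreserving_joinMap _))
    (hg.comp_measurePreserving (measurePreserving_joinMap _)))

lemma contraction_add_right (hf : MemLp f 2 (idxPow d p)) (hg : MemLp g 2 (idxPow d q))
    (hg' : MemLp g' 2 (idxPow d q)) : contraction i f (g + g') =ᵐ[idxPow d (p + q - 2 * i)]
      contraction i f g + contraction i f g' := by
  simp only [contraction_eq]
  exact (measurePreserving_splitMap _).quasiMeasurePreserving.ae_eq_comp (pairing_add_right
    (hf.comp_measurePreserving (measurePreserving_joinMap _))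
    (hg.comp_measurePreserving (measurePreserving_joinMap _))
    (hg'.comp_measurePreserving (measurePreserving_joinMap _)))

lemma contraction_smul_left (c : ℝ) : contraction i (c • f) g = c • contraction i f g := by
  simp only [contraction_eq, Pi.smul_comp, pairing_smul_left]

lemma contraction_smul_right (c : ℝ) : contraction i f (c • g) = c • contraction i f g := by
  simp only [contraction_eq, Pi.smul_comp, pairing_smul_right]

/-- The contraction as a bounded bilinear map. -/
noncomputable def contrL : Lp ℝ 2 (idxPow d p) →L[ℝ] Lp ℝ 2 (idxPow d q) →L[ℝ]
    Lp ℝ 2 (idxPow d (p + q - 2 * i)) :=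
  LinearMap.mkContinuous₂ (LinearMap.mk₂ ℝ
    (fun F G => (memLp_contraction i (Lp.memLp F) (Lp.memLp G)).toLp _)
    (fun F F' G => by
      rw [← MemLp.toLp_add, MemLp.toLp_eq_toLp_iff]
      exact (contraction_congr i (Lp.coeFn_add F F') EventuallyEq.rfl).trans
        (contraction_add_left i (Lp.memLp F) (Lp.memLp F') (Lp.memLp G)))
    (fun c F G => by
      rw [← MemLp.toLp_const_smul, MemLp.toLp_eq_toLp_iff, ← contraction_smul_left]
      exact contraction_congr i (Lp.coeFn_smul c F) EventuallyEq.rfl)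
    (fun F G G' => by
      rw [← MemLp.toLp_add, MemLp.toLp_eq_toLp_iff]
      exact (contraction_congr i EventuallyEq.rfl (Lp.coeFn_add G G')).trans
        (contraction_add_right i (Lp.memLp F) (Lp.memLp G) (Lp.memLp G')))
    (fun c F G => by
      rw [← MemLp.toLp_const_smul, MemLp.toLp_eq_toLp_iff, ← contraction_smul_right]
      exact contraction_congr i EventuallyEq.rfl (Lp.coeFn_smul c G))) 1
    fun F G => by
      rw [one_mul, Lp.norm_def F, Lp.norm_def G, ← ENNReal.toReal_mul]
      refine (Lp.norm_toLp _ (memLp_contraction i (Lp.memLp F) (Lp.memLp G))).trans_le ?_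
      exact ENNReal.toReal_mono (ENNReal.mul_lt_top (Lp.memLp F).2 (Lp.memLp G).2).ne
        (eLpNorm_contraction_le i (Lp.memLp F) (Lp.memLp G))

lemma contrL_toLp (hf : MemLp f 2 (idxPow d p)) (hg : MemLp g 2 (idxPow d q)) :
    contrL i (hf.toLp f) (hg.toLp g) = (memLp_contraction i hf hg).toLp _ := by
  have h : contrL i (hf.toLp f) (hg.toLp g) =
    (memLp_contraction i (Lp.memLp (hf.toLp f)) (Lp.memLp (hg.toLp g))).toLp _ := rfl
  rw [h, MemLp.toLp_eq_toLp_iff]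
  exact contraction_congr i hf.coeFn_toLp hg.coeFn_toLp

end Contraction

/-! ### Symmetrization -/

section Symmetrization

variable {n : ℕ} {f : (Fin n → Idx d) → ℝ}

lemma measurePreserving_perm (σ : Equiv.Perm (Fin n)) :
    MeasurePreserving (fun x : Fin n → Idx d => x ∘ σ) (idxPow d n) (idxPow d n) :=
  measurePreserving_comp_equiv σ

lemma memLp_symmetrization (hf : MemLp f 2 (idxPow d n)) :
    MemLp (symmetrization f) 2 (idxPow d n) :=
  (memLp_finsetSum _ fun σ _ =>
    hf.comp_measurePreserving (measurePreserving_perm σ)).const_mul _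

lemma symmetrization_comp (f : (Fin n → Idx d) → ℝ) (x : Fin n → Idx d)
    (σ : Equiv.Perm (Fin n)) : symmetrization f (x ∘ σ) = symmetrization f x := by
  unfold symmetrization
  congr 1
  exact Fintype.sum_equiv (Equiv.mulLeft σ) _ _ fun τ => rfl

lemma isSymmKernel_symmetrization (hf : MemLp f 2 (idxPow d n)) :
    IsSymmKernel (symmetrization f) :=
  ⟨memLp_symmetrization hf, fun σ => ae_of_all _ fun x => symmetrization_comp f x σ⟩

/-- The symmetrization as a bounded operator. -/
noncomputable def symL (d n : ℕ) : Lp ℝ 2 (idxPow d n) →L[ℝ] Lp ℝ 2 (idxPow d n) :=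
  (n.factorial : ℝ)⁻¹ • ∑ σ : Equiv.Perm (Fin n),
    (Lp.compMeasurePreservingₗᵢ ℝ _ (measurePreserving_perm σ)).toContinuousLinearMap

lemma symL_toLp (hf : MemLp f 2 (idxPow d n)) :
    symL d n (hf.toLp f) = (memLp_symmetrization hf).toLp _ := by
  have h : symL d n (hf.toLp f) = (n.factorial : ℝ)⁻¹ • ∑ σ : Equiv.Perm (Fin n),
      (hf.comp_measurePreserving (measurePreserving_perm σ)).toLp _ := by
    simp only [symL, _root_.smul_apply, _root_.sum_apply]
    rfl
  rw [h]
  refine Lp.ext ?_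
  have h1 : ∀ᵐ x ∂(idxPow d n), ∀ σ : Equiv.Perm (Fin n),
      (hf.comp_measurePreserving (measurePreserving_perm σ)).toLp _ x = f (x ∘ σ) :=
    ae_all_iff.2 fun σ => (hf.comp_measurePreserving (measurePreserving_perm σ)).coeFn_toLp
  filter_upwards [Lp.coeFn_smul (n.factorial : ℝ)⁻¹ (∑ σ : Equiv.Perm (Fin n),
      (hf.comp_measurePreserving (measurePreserving_perm σ)).toLp _),
    Lp.coeFn_finsetSum Finset.univ fun σ : Equiv.Perm (Fin n) =>
      (hf.comp_measurePreserving (measurePreserving_perm σ)).toLp _, h1,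
    (memLp_symmetrization hf).coeFn_toLp] with x h2 h3 h4 h5
  rw [h2, h5, Pi.smul_apply, h3]
  simp only [Finset.sum_apply, h4, smul_eq_mul, symmetrization]

end Symmetrization

end

section

variable {d : ℕ} {μ : Measure (Space d)}

/-! ### Polarization -/

/-- Ryser's formula. -/
lemma sum_perm_prod_eq {n : ℕ} (a : Fin n → Fin n → ℝ) :
    ∑ σ : Equiv.Perm (Fin n), ∏ j, a (σ j) j =
      ∑ t : Finset (Fin n), (-1) ^ t.card * ∏ j, ∑ i ∈ tᶜ, a i j := by
  classical
  -- Inclusion-exclusion over the values a map Fin n → Fin n misses: maps missing none are the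
  -- permutations, and those missing all of t have values in its complement.
  have h := Finset.inclusion_exclusion_sum_inf_compl (Finset.univ : Finset (Fin n))
    (fun i => Fintype.piFinset fun _ : Fin n => ({i}ᶜ : Finset (Fin n)))
    (fun φ => ∏ j, a (φ j) j)
  have h1 : ∀ t : Finset (Fin n), t.inf (fun i => Fintype.piFinset fun _ : Fin n =>
      ({i}ᶜ : Finset (Fin n))) = Fintype.piFinset fun _ => tᶜ := by
    intro t
    ext φ
    simp only [Finset.mem_inf, Fintype.mem_piFinset, Finset.mem_compl, Finset.mem_singleton]
    exact ⟨fun h j hj => h _ hj j rfl, fun h i hi j hij => h j (hij ▸ hi)⟩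
  simp only [h1, Finset.powerset_univ] at h
  simp only [zsmul_eq_mul, Int.cast_pow, Int.cast_neg, Int.cast_one] at h
  simp only [Finset.prod_univ_sum]
  rw [← h]
  refine Finset.sum_bij (fun σ _ => ⇑σ) (fun σ _ => ?_) (fun σ _ τ _ h => DFunLike.coe_injective h)
    (fun φ hφ => ?_) fun _ _ => rfl
  · simp only [Finset.mem_inf, Finset.mem_compl, Fintype.mem_piFinset, Finset.mem_singleton,
      not_forall, not_not]
    exact fun i _ => σ.surjective i
  · simp only [Finset.mem_inf, Finset.mem_compl, Fintype.mem_piFinset, Finset.mem_singleton,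
      not_forall, not_not] at hφ
    exact ⟨Equiv.ofBijective φ (Finite.surjective_iff_bijective.1 fun i => hφ i (Finset.mem_univ i)),
      Finset.mem_univ _, rfl⟩

lemma integral_comp_perm {n : ℕ} (σ : Equiv.Perm (Fin n)) (F : (Fin n → Idx d) → ℝ) :
    ∫ x, F (x ∘ σ) ∂(idxPow d n) = ∫ x, F x ∂(idxPow d n) :=
  integral_comp_equiv σ F

/-- Moving σ from one factor to the other replaces it by σ⁻¹, which only reindexes the sum. -/
lemma integral_symmetrization_mul {n : ℕ} {f g : (Fin n → Idx d) → ℝ}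
    (hf : MemLp f 2 (idxPow d n)) (hg : MemLp g 2 (idxPow d n)) :
    ∫ x, symmetrization f x * g x ∂(idxPow d n) =
      ∫ x, f x * symmetrization g x ∂(idxPow d n) := by
  have hfσ := fun σ => hf.comp_measurePreserving (measurePreserving_perm (d := d) (n := n) σ)
  have hgσ := fun σ => hg.comp_measurePreserving (measurePreserving_perm (d := d) (n := n) σ)
  have h : ∀ σ : Equiv.Perm (Fin n), ∫ x, f (x ∘ σ) * g x ∂(idxPow d n) =
      ∫ x, f x * g (x ∘ ⇑σ⁻¹) ∂(idxPow d n) := by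
    intro σ
    rw [← integral_comp_perm σ⁻¹]
    congr 1
    ext x
    congr 2
    ext1 k
    simp
  simp only [symmetrization, mul_assoc, mul_left_comm _ (n.factorial : ℝ)⁻¹]
  have e : ∀ x, f x * ∑ σ : Equiv.Perm (Fin n), g (x ∘ σ) =
      ∑ σ : Equiv.Perm (Fin n), f x * g (x ∘ σ) := fun x => Finset.mul_sum ..
  simp only [Finset.sum_mul, e]
  rw [integral_const_mul, integral_const_mul, integral_finsetSum, integral_finsetSum]
  · congr 1
    rw [Finset.sum_congr rfl fun σ _ => h σ]
    exact Fintype.sum_equiv (Equiv.inv _) _ _ fun σ => rfl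
  · exact fun σ _ => hf.integrable_mul (hgσ σ)
  · exact fun σ _ => (hfσ σ).integrable_mul hg

lemma IsSymmKernel.symmetrization_ae_eq {n : ℕ} {f : (Fin n → Idx d) → ℝ} (hf : IsSymmKernel f) :
    symmetrization f =ᵐ[idxPow d n] f := by
  filter_upwards [ae_all_iff.2 hf.symm] with x hx
  simp only [symmetrization, hx]
  simp [Fintype.card_perm, Nat.factorial_ne_zero]

lemma tpow_sum_single {n : ℕ} (e : Fin n → Idx d) (t : Finset (Fin n)) (x : Fin n → Idx d) :
    tpow (∑ i ∈ t, Finsupp.single (e i) 1) n x = ∏ j, ∑ i ∈ t, corner (e i) (x j) := by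
  simp [tpow, step_single]

/-- Polarization: the symmetrized product is a permanent, to which Ryser's formula applies. Its
products of row sums are tensor powers of sums of corners. -/
lemma symmetrization_prod_corner {n : ℕ} (e : Fin n → Idx d) (x : Fin n → Idx d) :
    symmetrization (fun x => ∏ k, corner (e k) (x k)) x = (n.factorial : ℝ)⁻¹ *
      ∑ t : Finset (Fin n), (-1) ^ t.card * tpow (∑ i ∈ tᶜ, Finsupp.single (e i) 1) n x := by
  simp only [tpow_sum_single, ← sum_perm_prod_eq]
  unfold symmetrization
  congr 1
  refine Fintype.sum_equiv (Equiv.inv _) _ _ fun σ => ?_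
  rw [← Equiv.prod_comp σ]
  simp

/-- The span of the tensor powers of step functions is dense in the symmetric kernels. -/
lemma mem_of_tpow_mem {n : ℕ} {K : Submodule ℝ (Lp ℝ 2 (idxPow d n))}
    (hK : IsClosed (K : Set (Lp ℝ 2 (idxPow d n))))
    (h : ∀ c, (memLp_tpow c n).toLp _ ∈ K) {f : (Fin n → Idx d) → ℝ} (hf : IsSymmKernel f) :
    hf.memLp.toLp f ∈ K := by
  -- A symmetric kernel has to be orthogonal to every R in the complement of `K`.
  have hcK : K = Kᗮᗮ := by
    rw [Submodule.orthogonal_orthogonal_eq_closure, hK.submodule_topologicalClosure_eq]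
  rw [hcK, Submodule.mem_orthogonal]
  intro R hR
  have hR2 : MemLp R 2 (idxPow d n) := Lp.memLp R
  have hRt : ∀ c, ∫ x, R x * tpow c n x ∂(idxPow d n) = 0 := by
    intro c
    have h1 := inner_toLp hR2 (memLp_tpow c n)
    rw [Lp.toLp_coeFn, real_inner_comm] at h1
    rw [← h1]
    exact hR _ (h c)
  -- Over a corner box, symmetrization moves onto the indicator, which polarization writes with
  -- tensor powers orthogonal to R.
  have hS : symmetrization R =ᵐ[idxPow d n] 0 := by
    have hm := memLp_symmetrization hR2
    refine ae_eq_zero_of_setIntegral_cornerSet (hm.integrable (by norm_num)) fun e => ?_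
    have e1 : (fun x : Fin n → Idx d => ∏ k, corner (e k) (x k)) = (cornerSet e).indicator 1 := by
      classical
      ext x
      simp only [corner, Set.indicator_apply, cornerSet, Pi.one_apply]
      rw [Finset.prod_ite_zero]
      simp [Set.mem_pi]
    have hcm : MemLp (fun x : Fin n → Idx d => ∏ k, corner (e k) (x k)) 2 (idxPow d n) := by
      rw [e1]
      exact (memLp_const 1).indicator (measurableSet_cornerSet e)
    have e2 : ∀ x, (cornerSet e).indicator (symmetrization R) x =
        symmetrization R x * ∏ k, corner (e k) (x k) := by
      intro x
      rw [congrFun e1 x]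
      by_cases hx : x ∈ cornerSet e <;> simp [hx]
    rw [← integral_indicator (measurableSet_cornerSet e)]
    simp only [e2]
    rw [integral_symmetrization_mul hR2 hcm]
    simp only [symmetrization_prod_corner, Finset.mul_sum, mul_left_comm (R _)]
    rw [integral_finsetSum]
    · refine Finset.sum_eq_zero fun t _ => ?_
      rw [integral_const_mul, integral_const_mul, hRt, mul_zero, mul_zero]
    · exact fun t _ => ((hR2.integrable_mul (memLp_tpow _ n)).const_mul _).const_mul _
  have h2 := inner_toLp hR2 hf.memLp
  rw [Lp.toLp_coeFn] at h2
  rw [h2, integral_congr_ae (g := fun x => R x * symmetrization f x), ← integral_symmetrization_mul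
    hR2 hf.memLp, integral_congr_ae (g := fun _ => 0), integral_zero]
  · filter_upwards [hS] with x hx
    simp [hx]
  · filter_upwards [hf.symmetrization_ae_eq] with x hx
    rw [hx]

/-! ### Products of tensor powers -/

/-- The tensor product of the tensor power of order `a` of one step function by the tensor power
of order `n - a` of another one. -/
noncomputable def tmul (c c' : Idx d →₀ ℝ) (n a : ℕ) (x : Fin n → Idx d) : ℝ :=
  ∏ k : Fin n, if (k : ℕ) < a then step c (x k) else step c' (x k)

lemma memLp_tmul (c c' : Idx d →₀ ℝ) (n a : ℕ) : MemLp (tmul c c' n a) 2 (idxPow d n) := by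
  obtain ⟨C, hC⟩ := exists_abs_step_le c
  obtain ⟨C', hC'⟩ := exists_abs_step_le c'
  have hm : Measurable (tmul c c' n a) := by
    refine Finset.measurable_fun_prod _ fun k _ => ?_
    split_ifs
    · exact (measurable_step _).comp (measurable_pi_apply k)
    · exact (measurable_step _).comp (measurable_pi_apply k)
  refine MemLp.of_bound hm.aestronglyMeasurable (max C C' ^ n) (ae_of_all _ fun x => ?_)
  rw [tmul, Real.norm_eq_abs, Finset.abs_prod]
  refine (Finset.prod_le_prod (g := fun _ => max C C') (fun _ _ => abs_nonneg _)
    fun k _ => ?_).trans_eq (by simp)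
  split_ifs
  · exact (hC _).trans (le_max_left _ _)
  · exact (hC' _).trans (le_max_right _ _)

lemma prod_splitMap {a b n : ℕ} (h : a + b = n) (u v : Idx d → ℝ) (x : Fin n → Idx d) :
    (∏ k, u ((splitMap h x).1 k)) * ∏ k, v ((splitMap h x).2 k) =
      ∏ k : Fin n, if (k : ℕ) < a then u (x k) else v (x k) := by
  subst h
  rw [Fin.prod_univ_add]
  simp [splitMap, Fin.castAdd, Fin.natAdd, Fin.castLE]

lemma prod_joinMap {a b n : ℕ} (h : n = a + b) (u : Idx d → ℝ)
    (z : (Fin a → Idx d) × (Fin b → Idx d)) :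
    ∏ k, u (joinMap h z k) = (∏ k, u (z.1 k)) * ∏ k, u (z.2 k) := by
  subst h
  rw [Fin.prod_univ_add]
  simp [joinMap]

/-- The integrand factors, and Fubini turns the integral over u into i equal factors. -/
lemma contraction_tpow {p q : ℕ} (i : Fin (min p q + 1)) (c c' : Idx d →₀ ℝ) :
    contraction i (tpow c p) (tpow c' q) =
      (∫ x, step c x * step c' x ∂(idxMeasure d)) ^ (i : ℕ) •
        tmul c c' (p + q - 2 * i) (p - i) := by
  ext x
  have h := integral_fintype_prod_eq_prod (𝕜 := ℝ) (ι := Fin (i : ℕ))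
    (μ := fun _ => idxMeasure d) (fun _ x => step c x * step c' x)
  simp only [Finset.prod_const, Finset.card_univ, Fintype.card_fin] at h
  have hs : tmul c c' (p + q - 2 * i) (p - i) x = _ :=
    (prod_splitMap (by omega : (p - i) + (q - i) = p + q - 2 * i) (step c) (step c') x).symm
  rw [contraction_eq, Pi.smul_apply, smul_eq_mul, ← h, hs, Function.comp_apply,
    ← integral_mul_const]
  refine integral_congr_ae (ae_of_all _ fun u => ?_)
  simp only [Function.comp_apply, tpow, prod_joinMap, Finset.prod_mul_distrib]
  ring

/-- Only the number of places carrying v matters: the permutation τ moves `S` to the last `S.card`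
positions and is absorbed by the symmetrization. -/
lemma symmetrization_prod_ite {n : ℕ} (u v : Idx d → ℝ) (S : Finset (Fin n)) (x : Fin n → Idx d) :
    symmetrization (fun x => ∏ k, if k ∈ S then v (x k) else u (x k)) x =
      symmetrization (fun x => ∏ k : Fin n, if (k : ℕ) < n - S.card then u (x k) else v (x k)) x := by
  have hS : S.card ≤ n := by simpa using S.card_le_univ
  have hcard : Fintype.card {k // k ∈ S} = Fintype.card {k : Fin n // ¬ (k : ℕ) < n - S.card} := by
    have h1 : Fintype.card {k : Fin n // (k : ℕ) < n - S.card} = n - S.card := by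
      rw [Fintype.card_subtype, Fin.card_filter_val_lt]
      omega
    rw [Fintype.card_subtype_compl, h1, Fintype.card_fin, Fintype.card_coe]
    omega
  set τ : Equiv.Perm (Fin n) := (Fintype.equivOfCardEq hcard).extendSubtype
  have hτ : ∀ k, (τ k : ℕ) < n - S.card ↔ k ∉ S := by
    intro k
    by_cases hk : k ∈ S
    · exact iff_of_false ((Fintype.equivOfCardEq hcard).extendSubtype_mem k hk) (not_not.2 hk)
    · exact iff_of_true (not_not.1 ((Fintype.equivOfCardEq hcard).extendSubtype_not_mem k hk)) hk
  unfold symmetrization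
  congr 1
  refine Fintype.sum_equiv (Equiv.mulRight τ⁻¹) _ _ fun σ => ?_
  refine Eq.trans ?_ (Equiv.prod_comp τ _)
  refine Finset.prod_congr rfl fun k _ => ?_
  by_cases hk : k ∈ S <;> simp [hτ, hk]

/-- The tensor power equals its symmetrization; expanding over subsets and grouping by cardinality
gives a binomial formula, whose powers of t will be compared. -/
lemma tpow_add_smul (c c' : Idx d →₀ ℝ) (n : ℕ) (t : ℝ) (x : Fin n → Idx d) :
    tpow (c + t • c') n x = ∑ m ∈ Finset.range (n + 1),
      t ^ m * (n.choose m * symmetrization (tmul c c' n (n - m)) x) := by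
  have h1 : ∀ x : Fin n → Idx d, tpow (c + t • c') n x = ∑ S : Finset (Fin n),
      t ^ S.card * ∏ k, if k ∈ S then step c' (x k) else step c (x k) := by
    intro x
    simp only [tpow, map_add, map_smul, Pi.add_apply, Pi.smul_apply, smul_eq_mul]
    simp only [add_comm (step c _)]
    rw [Finset.prod_add, Finset.powerset_univ]
    refine Finset.sum_congr rfl fun S _ => ?_
    rw [Finset.prod_mul_distrib, Finset.prod_const, Finset.prod_ite, mul_assoc]
    congr 2
    · simp
    · congr 1
      ext k
      simp
  have h2 : tpow (c + t • c') n x = symmetrization (tpow (c + t • c') n) x := by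
    have h : ∀ σ : Equiv.Perm (Fin n), tpow (c + t • c') n (x ∘ σ) = tpow (c + t • c') n x :=
      fun σ => Equiv.prod_comp σ fun k => step (c + t • c') (x k)
    simp [symmetrization, h, Fintype.card_perm, Nat.factorial_ne_zero]
  have h3 : symmetrization (tpow (c + t • c') n) x = ∑ S : Finset (Fin n),
      t ^ S.card * symmetrization (tmul c c' n (n - S.card)) x := by
    have h4 : ∀ S : Finset (Fin n), symmetrization (tmul c c' n (n - S.card)) x =
        symmetrization (fun x => ∏ k, if k ∈ S then step c' (x k) else step c (x k)) x :=
      fun S => (symmetrization_prod_ite (step c) (step c') S x).symm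
    simp only [h4]
    simp only [symmetrization, h1]
    rw [Finset.sum_comm, Finset.mul_sum]
    refine Finset.sum_congr rfl fun S _ => ?_
    rw [← Finset.mul_sum]
    ring
  rw [h2, h3, ← Finset.powerset_univ, Finset.sum_powerset_apply_card fun m =>
    t ^ m * symmetrization (tmul c c' n (n - m)) x, Finset.card_univ, Fintype.card_fin]
  refine Finset.sum_congr rfl fun m _ => ?_
  rw [nsmul_eq_mul]
  ring

end

section

variable {d : ℕ} {μ : Measure (Space d)}

/-! ### The product formula -/

section LinearCombinations

variable {α ι : Type*} {m : MeasurableSpace α} {ν : Measure α}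

lemma coeFn_sum_smul {r : ℝ≥0∞} (s : Finset ι) (a : ι → ℝ) (F : ι → Lp ℝ r ν) :
    (∑ i ∈ s, a i • F i : Lp ℝ r ν) =ᵐ[ν] fun x => ∑ i ∈ s, a i * F i x := by
  have h : ∀ᵐ x ∂ν, ∀ i ∈ s, (a i • F i) x = a i * F i x :=
    (ae_ball_iff s.countable_toSet).2 fun i _ => Lp.coeFn_smul (a i) (F i)
  filter_upwards [Lp.coeFn_finsetSum s fun i => a i • F i, h] with x h1 h2
  rw [h1, Finset.sum_apply]
  exact Finset.sum_congr rfl fun i hi => h2 i hi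

lemma toLp_eq_sum_smul {s : Finset ι} {a : ι → ℝ} {f : α → ℝ} {g : ι → α → ℝ}
    (hf : MemLp f 2 ν) (hg : ∀ i, MemLp (g i) 2 ν) (h : ∀ x, f x = ∑ i ∈ s, a i * g i x) :
    hf.toLp f = ∑ i ∈ s, a i • (hg i).toLp (g i) := by
  refine Lp.ext ?_
  have hg' : ∀ᵐ x ∂ν, ∀ i ∈ s, (hg i).toLp (g i) x = g i x :=
    (ae_ball_iff s.countable_toSet).2 fun i _ => (hg i).coeFn_toLp
  filter_upwards [hf.coeFn_toLp, coeFn_sum_smul s a fun i => (hg i).toLp (g i), hg']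
    with x h1 h2 h3
  rw [h1, h2, h]
  exact Finset.sum_congr rfl fun i hi => by rw [h3 i hi]

end LinearCombinations

/-- Both sides are the coefficients of tᵐ in the integral of (c + tc')^{⊗n}: one by linearity, the
other because that integral is a Hermite polynomial of W(c) + tW(c'). -/
lemma iterInt_symmetrization_tmul (hμ : IsWienerMeasure μ) (c c' : Idx d →₀ ℝ) {n m : ℕ}
    (hm : m ≤ n) : ∀ᵐ w ∂μ,
    n.choose m * iterInt hμ n ((memLp_symmetrization (memLp_tmul c c' n (n - m))).toLp _) w =
      herm₂ (∫ x, step c x * step c x ∂(idxMeasure d)) (∫ x, step c x * step c' x ∂(idxMeasure d))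
        (∫ x, step c' x * step c' x ∂(idxMeasure d)) (wien c w) (wien c' w) (n - m) m := by
  set α := ∫ x, step c x * step c x ∂(idxMeasure d)
  set β := ∫ x, step c x * step c' x ∂(idxMeasure d)
  set γ := ∫ x, step c' x * step c' x ∂(idxMeasure d)
  set T : ℕ → Lp ℝ 2 (idxPow d n) := fun m =>
    (memLp_symmetrization (memLp_tmul c c' n (n - m))).toLp _
  -- Natural t keep the exceptional sets countable in number, while being infinitely many they still
  -- determine the coefficients.
  have h : ∀ᵐ w ∂μ, ∀ t : ℕ, ∑ m ∈ Finset.range (n + 1),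
      (n.choose m * iterInt hμ n (T m) w - herm₂ α β γ (wien c w) (wien c' w) (n - m) m) *
        (t : ℝ) ^ m = 0 := by
    refine ae_all_iff.2 fun t => ?_
    have h1 := iterInt_tpow hμ (c + (t : ℝ) • c') n
    rw [toLp_eq_sum_smul (memLp_tpow (c + (t : ℝ) • c') n)
      (fun m => memLp_symmetrization (memLp_tmul c c' n (n - m)))
      (s := Finset.range (n + 1)) (a := fun m => t ^ m * n.choose m)
      (fun x => by simp only [tpow_add_smul, mul_assoc]), map_sum] at h1
    simp only [map_smul] at h1
    filter_upwards [h1, coeFn_sum_smul (Finset.range (n + 1)) (fun m => (t : ℝ) ^ m * n.choose m)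
      (fun m => iterInt hμ n (T m))] with w h2 h3
    rw [h3] at h2
    rw [step_add_smul_mul_self] at h2
    simp only [map_add, map_smul, Pi.add_apply, Pi.smul_apply, smul_eq_mul] at h2
    rw [herm_add_mul, sum_antidiagonal_eq_sum_range fun i j =>
      (t : ℝ) ^ j * herm₂ α β γ (wien c w) (wien c' w) i j] at h2
    simp only [sub_mul, Finset.sum_sub_distrib]
    rw [sub_eq_zero]
    refine Eq.trans ?_ (h2.trans ?_)
    · exact Finset.sum_congr rfl fun m _ => by ring
    · exact Finset.sum_congr rfl fun m _ => by ring
  filter_upwards [h] with w hw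
  have hinf : (Set.range fun t : ℕ => (t : ℝ)).Infinite :=
    Set.infinite_range_of_injective Nat.cast_injective
  have h0 := coeff_eq_zero_of_forall_eq_zero hinf (by rintro _ ⟨t, rfl⟩; exact hw t) hm
  exact sub_eq_zero.1 h0

/-- The integral of the symmetrized contraction of two kernels. -/
noncomputable def iterContr (hμ : IsWienerMeasure μ) {p q : ℕ} (i : Fin (min p q + 1))
    (F : Lp ℝ 2 (idxPow d p)) (G : Lp ℝ 2 (idxPow d q)) : Lp ℝ 2 μ :=
  iterInt hμ _ (symL d _ (contrL i F G))

/-- The coefficient of the contraction in `i` variables in the product of iterated integrals. -/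
noncomputable def contrCoeff (p q i : ℕ) : ℝ :=
  ((p + q - 2 * i).factorial : ℝ) / (i.factorial * (p - i).factorial * (q - i).factorial)

lemma iterContr_toLp (hμ : IsWienerMeasure μ) {p q : ℕ} (i : Fin (min p q + 1))
    {f : (Fin p → Idx d) → ℝ} {g : (Fin q → Idx d) → ℝ} (hf : MemLp f 2 (idxPow d p))
    (hg : MemLp g 2 (idxPow d q)) : iterContr hμ i (hf.toLp f) (hg.toLp g) =
      iterInt hμ _ ((memLp_symmetrization (memLp_contraction i hf hg)).toLp _) := by
  rw [iterContr, contrL_toLp i hf hg, symL_toLp]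

lemma iterContr_tpow (hμ : IsWienerMeasure μ) {p q : ℕ} (i : Fin (min p q + 1))
    (c c' : Idx d →₀ ℝ) : ∀ᵐ w ∂μ, contrCoeff p q i *
      iterContr hμ i ((memLp_tpow c p).toLp _) ((memLp_tpow c' q).toLp _) w =
      (∫ x, step c x * step c' x ∂(idxMeasure d)) ^ (i : ℕ) / ((i : ℕ).factorial : ℝ) *
      herm₂ (∫ x, step c x * step c x ∂(idxMeasure d)) (∫ x, step c x * step c' x ∂(idxMeasure d))
        (∫ x, step c' x * step c' x ∂(idxMeasure d)) (wien c w) (wien c' w) (p - i) (q - i) := by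
  have hi : (i : ℕ) ≤ p ∧ (i : ℕ) ≤ q := by omega
  have h := iterInt_symmetrization_tmul hμ c c' (n := p + q - 2 * i) (m := q - i) (by omega)
  have e : p + q - 2 * i - (q - i) = p - i := by omega
  simp only [e] at h
  have hC : contrL i ((memLp_tpow c p).toLp _) ((memLp_tpow c' q).toLp _) =
      (∫ x, step c x * step c' x ∂(idxMeasure d)) ^ (i : ℕ) •
        (memLp_tmul c c' (p + q - 2 * i) (p - i)).toLp _ := by
    rw [contrL_toLp, ← MemLp.toLp_const_smul, MemLp.toLp_eq_toLp_iff, contraction_tpow]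
  rw [iterContr, hC, map_smul, map_smul, symL_toLp]
  filter_upwards [h, Lp.coeFn_smul ((∫ x, step c x * step c' x ∂(idxMeasure d)) ^ (i : ℕ))
    (iterInt hμ _ ((memLp_symmetrization (memLp_tmul c c' (p + q - 2 * i) (p - i))).toLp _))]
    with w h1 h2
  -- Dividing `contrCoeff` by this binomial coefficient leaves exactly 1/i!.
  have hch := Nat.cast_choose ℝ (by omega : q - (i : ℕ) ≤ p + q - 2 * i)
  rw [e] at hch
  rw [h2, ← h1, Pi.smul_apply, smul_eq_mul, contrCoeff, hch]
  field_simp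

/-- The difference of the two sides of the product formula. -/
noncomputable def productDefect (hμ : IsWienerMeasure μ) {p q : ℕ}
    (F : Lp ℝ 2 (idxPow d p)) (G : Lp ℝ 2 (idxPow d q)) : Lp ℝ 1 μ :=
  have := hμ.isProbabilityMeasure
  (ContinuousLinearMap.mul ℝ ℝ).holderL μ 2 2 1 (iterInt hμ p F) (iterInt hμ q G) -
    -- Multiplying by the constant 1 embeds L²(μ) into L¹(μ), where the product of the two integrals
    -- lives.
    ∑ i : Fin (min p q + 1), contrCoeff p q i •
      (ContinuousLinearMap.mul ℝ ℝ).holderL μ 2 2 1 (iterContr hμ i F G)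
        ((memLp_const (μ := μ) (p := 2) (1 : ℝ)).toLp _)

lemma productDefect_coeFn (hμ : IsWienerMeasure μ) {p q : ℕ}
    (F : Lp ℝ 2 (idxPow d p)) (G : Lp ℝ 2 (idxPow d q)) :
    productDefect hμ F G =ᵐ[μ] fun w => iterInt hμ p F w * iterInt hμ q G w -
      ∑ i : Fin (min p q + 1), contrCoeff p q i * iterContr hμ i F G w := by
  have := hμ.isProbabilityMeasure
  have h1 : ∀ᵐ w ∂μ, ∀ i : Fin (min p q + 1), (ContinuousLinearMap.mul ℝ ℝ).holderL μ 2 2 1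
      (iterContr hμ i F G) ((memLp_const (μ := μ) (p := 2) (1 : ℝ)).toLp _) w = iterContr hμ i F G w := by
    refine ae_all_iff.2 fun i => ?_
    filter_upwards [(ContinuousLinearMap.mul ℝ ℝ).coeFn_holder (r := 1) (iterContr hμ i F G)
      ((memLp_const (μ := μ) (p := 2) (1 : ℝ)).toLp _), (memLp_const (μ := μ) (p := 2) (1 : ℝ)).coeFn_toLp]
      with w h2 h3
    rw [ContinuousLinearMap.holderL_apply_apply, h2, h3]
    simp
  filter_upwards [Lp.coeFn_sub ((ContinuousLinearMap.mul ℝ ℝ).holderL μ 2 2 1 (iterInt hμ p F)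
      (iterInt hμ q G)) (∑ i : Fin (min p q + 1), contrCoeff p q i •
      (ContinuousLinearMap.mul ℝ ℝ).holderL μ 2 2 1 (iterContr hμ i F G)
        ((memLp_const (μ := μ) (p := 2) (1 : ℝ)).toLp _)), coeFn_sum_smul Finset.univ
      (fun i : Fin (min p q + 1) => contrCoeff p q i) (fun i =>
      (ContinuousLinearMap.mul ℝ ℝ).holderL μ 2 2 1 (iterContr hμ i F G)
        ((memLp_const (μ := μ) (p := 2) (1 : ℝ)).toLp _)), (ContinuousLinearMap.mul ℝ ℝ).coeFn_holder (r := 1)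
        (iterInt hμ p F) (iterInt hμ q G), h1] with w h2 h3 h4 h5
  rw [productDefect, h2, Pi.sub_apply, h3, ContinuousLinearMap.holderL_apply_apply, h4]
  simp only [h5]
  rfl

lemma productDefect_tpow (hμ : IsWienerMeasure μ) {p q : ℕ} (c c' : Idx d →₀ ℝ) :
    productDefect hμ ((memLp_tpow c p).toLp _) ((memLp_tpow c' q).toLp _) = 0 := by
  rw [Lp.eq_zero_iff_ae_eq_zero]
  filter_upwards [productDefect_coeFn hμ ((memLp_tpow c p).toLp _) ((memLp_tpow c' q).toLp _),
    iterInt_tpow hμ c p, iterInt_tpow hμ c' q,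
    ae_all_iff.2 fun i : Fin (min p q + 1) => iterContr_tpow hμ i c c'] with w h1 h2 h3 h4
  rw [h1, h2, h3, herm_mul_herm _ (∫ x, step c x * step c' x ∂(idxMeasure d)),
    Finset.sum_congr rfl fun i _ => h4 i, Finset.sum_range, sub_self]
  rfl

/-- Density is applied one variable at a time: first in the left kernel against a fixed tensor
power, then in the right kernel with f fixed. -/
lemma productDefect_eq_zero (hμ : IsWienerMeasure μ) {p q : ℕ} {f : (Fin p → Idx d) → ℝ}
    {g : (Fin q → Idx d) → ℝ} (hf : IsSymmKernel f) (hg : IsSymmKernel g) :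
    productDefect hμ (hf.memLp.toLp f) (hg.memLp.toLp g) = 0 := by
  have := hμ.isProbabilityMeasure
  have hleft : ∀ c, productDefect hμ (hf.memLp.toLp f) ((memLp_tpow c q).toLp _) = 0 := by
    intro c
    set G := (memLp_tpow c q).toLp _
    let A : Lp ℝ 2 (idxPow d p) →L[ℝ] Lp ℝ 1 μ :=
      (((ContinuousLinearMap.mul ℝ ℝ).holderL μ 2 2 1).flip (iterInt hμ q G)).comp (iterInt hμ p) -
        ∑ i : Fin (min p q + 1), contrCoeff p q i •
        (((ContinuousLinearMap.mul ℝ ℝ).holderL μ 2 2 1).flip ((memLp_const (μ := μ) (p := 2) (1 : ℝ)).toLp _)).comp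
          ((iterInt hμ _).comp ((symL d _).comp ((contrL i).flip G)))
    have hA : ∀ F, A F = productDefect hμ F G := by
      intro F
      simp only [A, _root_.sub_apply, _root_.sum_apply, _root_.smul_apply]
      rfl
    rw [← hA]
    exact mem_of_tpow_mem (K := LinearMap.ker A.toLinearMap) A.isClosed_ker
      (fun c' => (hA _).trans (productDefect_tpow hμ c' c)) hf
  set F := hf.memLp.toLp f
  let A : Lp ℝ 2 (idxPow d q) →L[ℝ] Lp ℝ 1 μ :=
    ((ContinuousLinearMap.mul ℝ ℝ).holderL μ 2 2 1 (iterInt hμ p F)).comp (iterInt hμ q) -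
      ∑ i : Fin (min p q + 1), contrCoeff p q i •
      (((ContinuousLinearMap.mul ℝ ℝ).holderL μ 2 2 1).flip ((memLp_const (μ := μ) (p := 2) (1 : ℝ)).toLp _)).comp
        ((iterInt hμ _).comp ((symL d _).comp (contrL i F)))
  have hA : ∀ G, A G = productDefect hμ F G := by
    intro G
    simp only [A, _root_.sub_apply, _root_.sum_apply, _root_.smul_apply]
    rfl
  rw [← hA]
  exact mem_of_tpow_mem (K := LinearMap.ker A.toLinearMap) A.isClosed_ker
    (fun c => (hA _).trans (hleft c)) hg

/-- The product of two iterated integrals of symmetric kernels. -/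
lemma iterInt_mul_iterInt (hμ : IsWienerMeasure μ) {p q : ℕ} {f : (Fin p → Idx d) → ℝ}
    {g : (Fin q → Idx d) → ℝ} (hf : IsSymmKernel f) (hg : IsSymmKernel g) :
    ∀ᵐ w ∂μ, iterInt hμ p (hf.memLp.toLp f) w * iterInt hμ q (hg.memLp.toLp g) w =
      ∑ i : Fin (min p q + 1), contrCoeff p q i * iterInt hμ _
        ((memLp_symmetrization (memLp_contraction i hf.memLp hg.memLp)).toLp _) w := by
  have h := (Lp.eq_zero_iff_ae_eq_zero).1 (productDefect_eq_zero hμ hf hg)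
  filter_upwards [h, productDefect_coeFn hμ (hf.memLp.toLp f) (hg.memLp.toLp g)] with w h1 h2
  rw [h1] at h2
  simp only [iterContr_toLp] at h2
  exact sub_eq_zero.1 h2.symm

lemma isMultipleWienerIntegral_iff (hμ : IsWienerMeasure μ) {p : ℕ} {f : (Fin p → Idx d) → ℝ}
    (hf : MemLp f 2 (idxPow d p)) {X : Space d → ℝ} :
    IsMultipleWienerIntegral μ f X ↔
      X =ᵐ[μ] fun w => (p.factorial : ℝ) * iterInt hμ p (hf.toLp f) w := by
  constructor
  · rintro ⟨J, hJ, hX⟩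
    filter_upwards [hX, (isIteratedIntegral_iff hμ hf).1 hJ] with w h1 h2
    rw [h1, h2]
  · exact fun hX => ⟨_, (isIteratedIntegral_iff hμ hf).2 EventuallyEq.rfl, hX⟩

end

end Wiener

theorem theorem1 (d p q : ℕ) (μ : Measure (Wiener.Space d)) (hμ : Wiener.IsWienerMeasure μ)
    (f : (Fin p → Wiener.Idx d) → ℝ) (hf : Wiener.IsSymmKernel f)
    (g : (Fin q → Wiener.Idx d) → ℝ) (hg : Wiener.IsSymmKernel g) :
    (∃ X, Wiener.IsMultipleWienerIntegral μ f X) ∧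
    (∃ Y, Wiener.IsMultipleWienerIntegral μ g Y) ∧
    (∀ i : Fin (min p q + 1), Wiener.IsSymmKernel (Wiener.symContraction i f g) ∧
      ∃ Z, Wiener.IsMultipleWienerIntegral μ (Wiener.symContraction i f g) Z) ∧
    ∀ (X Y : Wiener.Space d → ℝ) (Z : Fin (min p q + 1) → Wiener.Space d → ℝ),
      Wiener.IsMultipleWienerIntegral μ f X →
      Wiener.IsMultipleWienerIntegral μ g Y →
      (∀ i, Wiener.IsMultipleWienerIntegral μ (Wiener.symContraction i f g) (Z i)) →
      ∀ᵐ w ∂μ, X w * Y w = ∑ i : Fin (min p q + 1),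
        ((p.factorial : ℝ) * (q.factorial : ℝ) /
          (((i : ℕ).factorial : ℝ) * ((p - (i : ℕ)).factorial : ℝ) *
            ((q - (i : ℕ)).factorial : ℝ))) * Z i w := by
  have hF : ∀ {n : ℕ} {f : (Fin n → Wiener.Idx d) → ℝ},
      MemLp f 2 (Wiener.idxPow d n) → ∃ X, Wiener.IsMultipleWienerIntegral μ f X :=
    fun hf => ⟨_, (Wiener.isMultipleWienerIntegral_iff hμ hf).2 EventuallyEq.rfl⟩
  have hC := fun i => Wiener.memLp_contraction i hf.memLp hg.memLp
  refine ⟨hF hf.memLp, hF hg.memLp, fun i => ⟨Wiener.isSymmKernel_symmetrization (hC i),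
    hF (Wiener.memLp_symmetrization (hC i))⟩, fun X Y Z hX hY hZ => ?_⟩
  filter_upwards [(Wiener.isMultipleWienerIntegral_iff hμ hf.memLp).1 hX,
    (Wiener.isMultipleWienerIntegral_iff hμ hg.memLp).1 hY,
    ae_all_iff.2 fun i => (Wiener.isMultipleWienerIntegral_iff hμ
      (Wiener.memLp_symmetrization (hC i))).1 (hZ i),
    Wiener.iterInt_mul_iterInt hμ hf hg] with w h1 h2 h3 h4
  -- The normalisations p! q! multiply the formula for iterated integrals; the factor (p + q - 2i)!
  -- in `contrCoeff` is the normalisation of the integral `Z i`.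
  rw [h1, h2, mul_mul_mul_comm, h4, Finset.mul_sum]
  refine Finset.sum_congr rfl fun i _ => ?_
  rw [h3, Wiener.contrCoeff]
  ring
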